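/- Let $m\ge 1$ be an integer, $\mu\in\mathbb R$, and let $w:(0,\infty)\to[0,\infty)$ be a vortex profile, i.e. a $C^2$ solution of $$-w''-\tfrac1r w'+\tfrac{m^2}{r^2}w+r^2w+2|w|^2w-2\mu w=0\qquad(r>0)$$ that is bounded as $r\to0^+$ and tends to $0$ as $r\to\infty$. Let $J=\begin{pmatrix}0&-1\\1&0\end{pmatrix}$, $R=\begin{pmatrix}1&0\\0&-1\end{pmatrix}$, and let $(r,\theta)$ be polar coordinates in $\mathbb R^2$. On $L^2(\mathbb R^2,\mathbb C^2)$ let $L_c=-\tfrac12\Delta+\tfrac12r^2$ be the self-adjoint operator of the closed quadratic form $\int_{\mathbb R^2}\big(\tfrac12|\nabla\Psi|^2+\tfrac{r^2}2|\Psi|^2\big)\,dx$ with form domain $H^1(\mathbb R^2,\mathbb C^2)\cap L^2(\mathbb R^2,\mathbb C^2;r^2)$, let $L_w=2|w|^2I+|w|^2e^{2m\theta J}R-\mu I$, and let $A=-J(L_c+L_w)$ with domain $D(A)=D(L_c)$. For $j\in\mathbb Z$ and $\lambda\in\mathbb C$ consider, for pairs $y=(y_+,y_-)$ of $C^2$ functions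 $(0,\infty)\to\mathbb C$, the system $$L_jy=i\lambda Ry,\qquad L_j=\begin{pmatrix}L_j^+&0\\0&L_j^-\end{pmatrix}+|w|^2\begin{pmatrix}2&1\\1&2\end{pmatrix},\qquad L_j^\pm=-\tfrac12\Big(\partial_r^2+\tfrac1r\partial_r\Big)+\tfrac{(j\pm m)^2}{2r^2}+\tfrac12r^2-\mu, \tag{1}$$ and the boundary conditions $$\lim_{r\to0^+}y_\pm(r)\ \text{exists},\qquad \lim_{r\to\infty}y_\pm(r)=0. \tag{2}$$ 1. A number $\lambda\in\mathbb C$ is an eigenvalue of $A$ if and only if for some integer $j$ the system (1) has a nontrivial solution satisfying (2). 2. With $\Phi\in L^2(\mathbb R^2,\mathbb C^2)$ and $\lambda$ associate the complex wave perturbation $v=u_1+iu_2$, where $u=(u_1,u_2)$ is the real field $u=e^{\lambda t}\Phi+\overline{e^{\lambda t}\Phi}$. If $(y_+,y_-)$ is a nontrivial solution of (1)–(2) and $C\in\mathbb C\setminus\{0\}$, then $$\Phi=C\,e^{i(j+m)\theta}y_+(r)\begin{pmatrix}1/2\\-i/2\end{pmatrix}+C\,e^{i(j-m)\theta}y_-(r)\begin{pmatrix}1/2\\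 i/2\end{pmatrix} \tag{3}$$ is an eigenfunction of $A$ for $\lambda$, and the associated perturbation is $$v_{\lambda,j,m}(x,t)=C e^{\lambda t}e^{i(j+m)\theta}y_+(r)+\overline{C e^{\lambda t}e^{i(j-m)\theta}y_-(r)}. \tag{4}$$ Conversely, every eigenfunction of $A$ for $\lambda$ is a finite non-empty sum, over distinct integers $j$, of fields of the form (3) with $C=C_j\ne0$ and nontrivial solutions $(y_+,y_-)=(y_{+,j},y_{-,j})$ of (1)–(2), and its associated perturbation is the sum of the corresponding functions (4). (In particular there is a single term if only one $j$ occurs for $\lambda$.) 3. If $(y_+,y_-)$ is a solution of (1) for $(\lambda,j)$, then $(y_-,y_+)$ is a solution for $(-\lambda,-j)$ and $(\bar y_-,\bar y_+)$ is a solution for $(\bar\lambda,-j)$; if the first solution is nontrivial and satisfies (2), so do the other two. -/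

import Mathlib

open Set Filter Topology MeasureTheory Matrix
open scoped ContDiff ComplexConjugate

noncomputable section

namespace GPVortex

/-! ### The plane, polar coordinates, and the space `L²(ℝ², ℂ²)` -/

/-- The plane `ℝ²` with its Euclidean norm; the radial variable of `x` is `r = ‖x‖`. -/
abbrev Plane := EuclideanSpace ℝ (Fin 2)

/-- `ℂ²` with its Hermitian inner product. -/
abbrev C2 := EuclideanSpace ℂ (Fin 2)

/-- The complexified space `L²(ℝ², ℂ²)` for Lebesgue measure. -/
abbrev L2 := Lp C2 2 (volume : Measure Plane)

/-- The polar angle `θ` of a point of the plane (irrelevant value at the origin). -/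
def angle (x : Plane) : ℝ := Complex.arg ⟨x 0, x 1⟩

/-- The angular factor `e^{i k θ}`. -/
def angularMode (k : ℤ) (x : Plane) : ℂ := Complex.exp (Complex.I * k * angle x)

/-! ### The vortex profile -/

/-- `w` is a radial vortex profile of degree `m` and frequency `μ`: a non-negative solution on
`r > 0` of `-w'' - w'/r + (m²/r²) w + r² w + 2 |w|² w - 2 μ w = 0`, bounded as `r → 0⁺` and
tending to `0` as `r → ∞`. Values of `w` at `r ≤ 0` play no role. -/
structure IsVortexProfile (m : ℤ) (μ : ℝ) (w : ℝ → ℝ) : Prop where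
  contDiffOn : ContDiffOn ℝ 2 w (Ioi 0)
  nonneg : ∀ r, 0 < r → 0 ≤ w r
  equation : ∀ r, 0 < r →
    -deriv (deriv w) r - (1 / r) * deriv w r + ((m : ℝ) ^ 2 / r ^ 2) * w r + r ^ 2 * w r
      + 2 * |w r| ^ 2 * w r - 2 * μ * w r = 0
  bounded_zero : ∃ M : ℝ, ∀ᶠ r in 𝓝[>] (0 : ℝ), |w r| ≤ M
  tendsto_atTop : Tendsto w atTop (𝓝 0)

/-! ### The operator `L_c`, defined by its closed quadratic form -/

/-- `G` is the weak partial derivative `∂Ψ/∂xᵢ`. -/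
def HasWeakPartial (i : Fin 2) (Ψ G : L2) : Prop :=
  ∀ φ : Plane → ℝ, ContDiff ℝ ∞ φ → HasCompactSupport φ →
    ∫ x, (fderiv ℝ φ x (EuclideanSpace.single i 1)) • Ψ x = -∫ x, φ x • G x

/-- `Ψ` lies in the form domain `H¹(ℝ², ℂ²) ∩ L²(ℝ², ℂ²; r²)`, with weak gradient `D`. -/
structure InFormDomain (Ψ : L2) (D : Fin 2 → L2) : Prop where
  weakGradient : ∀ i, HasWeakPartial i Ψ (D i)
  weighted : MemLp (fun x : Plane => ‖x‖ • Ψ x) 2 volume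

/-- The sesquilinear form of `q(Ψ,Ψ) = ∫ (1/2)|∇Ψ|² + (r²/2)|Ψ|²`, linear in `Ψ` and conjugate
linear in `X`; `DΨ` and `DX` are the weak gradients. -/
def harmonicForm (Ψ : L2) (DΨ : Fin 2 → L2) (X : L2) (DX : Fin 2 → L2) : ℂ :=
  ∫ x : Plane, ((1 / 2 : ℂ) * ∑ i, inner ℂ (DX i x) (DΨ i x)
    + ((‖x‖ ^ 2 / 2 : ℝ) : ℂ) * inner ℂ (X x) (Ψ x))

/-- `Ψ ∈ D(L_c)` and `L_c Ψ = G`, where `L_c = -(1/2)Δ + (1/2) r²` is the self-adjoint operator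
of the closed form `q`: `Ψ` lies in the form domain, and `q(Ψ, X) = ⟨G, X⟩` for every `X` in the
form domain (a dense subspace of `L²`, so that `G` is determined by `Ψ`). -/
def LcEq (Ψ G : L2) : Prop :=
  ∃ DΨ, InFormDomain Ψ DΨ ∧
    ∀ X DX, InFormDomain X DX → harmonicForm Ψ DΨ X DX = inner ℂ X G

/-! ### The linearized operator `A = -J (L_c + L_w)` and its eigenvalues -/

/-- The matrix `J`. -/
def matJ : Matrix (Fin 2) (Fin 2) ℂ := !![0, -1; 1, 0]

/-- The matrix `R`. -/
def matR : Matrix (Fin 2) (Fin 2) ℂ := !![1, 0; 0, -1]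

/-- The rotation `e^{φ J} = cos φ I + sin φ J` (as `J² = -I`). -/
def expJ (φ : ℝ) : Matrix (Fin 2) (Fin 2) ℂ :=
  (Real.cos φ : ℂ) • (1 : Matrix (Fin 2) (Fin 2) ℂ) + (Real.sin φ : ℂ) • matJ

/-- The matrix potential `L_w = 2|w|² I + |w|² e^{2mθJ} R - μ I` at the point `x`. -/
def potential (m : ℤ) (μ : ℝ) (w : ℝ → ℝ) (x : Plane) : Matrix (Fin 2) (Fin 2) ℂ :=
  ((2 * |w ‖x‖| ^ 2 : ℝ) : ℂ) • (1 : Matrix (Fin 2) (Fin 2) ℂ)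
    + ((|w ‖x‖| ^ 2 : ℝ) : ℂ) • (expJ (2 * m * angle x) * matR)
    - (μ : ℂ) • (1 : Matrix (Fin 2) (Fin 2) ℂ)

/-- `Φ ∈ D(A) = D(L_c)` and `A Φ = F`, where `A = -J (L_c + L_w)`. -/
def AEq (m : ℤ) (μ : ℝ) (w : ℝ → ℝ) (Φ F : L2) : Prop :=
  ∃ G : L2, LcEq Φ G ∧
    ∀ᵐ x : Plane, (F x).ofLp = (-matJ) *ᵥ ((G x).ofLp + potential m μ w x *ᵥ (Φ x).ofLp)

/-- `Φ` is an eigenfunction of `A` (on `L²(ℝ², ℂ²)`) for `lam`. -/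
def IsEigenfunction (m : ℤ) (μ : ℝ) (w : ℝ → ℝ) (lam : ℂ) (Φ : L2) : Prop :=
  Φ ≠ 0 ∧ AEq m μ w Φ (lam • Φ)

/-- `lam` is an eigenvalue of `A`. -/
def IsEigenvalue (m : ℤ) (μ : ℝ) (w : ℝ → ℝ) (lam : ℂ) : Prop :=
  ∃ Φ : L2, IsEigenfunction m μ w lam Φ

/-! ### The radial pair systems -/

/-- `-(1/2) Δ_r y + (k²/(2r²)) y + (1/2) r² y - μ y`, where `Δ_r = ∂_r² + (1/r) ∂_r`; with
`k = j + m` and `k = j - m` these are the operators `L_j^+` and `L_j^-`. -/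
def radialOp (k : ℤ) (μ : ℝ) (y : ℝ → ℂ) (r : ℝ) : ℂ :=
  -(1 / 2) * (deriv (deriv y) r + (1 / (r : ℂ)) * deriv y r)
    + ((k : ℂ) ^ 2 / (2 * (r : ℂ) ^ 2)) * y r + (1 / 2) * (r : ℂ) ^ 2 * y r - (μ : ℂ) * y r

/-- `y = (yp, ym)` is a solution on `r > 0` of `L_j y = i lam R y`, where
`L_j = diag(L_j^+, L_j^-) + |w|² [[2, 1], [1, 2]]`. -/
structure IsPairSolution (m : ℤ) (μ : ℝ) (w : ℝ → ℝ) (j : ℤ) (lam : ℂ) (yp ym : ℝ → ℂ) :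
    Prop where
  contDiffOn_plus : ContDiffOn ℝ 2 yp (Ioi 0)
  contDiffOn_minus : ContDiffOn ℝ 2 ym (Ioi 0)
  equation_plus : ∀ r : ℝ, 0 < r →
    radialOp (j + m) μ yp r + ((|w r| ^ 2 : ℝ) : ℂ) * (2 * yp r + ym r)
      = Complex.I * lam * yp r
  equation_minus : ∀ r : ℝ, 0 < r →
    radialOp (j - m) μ ym r + ((|w r| ^ 2 : ℝ) : ℂ) * (yp r + 2 * ym r)
      = -(Complex.I * lam * ym r)

/-- The boundary conditions: `lim_{r → 0⁺} y` exists and `lim_{r → ∞} y = 0`. -/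
def BoundaryCondition (y : ℝ → ℂ) : Prop :=
  (∃ l : ℂ, Tendsto y (𝓝[>] 0) (𝓝 l)) ∧ Tendsto y atTop (𝓝 0)

/-- A nontrivial solution of the pair system that satisfies the boundary conditions. -/
structure IsPairMode (m : ℤ) (μ : ℝ) (w : ℝ → ℝ) (j : ℤ) (lam : ℂ) (yp ym : ℝ → ℂ) :
    Prop where
  solution : IsPairSolution m μ w j lam yp ym
  boundary_plus : BoundaryCondition yp
  boundary_minus : BoundaryCondition ym
  nontrivial : ∃ r, 0 < r ∧ (yp r ≠ 0 ∨ ym r ≠ 0)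

/-! ### Eigenfunctions in terms of Fourier modes -/

/-- The field `Φ = Φ₊ (1/2, -i/2) + Φ₋ (1/2, i/2)` with `Φ₊ = e^{i(j+m)θ} yp(r)` and
`Φ₋ = e^{i(j-m)θ} ym(r)`. -/
def modeVector (m j : ℤ) (yp ym : ℝ → ℂ) (x : Plane) : C2 :=
  (angularMode (j + m) x * yp ‖x‖) • !₂[1 / 2, -Complex.I / 2]
    + (angularMode (j - m) x * ym ‖x‖) • !₂[1 / 2, Complex.I / 2]

/-- The complex wave perturbation `v = u₁ + i u₂` that corresponds to the real field
`u = e^{lam t} Φ + c.c.`. -/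
def perturbation (lam : ℂ) (Φ : L2) (t : ℝ) (x : Plane) : ℂ :=
  let z := Complex.exp (lam * t)
  (z * Φ x 0 + conj (z * Φ x 0)) + Complex.I * (z * Φ x 1 + conj (z * Φ x 1))

/-- `v(x,t) = C e^{lam t} e^{i(j+m)θ} yp(r) + conj (C e^{lam t} e^{i(j-m)θ} ym(r))`. -/
def modePerturbation (m j : ℤ) (lam C : ℂ) (yp ym : ℝ → ℂ) (t : ℝ) (x : Plane) : ℂ :=
  C * Complex.exp (lam * t) * angularMode (j + m) x * yp ‖x‖
    + conj (C * Complex.exp (lam * t) * angularMode (j - m) x * ym ‖x‖)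

end GPVortex

end

open GPVortex

open scoped Convolution ENNReal

noncomputable section

namespace GPVortex

section

/-! ### Partial derivatives and weak partial derivatives -/

/-! Pairing with the vectors (1,-i) and (1,i), which diagonalize J, turns the eigenvalue equation
into two scalar equations coupled only through multiplication by |w|² e^{±2imθ}
(`eigen_pointwise_iff`). Such a factor shifts angular Fourier indices by 2m, so the coefficient of
index j+m of one component interacts only with the coefficient of index j-m of the other, and each j
gives a closed radial system. The real task is to show that the L² problem and the classical
boundary value problem agree at both ends of (0,∞).

From an eigenfunction to modes: the weak equation is tested against r^|k| e^{ikθ} g(r²), which is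
smooth on the whole plane. The resulting weak radial equation has test functions that need not
vanish at the origin (`weakRadialEq_of_lcEq`). This excludes the singular solutions r^{-κ} and log
r, so every Fourier coefficient equals r^κ (c + `primitive κ F r`) almost everywhere
(`WeakRadialEq.exists_ae_eq`). Continuity, C² regularity, the differential equation and the limit at
0 are read off from this formula. At infinity the flux r (|y₊|² + |y₋|²)' is eventually
nondecreasing, since r² outweighs the terms with μ and λ, and for a square integrable pair this
forces decay (`IsPairSolution.tendsto_atTop`). If |j ± m| ≥ |μ| + |λ|, then κ²/r² + r² ≥ 2κ makes
the flux nondecreasing on all of (0,∞), and a bounded pair that decays must vanish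
(`IsPairMode.lt_of_mode`). Hence only finitely many j occur, and completeness of the exponentials on
almost every circle identifies Φ with a finite sum of modes (`IsEigenfunction.exists_modes`).

From a mode to an eigenfunction: a bounded solution has no singular part (`exists_regularSol`), so
y' and κ y / r are bounded near 0. Near infinity the flux is nondecreasing and nonpositive, so its
derivative is integrable, which controls r |y'|² and r³ |y|² (`IsPairMode.exists_integrableOn`). The
field e^{ikθ} y(r) therefore lies in the form domain. A divergence theorem with cutoffs at the
origin and at infinity (`integral_divergence_smul`) shows that neither end contributes, so L_c acts
on the field as the classical operator (`ModeProfile.lcEq`).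

The symmetries are algebraic: exchanging the components reverses R, the indices enter only through
their squares, and all coefficients other than iλ are real. -/

/-- The classical partial derivative of a function on the plane. -/
def pderiv {F : Type*} [NormedAddCommGroup F] [NormedSpace ℝ F] (i : Fin 2) (f : Plane → F)
    (x : Plane) : F :=
  fderiv ℝ f x (EuclideanSpace.single i 1)

section pderiv
variable {F : Type*} [NormedAddCommGroup F] [NormedSpace ℝ F] {f : Plane → F} {i : Fin 2}

theorem continuous_pderiv (hf : ContDiff ℝ 1 f) : Continuous (pderiv i f) :=
  (hf.continuous_fderiv one_ne_zero).clm_apply continuous_const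

theorem contDiff_pderiv {m n : WithTop ℕ∞} (hf : ContDiff ℝ n f) (hmn : m + 1 ≤ n) :
    ContDiff ℝ m (pderiv i f) :=
  (hf.fderiv_right hmn).clm_apply contDiff_const

theorem hasCompactSupport_pderiv (hf : HasCompactSupport f) : HasCompactSupport (pderiv i f) :=
  hf.fderiv_apply (𝕜 := ℝ) _

theorem tsupport_pderiv_subset : tsupport (pderiv i f) ⊆ tsupport f :=
  tsupport_fderiv_apply_subset ℝ _

end pderiv

theorem locallyIntegrable_coe (Ψ : L2) : LocallyIntegrable Ψ volume :=
  (Lp.memLp Ψ).locallyIntegrable (by norm_num)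

/-- Mollification: the bump radius `c` lies below the moduli of uniform continuity of `V` and of its
partial derivative, and the derivative of the convolution falls on `V`. Since also `c ≤ 1`, the
supports stay in a compact set that does not depend on `δ`. -/
theorem exists_smooth_approx {V : Plane → ℝ} (hV : ContDiff ℝ 1 V) (hc : HasCompactSupport V)
    {δ : ℝ} (hδ : 0 < δ) (i : Fin 2) :
    ∃ φ : Plane → ℝ, ContDiff ℝ ∞ φ ∧ HasCompactSupport φ ∧
      tsupport φ ⊆ Metric.cthickening 1 (tsupport V) ∧
      (∀ x, |φ x - V x| ≤ δ) ∧ ∀ x, |pderiv i φ x - pderiv i V x| ≤ δ := by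
  have hV' : Continuous (pderiv i V) := continuous_pderiv hV
  have hc' : HasCompactSupport (pderiv i V) := hasCompactSupport_pderiv hc
  obtain ⟨a, ha, ha'⟩ := Metric.uniformContinuous_iff.1
    (hc.uniformContinuous_of_continuous hV.continuous) δ hδ
  obtain ⟨b, hb, hb'⟩ := Metric.uniformContinuous_iff.1
    (hc'.uniformContinuous_of_continuous hV') δ hδ
  let c := min 1 (min a b)
  have hc0 : 0 < c := by positivity
  let ρ : ContDiffBump (0 : Plane) := ⟨c / 2, c, by positivity, by linarith⟩
  have hρ : LocallyIntegrable (ρ.normed volume) (volume : Measure Plane) :=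
    ρ.continuous_normed.locallyIntegrable
  have hVi : LocallyIntegrable V (volume : Measure Plane) := hV.continuous.locallyIntegrable
  have hder : ∀ x, HasFDerivAt (ρ.normed volume ⋆[ContinuousLinearMap.lsmul ℝ ℝ, volume] V)
      ((ρ.normed volume ⋆[(ContinuousLinearMap.lsmul ℝ ℝ).precompR Plane, volume] fderiv ℝ V) x)
      x := fun x => hc.hasFDerivAt_convolution_right _
        hρ hV x
  have hpd : ∀ x, pderiv i (ρ.normed volume ⋆[ContinuousLinearMap.lsmul ℝ ℝ, volume] V) x
      = (ρ.normed volume ⋆[ContinuousLinearMap.lsmul ℝ ℝ, volume] pderiv i V) x := by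
    intro x
    rw [pderiv, (hder x).fderiv, convolution_precompR_apply _
      hρ (hc.fderiv ℝ) (hV.continuous_fderiv one_ne_zero)]
    rfl
  refine ⟨ρ.normed volume ⋆[ContinuousLinearMap.lsmul ℝ ℝ, volume] V,
    ρ.hasCompactSupport_normed.contDiff_convolution_left _ ρ.contDiff_normed
    hVi, ρ.hasCompactSupport_normed.convolution _ hc, ?_, ?_, ?_⟩
  · refine closure_minimal ?_ (Metric.isClosed_cthickening)
    refine (support_convolution_subset _).trans ?_
    rintro _ ⟨u, hu, v, hv, rfl⟩
    rw [ρ.support_normed_eq] at hu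
    refine Metric.mem_cthickening_of_dist_le _ v _ _ (subset_tsupport _ hv) ?_
    simp only [Metric.mem_ball, dist_zero_right] at hu
    simp only [dist_eq_norm, add_sub_cancel_right]
    exact hu.le.trans (min_le_left _ _)
  · intro x
    refine ρ.dist_normed_convolution_le hV.continuous.aestronglyMeasurable fun y hy => ?_
    exact (ha' ((Metric.mem_ball.1 hy).trans_le
      ((min_le_right _ _).trans (min_le_left _ _)))).le
  · intro x
    rw [hpd]
    refine ρ.dist_normed_convolution_le hV'.aestronglyMeasurable fun y hy => ?_
    exact (hb' ((Metric.mem_ball.1 hy).trans_le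
      ((min_le_right _ _).trans (min_le_right _ _)))).le

/-- The definition of a weak derivative allows only smooth tests, whereas cutoffs of mode
derivatives are merely C¹. Uniform approximation of `V` and its derivative within one compact set
`K` suffices, because `Ψ` and `G` are integrable on `K`. -/
theorem HasWeakPartial.integral_pderiv_smul_real {i : Fin 2} {Ψ G : L2}
    (h : HasWeakPartial i Ψ G) {V : Plane → ℝ} (hV : ContDiff ℝ 1 V)
    (hc : HasCompactSupport V) :
    ∫ x, pderiv i V x • Ψ x = -∫ x, V x • G x := by
  set K := Metric.cthickening 1 (tsupport V) with hK
  have hKc : IsCompact K := hc.isCompact.cthickening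
  have hVK : tsupport V ⊆ K := Metric.self_subset_cthickening _
  have hint : ∀ (Θ : L2) (f : Plane → ℝ), Continuous f → HasCompactSupport f →
      Integrable (fun x => f x • Θ x) := fun Θ f hf hf' =>
    (locallyIntegrable_coe Θ).integrable_smul_left_of_hasCompactSupport hf hf'
  have hKi : ∀ Θ : L2, IntegrableOn (fun x => ‖Θ x‖) K := fun Θ =>
    ((locallyIntegrable_coe Θ).integrableOn_isCompact hKc).norm
  have key : ∀ (Θ : L2) (f g : Plane → ℝ) (δ : ℝ), Continuous f → Continuous g →
      tsupport f ⊆ K → tsupport g ⊆ K → (∀ x, |f x - g x| ≤ δ) →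
      ‖(∫ x, f x • Θ x) - ∫ x, g x • Θ x‖ ≤ δ * ∫ x in K, ‖Θ x‖ := by
    intro Θ f g δ hf hg hfK hgK hfg
    have hfc : HasCompactSupport f := hKc.of_isClosed_subset (isClosed_tsupport _) hfK
    have hgc : HasCompactSupport g := hKc.of_isClosed_subset (isClosed_tsupport _) hgK
    rw [← integral_sub (hint Θ f hf hfc) (hint Θ g hg hgc), ← integral_const_mul,
      ← integral_indicator hKc.measurableSet]
    refine norm_integral_le_of_norm_le
      (IntegrableOn.integrable_indicator ((hKi Θ).const_mul δ) hKc.measurableSet) (ae_of_all _ fun x => ?_)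
    by_cases hx : x ∈ K
    · rw [indicator_of_mem hx, ← sub_smul, norm_smul]
      exact mul_le_mul_of_nonneg_right (hfg x) (norm_nonneg _)
    · have h1 : f x = 0 := image_eq_zero_of_notMem_tsupport fun h => hx (hfK h)
      have h2 : g x = 0 := image_eq_zero_of_notMem_tsupport fun h => hx (hgK h)
      simp [h1, h2, hx]
  rw [eq_neg_iff_add_eq_zero, ← norm_eq_zero]
  refine le_antisymm (le_of_forall_pos_le_add fun ε hε => ?_) (norm_nonneg _)
  set B := (∫ x in K, ‖Ψ x‖) + ∫ x in K, ‖G x‖ with hB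
  have hB0 : 0 ≤ B := by positivity
  -- The total error is at most `δ * B`; dividing by `B + 1` also covers `B = 0`.
  obtain ⟨φ, h1, h2, h3, h4, h5⟩ := exists_smooth_approx hV hc
    (δ := ε / (B + 1)) (by positivity) i
  have e1 := key Ψ _ _ _ (continuous_pderiv (i := i) (h1.of_le (by simp)))
    (continuous_pderiv (i := i) hV)
    (tsupport_pderiv_subset.trans h3) (tsupport_pderiv_subset.trans hVK) h5
  have e2 := key G _ _ _ h1.continuous hV.continuous h3 hVK h4
  have e3 : ∫ x, pderiv i φ x • Ψ x = -∫ x, φ x • G x := h φ h1 h2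
  rw [e3] at e1
  have e4 : (∫ x, pderiv i V x • Ψ x) + ∫ x, V x • G x
      = -((-∫ x, φ x • G x) - ∫ x, pderiv i V x • Ψ x)
        - ((∫ x, φ x • G x) - ∫ x, V x • G x) := by abel
  rw [e4, zero_add]
  refine (norm_sub_le _ _).trans ?_
  rw [norm_neg]
  refine (add_le_add e1 e2).trans ?_
  rw [← mul_add, ← hB, div_mul_eq_mul_div, div_le_iff₀ (by positivity)]
  nlinarith

theorem HasWeakPartial.integral_pderiv_smul {i : Fin 2} {Ψ G : L2}
    (h : HasWeakPartial i Ψ G) {V : Plane → ℂ} (hV : ContDiff ℝ 1 V)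
    (hc : HasCompactSupport V) :
    ∫ x, pderiv i V x • Ψ x = -∫ x, V x • G x := by
  have hre : ContDiff ℝ 1 fun x => (V x).re := Complex.reCLM.contDiff.comp hV
  have him : ContDiff ℝ 1 fun x => (V x).im := Complex.imCLM.contDiff.comp hV
  have cre : HasCompactSupport fun x => (V x).re := hc.comp_left (g := Complex.re) rfl
  have cim : HasCompactSupport fun x => (V x).im := hc.comp_left (g := Complex.im) rfl
  have dre : ∀ x, pderiv i (fun x => (V x).re) x = (pderiv i V x).re := fun x => by
    have := (Complex.reCLM.hasFDerivAt.comp x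
      (hV.differentiable one_ne_zero x).hasFDerivAt).fderiv
    exact congrArg (fun L => L (EuclideanSpace.single i 1)) this
  have dim : ∀ x, pderiv i (fun x => (V x).im) x = (pderiv i V x).im := fun x => by
    have := (Complex.imCLM.hasFDerivAt.comp x
      (hV.differentiable one_ne_zero x).hasFDerivAt).fderiv
    exact congrArg (fun L => L (EuclideanSpace.single i 1)) this
  have hint : ∀ (Θ : L2) (f : Plane → ℝ), Continuous f → HasCompactSupport f →
      Integrable (fun x => f x • Θ x) := fun Θ f hf hf' =>
    (locallyIntegrable_coe Θ).integrable_smul_left_of_hasCompactSupport hf hf'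
  have hintI : ∀ (Θ : L2) (f : Plane → ℝ), Continuous f → HasCompactSupport f →
      Integrable (fun x => Complex.I • f x • Θ x) := fun Θ f hf hf' =>
    (hint Θ f hf hf').smul Complex.I
  have split : ∀ (z : ℂ) (v : C2), z • v = z.re • v + Complex.I • (z.im • v) := fun z v => by
    conv_lhs => rw [← Complex.re_add_im z]
    rw [add_smul, mul_comm, mul_smul]; simp
  have e1 := h.integral_pderiv_smul_real hre cre
  have e2 := h.integral_pderiv_smul_real him cim
  simp_rw [split (pderiv i V _), split (V _), ← dre, ← dim]
  rw [integral_add (hint _ _ (continuous_pderiv hre) (hasCompactSupport_pderiv cre))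
      (hintI _ _ (continuous_pderiv him) (hasCompactSupport_pderiv cim)),
    integral_add (hint _ _ hre.continuous cre) (hintI _ _ him.continuous cim),
    integral_smul, integral_smul, e1, e2, smul_neg]
  abel

end

/-! ### Testing the weak equation -/

theorem pderiv_conj {V : Plane → ℂ} (i : Fin 2) {x : Plane} (hV : DifferentiableAt ℝ V x) :
    pderiv i (fun x => conj (V x)) x = conj (pderiv i V x) := by
  have := (Complex.conjCLE.toContinuousLinearMap.hasFDerivAt.comp x hV.hasFDerivAt).fderiv
  exact congrArg (fun L => L (EuclideanSpace.single i 1)) this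

theorem contDiff_conj_comp {V : Plane → ℂ} {n : WithTop ℕ∞} (hV : ContDiff ℝ n V) :
    ContDiff ℝ n fun x => conj (V x) :=
  Complex.conjCLE.toContinuousLinearMap.contDiff.comp hV

theorem hasCompactSupport_conj_comp {V : Plane → ℂ} (hV : HasCompactSupport V) :
    HasCompactSupport fun x => conj (V x) :=
  hV.comp_left (g := conj) (map_zero _)

theorem integrable_smul_coe (Θ : L2) {f : Plane → ℂ} (hf : Continuous f)
    (hf' : HasCompactSupport f) : Integrable (fun x => f x • Θ x) :=
  (locallyIntegrable_coe Θ).integrable_smul_left_of_hasCompactSupport hf hf'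

/-- A continuous compactly supported scalar function times a fixed vector is in `L²`. -/
theorem memLp_smul_vec {ψ : Plane → ℂ} (h : Continuous ψ) (hc : HasCompactSupport ψ) (e : C2) :
    MemLp (fun x => ψ x • e) 2 (volume : Measure Plane) :=
  (h.smul continuous_const).memLp_of_hasCompactSupport hc.smul_right

theorem hasWeakPartial_smul_vec {ψ : Plane → ℂ} (h : ContDiff ℝ 1 ψ)
    (hc : HasCompactSupport ψ) (e : C2) (i : Fin 2) :
    HasWeakPartial i ((memLp_smul_vec h.continuous hc e).toLp _)
      ((memLp_smul_vec (continuous_pderiv (i := i) h) (hasCompactSupport_pderiv hc) e).toLp _) := by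
  intro φ hφ hφc
  have hφ1 : ContDiff ℝ 1 φ := hφ.of_le (by simp)
  have e1 : ∀ (u : Plane → ℝ) (v : Plane → ℂ) (hv : MemLp (fun x => v x • e) 2 volume),
      ∫ x, u x • (hv.toLp _ : L2) x = ∫ x, u x • v x • e := by
    intro u v hv
    refine integral_congr_ae ?_
    filter_upwards [hv.coeFn_toLp] with x hx
    rw [hx]
  rw [e1, e1]
  have hd : ∀ x, pderiv i ψ x • e = fderiv ℝ (fun x => ψ x • e) x (EuclideanSpace.single i 1) := by
    intro x
    rw [fderiv_smul_const (h.differentiable one_ne_zero x)]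
    rfl
  simp_rw [hd]
  rw [integral_smul_fderiv_eq_neg_fderiv_smul_of_integrable, neg_neg]
  · exact ((continuous_pderiv (i := i) hφ1).smul (h.continuous.smul continuous_const)
      ).integrable_of_hasCompactSupport (hasCompactSupport_pderiv hφc).smul_right
  · simp_rw [← hd]
    exact (hφ1.continuous.smul ((continuous_pderiv (i := i) h).smul continuous_const)
      ).integrable_of_hasCompactSupport hφc.smul_right
  · exact (hφ1.continuous.smul (h.continuous.smul continuous_const)
      ).integrable_of_hasCompactSupport hφc.smul_right
  · exact fun x _ => (hφ1.differentiable one_ne_zero x)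
  · exact fun x _ => ((h.differentiable one_ne_zero x).smul_const e)

/-- These fields are the elements of the form domain that are inserted for `X` in the identity
defining L_c. -/
theorem inFormDomain_smul_vec {ψ : Plane → ℂ} (h : ContDiff ℝ 1 ψ)
    (hc : HasCompactSupport ψ) (e : C2) :
    InFormDomain ((memLp_smul_vec h.continuous hc e).toLp _) (fun i =>
      (memLp_smul_vec (continuous_pderiv (i := i) h) (hasCompactSupport_pderiv hc) e).toLp _) := by
  refine ⟨hasWeakPartial_smul_vec h hc e, ?_⟩
  have h1 : MemLp (fun x : Plane => ((‖x‖ : ℂ) * ψ x) • e) 2 volume :=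
    memLp_smul_vec ((Complex.continuous_ofReal.comp continuous_norm).mul h.continuous)
      hc.mul_left e
  refine h1.ae_eq ?_
  filter_upwards [(memLp_smul_vec h.continuous hc e).coeFn_toLp] with x hx
  rw [hx, mul_smul, Complex.coe_smul]

/-- The equation `L_c Ψ = G`, tested against smooth functions, in distributional form. -/
theorem LcEq.integral_test {Ψ G : L2} (h : LcEq Ψ G) {ψ : Plane → ℂ} (hψ : ContDiff ℝ 2 ψ)
    (hc : HasCompactSupport ψ) (e : C2) :
    ∫ x, conj (-(1 / 2 : ℂ) * (∑ i, pderiv i (pderiv i ψ) x) + ((‖x‖ ^ 2 / 2 : ℝ) : ℂ) * ψ x)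
        * inner ℂ e (Ψ x)
      = ∫ x, conj (ψ x) * inner ℂ e (G x) := by
  obtain ⟨D, ⟨hD, -⟩, hq⟩ := h
  have h1 : ContDiff ℝ 1 ψ := hψ.of_le (by norm_num)
  have hp : ∀ i, ContDiff ℝ 1 (pderiv i ψ) := fun i => contDiff_pderiv hψ (by norm_num)
  have hpc : ∀ i, HasCompactSupport (pderiv i ψ) := fun i => hasCompactSupport_pderiv hc
  have hpp : ∀ i, Continuous (pderiv i (pderiv i ψ)) := fun i => continuous_pderiv (hp i)
  have hppc : ∀ i, HasCompactSupport (pderiv i (pderiv i ψ)) := fun i =>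
    hasCompactSupport_pderiv (hpc i)
  have hn : Continuous fun x : Plane => ((‖x‖ ^ 2 / 2 : ℝ) : ℂ) := by fun_prop
  have hint : ∀ (Θ : L2) (f : Plane → ℂ), Continuous f → HasCompactSupport f →
      Integrable (fun x => inner ℂ e (conj (f x) • Θ x)) := fun Θ f hf hf' =>
    (integrable_smul_coe Θ (Complex.continuous_conj.comp hf)
      (hasCompactSupport_conj_comp hf')).const_inner e
  have hq' := hq _ _ (inFormDomain_smul_vec h1 hc e)
  rw [L2.inner_def] at hq'
  have eR : ∫ x, inner ℂ (((memLp_smul_vec h1.continuous hc e).toLp _ : L2) x) (G x)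
      = ∫ x, conj (ψ x) * inner ℂ e (G x) := by
    refine integral_congr_ae ?_
    filter_upwards [(memLp_smul_vec h1.continuous hc e).coeFn_toLp] with x hx
    rw [hx, inner_smul_left]
  rw [← eR, ← hq', harmonicForm]
  -- The weak derivative of `Ψ` is moved onto `∂ᵢψ`, which is only C¹ when `ψ` is C².
  have eL : ∀ i, ∫ x, inner ℂ e (conj (pderiv i ψ x) • D i x)
      = -∫ x, inner ℂ e (conj (pderiv i (pderiv i ψ) x) • Ψ x) := by
    intro i
    have g1 : Integrable fun x => conj (pderiv i ψ x) • D i x :=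
      integrable_smul_coe _ (Complex.continuous_conj.comp (hp i).continuous)
        (hasCompactSupport_conj_comp (hpc i))
    have g2 : Integrable fun x => conj (pderiv i (pderiv i ψ) x) • Ψ x :=
      integrable_smul_coe _ (Complex.continuous_conj.comp (hpp i))
        (hasCompactSupport_conj_comp (hppc i))
    rw [integral_inner g1, integral_inner g2, ← inner_neg_right]
    congr 1
    have := (hD i).integral_pderiv_smul (contDiff_conj_comp (hp i))
      (hasCompactSupport_conj_comp (hpc i))
    rw [eq_neg_iff_add_eq_zero, add_comm, ← eq_neg_iff_add_eq_zero, ← this]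
    refine integral_congr_ae (ae_of_all _ fun x => ?_)
    simp only [pderiv_conj i ((hp i).differentiable one_ne_zero x)]
  have hI1 : ∀ i, Integrable fun x => inner ℂ e (conj (pderiv i ψ x) • D i x) := fun i =>
    hint _ _ (hp i).continuous (hpc i)
  have hI2 : ∀ i, Integrable fun x => inner ℂ e (conj (pderiv i (pderiv i ψ) x) • Ψ x) :=
    fun i => hint _ _ (hpp i) (hppc i)
  have hI3 : Integrable fun x => inner ℂ e (conj (((‖x‖ ^ 2 / 2 : ℝ) : ℂ) * ψ x) • Ψ x) :=
    hint _ _ (hn.mul hψ.continuous) hc.mul_left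
  have L : ∫ x, conj (-(1 / 2 : ℂ) * (∑ i, pderiv i (pderiv i ψ) x)
        + ((‖x‖ ^ 2 / 2 : ℝ) : ℂ) * ψ x) * inner ℂ e (Ψ x)
      = ∫ x, ((-(1 / 2 : ℂ)) * (∑ i, inner ℂ e (conj (pderiv i (pderiv i ψ) x) • Ψ x))
        + inner ℂ e (conj (((‖x‖ ^ 2 / 2 : ℝ) : ℂ) * ψ x) • Ψ x)) := by
    refine integral_congr_ae (ae_of_all _ fun x => ?_)
    simp only [inner_smul_right, map_add, map_mul, map_neg, map_div₀, map_one, map_sum,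
      ← Finset.sum_mul, Complex.conj_ofNat]
    ring
  have Rr : ∫ x, ((1 / 2 : ℂ) * ∑ i, inner ℂ
          (((memLp_smul_vec (continuous_pderiv (i := i) h1) (hasCompactSupport_pderiv hc) e).toLp _
            : L2) x) (D i x)
        + ((‖x‖ ^ 2 / 2 : ℝ) : ℂ) *
          inner ℂ (((memLp_smul_vec h1.continuous hc e).toLp _ : L2) x) (Ψ x))
      = ∫ x, ((1 / 2 : ℂ) * (∑ i, inner ℂ e (conj (pderiv i ψ x) • D i x))
        + inner ℂ e (conj (((‖x‖ ^ 2 / 2 : ℝ) : ℂ) * ψ x) • Ψ x)) := by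
    refine integral_congr_ae ?_
    have hall : ∀ᵐ x : Plane, ∀ i : Fin 2,
        ((memLp_smul_vec (continuous_pderiv (i := i) h1) (hasCompactSupport_pderiv hc) e).toLp _
            : L2) x = pderiv i ψ x • e :=
      ae_all_iff.2 fun i => (memLp_smul_vec (continuous_pderiv (i := i) h1)
        (hasCompactSupport_pderiv hc) e).coeFn_toLp
    filter_upwards [(memLp_smul_vec h1.continuous hc e).coeFn_toLp, hall] with x hx hx'
    simp only [hx, hx', inner_smul_left, inner_smul_right, map_mul, Complex.conj_ofReal]
    ring
  rw [L, Rr, integral_add ((integrable_finsetSum _ fun i _ => hI2 i).const_mul _) hI3,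
    integral_add ((integrable_finsetSum _ fun i _ => hI1 i).const_mul _) hI3,
    integral_const_mul, integral_const_mul, integral_finsetSum _ fun i _ => hI2 i,
    integral_finsetSum _ fun i _ => hI1 i]
  simp_rw [eL]
  rw [Finset.sum_neg_distrib]
  ring

/-! ### Harmonic polynomials and the Laplacian -/

/-- The real linear map `x ↦ x₀ + ε x₁`. -/
def zetaL (ε : ℂ) : Plane →L[ℝ] ℂ :=
  Complex.ofRealCLM ∘L EuclideanSpace.proj 0 + ε • (Complex.ofRealCLM ∘L EuclideanSpace.proj 1)

theorem zetaL_apply (ε : ℂ) (x : Plane) : zetaL ε x = x 0 + ε * x 1 := by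
  simp [zetaL]

/-- The unit `± i` selecting `z` or its conjugate as the base of the harmonic polynomial. -/
def unitOf (k : ℤ) : ℂ := if 0 ≤ k then Complex.I else -Complex.I

theorem unitOf_sq (k : ℤ) : unitOf k ^ 2 = -1 := by
  unfold unitOf; split_ifs <;> simp

/-- The harmonic homogeneous polynomial `r^|k| e^{i k θ}`. -/
def harm (k : ℤ) (x : Plane) : ℂ := zetaL (unitOf k) x ^ k.natAbs

theorem contDiff_harm (k : ℤ) {n : WithTop ℕ∞} : ContDiff ℝ n (harm k) :=
  (zetaL _).contDiff.pow _

theorem norm_toComplex (x : Plane) : ‖(⟨x 0, x 1⟩ : ℂ)‖ = ‖x‖ := by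
  rw [EuclideanSpace.norm_eq, Complex.norm_eq_sqrt_sq_add_sq]
  simp

theorem toComplex_eq (x : Plane) :
    (⟨x 0, x 1⟩ : ℂ) = ‖x‖ * Complex.exp (Complex.I * angle x) := by
  rw [← norm_toComplex, angle, mul_comm Complex.I, Complex.norm_mul_exp_arg_mul_I]

theorem norm_angularMode (k : ℤ) (x : Plane) : ‖angularMode k x‖ = 1 := by
  rw [angularMode, mul_assoc, mul_comm]
  have : (k : ℂ) * (angle x : ℂ) * Complex.I = ((k * angle x : ℝ) : ℂ) * Complex.I := by
    push_cast; ring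
  rw [this, Complex.norm_exp_ofReal_mul_I]

theorem harm_eq (k : ℤ) (x : Plane) : harm k x = (‖x‖ : ℂ) ^ k.natAbs * angularMode k x := by
  have hz := toComplex_eq x
  unfold harm unitOf angularMode
  rw [zetaL_apply]
  split_ifs with h
  · obtain ⟨n, rfl⟩ := Int.eq_ofNat_of_zero_le h
    have : (x 0 : ℂ) + Complex.I * x 1 = ⟨x 0, x 1⟩ := by
      apply Complex.ext <;> simp
    rw [this, hz, mul_pow, ← Complex.exp_nat_mul]
    congr 2
    simp; ring
  · obtain ⟨n, hn⟩ := Int.eq_ofNat_of_zero_le (le_of_lt (neg_pos.2 (not_le.1 h)))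
    obtain rfl : k = -(n : ℤ) := by linarith
    have : (x 0 : ℂ) + -Complex.I * x 1 = conj (⟨x 0, x 1⟩ : ℂ) := by
      apply Complex.ext <;> simp
    rw [this, hz, map_mul, Complex.conj_ofReal, ← Complex.exp_conj, mul_pow,
      ← Complex.exp_nat_mul]
    congr 2
    simp; ring

theorem norm_harm (k : ℤ) (x : Plane) : ‖harm k x‖ = ‖x‖ ^ k.natAbs := by
  rw [harm_eq, norm_mul, norm_angularMode, mul_one, norm_pow, Complex.norm_real, norm_norm]

/-- `∂ᵢ (x₀ + ε x₁)` -/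
def zetaCoeff (ε : ℂ) (i : Fin 2) : ℂ := zetaL ε (EuclideanSpace.single i 1)

theorem zetaCoeff_zero (ε : ℂ) : zetaCoeff ε 0 = 1 := by simp [zetaCoeff, zetaL_apply]
theorem zetaCoeff_one (ε : ℂ) : zetaCoeff ε 1 = ε := by simp [zetaCoeff, zetaL_apply]

theorem inner_single (x : Plane) (i : Fin 2) :
    inner ℝ x (EuclideanSpace.single i 1) = x i := by
  simp [EuclideanSpace.inner_single_right]

theorem hasFDerivAt_zetaL_pow_mul (ε : ℂ) (n : ℕ) {u : ℝ → ℂ} {u' : ℂ} {x : Plane}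
    (hu : HasDerivAt u u' (‖x‖ ^ 2)) :
    HasFDerivAt (fun x => zetaL ε x ^ n * u (‖x‖ ^ 2))
      (zetaL ε x ^ n • ((2 • innerSL ℝ x).smulRight u')
        + u (‖x‖ ^ 2) • ((n * zetaL ε x ^ (n - 1)) • zetaL ε)) x := by
  have h1 : HasFDerivAt (fun x : Plane => u (‖x‖ ^ 2)) ((2 • innerSL ℝ x).smulRight u') x := by
    refine (hu.hasFDerivAt.comp x (hasStrictFDerivAt_norm_sq x).hasFDerivAt).congr_fderiv ?_
    ext v
    simp [mul_assoc]
  have h2 : HasFDerivAt (fun x => zetaL ε x ^ n) ((n * zetaL ε x ^ (n - 1)) • zetaL ε) x := by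
    refine (((hasDerivAt_pow n (zetaL ε x)).hasFDerivAt.restrictScalars ℝ).comp x
      (zetaL ε).hasFDerivAt).congr_fderiv ?_
    ext v
    simp [mul_comm]
  exact h2.mul h1

theorem pderiv_zetaL_pow_mul (ε : ℂ) (n : ℕ) {u : ℝ → ℂ} {x : Plane}
    (hu : DifferentiableAt ℝ u (‖x‖ ^ 2)) (i : Fin 2) :
    pderiv i (fun x => zetaL ε x ^ n * u (‖x‖ ^ 2)) x
      = n * zetaCoeff ε i * (zetaL ε x ^ (n - 1) * u (‖x‖ ^ 2))
        + 2 * x i * (zetaL ε x ^ n * deriv u (‖x‖ ^ 2)) := by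
  rw [pderiv, (hasFDerivAt_zetaL_pow_mul ε n hu.hasDerivAt).fderiv]
  simp [inner_single, zetaCoeff]
  ring

theorem pderiv_congr {f g : Plane → ℂ} {x : Plane} (h : f =ᶠ[𝓝 x] g) (i : Fin 2) :
    pderiv i f x = pderiv i g x := by
  rw [pderiv, h.fderiv_eq]; rfl

theorem pderiv_coord_mul {g : Plane → ℂ} {x : Plane} (hg : DifferentiableAt ℝ g x) (i : Fin 2) :
    pderiv i (fun x => 2 * (x i : ℂ) * g x) x = 2 * g x + 2 * x i * pderiv i g x := by
  have h1 : HasFDerivAt (fun x : Plane => (2 * (x i : ℂ)))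
      ((2 : ℂ) • (Complex.ofRealCLM ∘L EuclideanSpace.proj i)) x := by
    exact ((Complex.ofRealCLM ∘L EuclideanSpace.proj i).hasFDerivAt).const_smul (2 : ℂ)
  have := (h1.mul hg.hasFDerivAt).fderiv
  have h2 := congrArg (fun L => L (EuclideanSpace.single i 1)) this
  simp only [pderiv]
  refine h2.trans ?_
  simp; ring

theorem pderiv_add {f g : Plane → ℂ} {x : Plane} (hf : DifferentiableAt ℝ f x)
    (hg : DifferentiableAt ℝ g x) (i : Fin 2) :
    pderiv i (fun x => f x + g x) x = pderiv i f x + pderiv i g x := by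
  simp only [pderiv]
  rw [fderiv_fun_add hf hg]; rfl

theorem pderiv_const_mul {f : Plane → ℂ} {x : Plane} (hf : DifferentiableAt ℝ f x)
    (c : ℂ) (i : Fin 2) :
    pderiv i (fun x => c * f x) x = c * pderiv i f x := by
  simp only [pderiv]
  rw [fderiv_const_mul hf]; rfl

/-- The power ζⁿ is harmonic because 1 + ε² = 0, and homogeneous of degree n. Hence the cross term
2∇ζⁿ·∇u contributes 4n ζⁿ u', and Δu contributes 4s u'' + 4u' at s = |x|². The set `S` is the whole
line for test functions and (0,∞) for mode fields. -/
theorem laplacian_zetaL_pow_mul {ε : ℂ} (hε : ε ^ 2 = -1) (n : ℕ) {u : ℝ → ℂ} {S : Set ℝ}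
    (hS : IsOpen S) (hu : ContDiffOn ℝ 2 u S) {x : Plane} (hx : ‖x‖ ^ 2 ∈ S) :
    ∑ i, pderiv i (pderiv i fun x => zetaL ε x ^ n * u (‖x‖ ^ 2)) x
      = zetaL ε x ^ n * (4 * ‖x‖ ^ 2 * deriv (deriv u) (‖x‖ ^ 2)
        + 4 * (n + 1) * deriv u (‖x‖ ^ 2)) := by
  have hu1 : ∀ s ∈ S, DifferentiableAt ℝ u s := fun s hs =>
    (hu.differentiableOn (by norm_num) s hs).differentiableAt (hS.mem_nhds hs)
  have hu2 : DifferentiableAt ℝ (deriv u) (‖x‖ ^ 2) :=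
    ((hu.deriv_of_isOpen hS (m := 1) (by norm_num)).differentiableOn one_ne_zero _
      hx).differentiableAt (hS.mem_nhds hx)
  have hn : ∀ᶠ y : Plane in 𝓝 x, ‖y‖ ^ 2 ∈ S :=
    (continuous_norm.pow 2).continuousAt.eventually_mem (hS.mem_nhds hx)
  have key : ∀ i, pderiv i (pderiv i fun x => zetaL ε x ^ n * u (‖x‖ ^ 2)) x
      = n * zetaCoeff ε i * (((n - 1 : ℕ) : ℂ) * zetaCoeff ε i
            * (zetaL ε x ^ (n - 1 - 1) * u (‖x‖ ^ 2))
          + 2 * x i * (zetaL ε x ^ (n - 1) * deriv u (‖x‖ ^ 2)))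
        + (2 * (zetaL ε x ^ n * deriv u (‖x‖ ^ 2))
          + 2 * x i * (n * zetaCoeff ε i * (zetaL ε x ^ (n - 1) * deriv u (‖x‖ ^ 2))
            + 2 * x i * (zetaL ε x ^ n * deriv (deriv u) (‖x‖ ^ 2)))) := by
    intro i
    have e : (pderiv i fun x => zetaL ε x ^ n * u (‖x‖ ^ 2)) =ᶠ[𝓝 x] fun x =>
        n * zetaCoeff ε i * (zetaL ε x ^ (n - 1) * u (‖x‖ ^ 2))
        + 2 * x i * (zetaL ε x ^ n * deriv u (‖x‖ ^ 2)) := by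
      filter_upwards [hn] with y hy
      exact pderiv_zetaL_pow_mul ε n (hu1 _ hy) i
    have d1 := (hasFDerivAt_zetaL_pow_mul ε (n - 1) (hu1 _ hx).hasDerivAt).differentiableAt
    have d2 := (hasFDerivAt_zetaL_pow_mul ε n hu2.hasDerivAt).differentiableAt
    have d3 : DifferentiableAt ℝ (fun x : Plane =>
        2 * (x i : ℂ) * (zetaL ε x ^ n * deriv u (‖x‖ ^ 2))) x := by
      refine DifferentiableAt.mul ?_ d2
      exact (((Complex.ofRealCLM ∘L EuclideanSpace.proj i).hasFDerivAt).const_smul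
        (2 : ℂ)).differentiableAt
    rw [pderiv_congr e, pderiv_add (d1.const_mul _) d3, pderiv_const_mul d1,
      pderiv_coord_mul d2, pderiv_zetaL_pow_mul _ _ (hu1 _ hx), pderiv_zetaL_pow_mul _ _ hu2]
  have hns : (‖x‖ : ℂ) ^ 2 = (x 0 : ℂ) ^ 2 + (x 1 : ℂ) ^ 2 := by
    have := EuclideanSpace.norm_sq_eq x
    simp only [Real.norm_eq_abs, sq_abs, Fin.sum_univ_two] at this
    exact_mod_cast this
  rw [Fin.sum_univ_two, key, key, zetaCoeff_zero, zetaCoeff_one, hns]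
  rcases n with _ | n
  · simp; ring
  · have hz : zetaL ε x ^ (n + 1) = zetaL ε x ^ n * (x 0 + ε * x 1) := by
      rw [pow_succ, zetaL_apply ε x]
    simp only [Nat.add_sub_cancel, hz]
    push_cast
    -- The only use of ε² = -1: the undifferentiated `u` appears with the factor 1 + ε².
    linear_combination (((n : ℂ) + 1) * n * (zetaL ε x ^ (n - 1) * u (‖x‖ ^ 2))) * hε

/-! ### Polar coordinates -/

/-- The polar coordinate map `(r, θ) ↦ (r cos θ, r sin θ)`. -/
def polarMap (p : ℝ × ℝ) : Plane := !₂[p.1 * Real.cos p.2, p.1 * Real.sin p.2]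

/-- The measure `r dr` on `(0, ∞)`. -/
def radialMeasure : Measure ℝ :=
  (volume.restrict (Ioi 0)).withDensity fun r => ENNReal.ofReal r

/-- Lebesgue measure on the interval of angles. -/
def angularMeasure : Measure ℝ := volume.restrict (Ioo (-Real.pi) Real.pi)

instance : SigmaFinite radialMeasure := by
  unfold radialMeasure
  exact SigmaFinite.withDensity_of_ne_top (by simp)

instance : IsFiniteMeasure angularMeasure := by
  unfold angularMeasure; infer_instance

/-- With the Jacobian r absorbed into `radialMeasure`, polar coordinates become a measure-preserving
map from a product space, so that Fubini's theorem and L² membership transfer directly. -/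
theorem measurePreserving_polarMap :
    MeasurePreserving polarMap (radialMeasure.prod angularMeasure) volume := by
  have hm : Measurable polarMap := by
    unfold polarMap
    exact (by fun_prop : Continuous fun p : ℝ × ℝ =>
      (!₂[p.1 * Real.cos p.2, p.1 * Real.sin p.2] : Plane)).measurable
  have hp : ∀ p, polarMap p = Complex.orthonormalBasisOneI.repr (Complex.polarCoord.symm p) := by
    intro p
    ext i
    fin_cases i <;> simp [polarMap, Complex.polarCoord_symm_apply, Complex.cos_ofReal_re,
      Complex.sin_ofReal_re]
  refine ⟨hm, Measure.ext_of_lintegral _ fun f hf => ?_⟩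
  rw [lintegral_map hf hm]
  change ∫⁻ a, (f ∘ polarMap) a ∂_ = _
  rw [radialMeasure, prod_withDensity_left (by fun_prop),
    lintegral_withDensity_eq_lintegral_mul _ (by fun_prop) (hf.comp hm), angularMeasure,
    Measure.prod_restrict, ← Measure.volume_eq_prod]
  have e := Complex.lintegral_comp_polarCoord_symm
    (fun z => f (Complex.orthonormalBasisOneI.repr z))
  have e2 := Complex.orthonormalBasisOneI.measurePreserving_repr.lintegral_comp hf
  rw [← e2, ← e]
  refine setLIntegral_congr_fun (measurableSet_Ioi.prod measurableSet_Ioo) fun p _ => ?_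
  simp [hp]

theorem ae_radialMeasure_iff {p : ℝ → Prop} :
    (∀ᵐ r ∂radialMeasure, p r) ↔ ∀ᵐ r : ℝ, 0 < r → p r := by
  unfold radialMeasure
  rw [ae_withDensity_iff (by fun_prop), ae_restrict_iff' measurableSet_Ioi]
  refine eventually_congr (ae_of_all _ fun r => ?_)
  simp only [mem_Ioi, ne_eq, ENNReal.ofReal_eq_zero, not_le]
  tauto

theorem ae_radialMeasure_pos : ∀ᵐ r ∂radialMeasure, 0 < r :=
  ae_radialMeasure_iff.2 (ae_of_all _ fun _ h => h)

theorem integral_radialMeasure {E : Type*} [NormedAddCommGroup E] [NormedSpace ℝ E]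
    (f : ℝ → E) : ∫ r, f r ∂radialMeasure = ∫ r in Ioi (0 : ℝ), r • f r := by
  unfold radialMeasure
  rw [integral_withDensity_eq_integral_toReal_smul (by fun_prop) (by simp)]
  refine setIntegral_congr_fun measurableSet_Ioi fun r hr => ?_
  simp [ENNReal.toReal_ofReal (le_of_lt hr)]

theorem integrable_radialMeasure_iff {E : Type*} [NormedAddCommGroup E] [NormedSpace ℝ E]
    {f : ℝ → E} :
    Integrable f radialMeasure ↔ IntegrableOn (fun r => r • f r) (Ioi (0 : ℝ)) := by
  unfold radialMeasure
  rw [integrable_withDensity_iff_integrable_smul₀' (by fun_prop) (by simp)]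
  refine integrableOn_congr_fun (fun r hr => ?_) measurableSet_Ioi
  simp [ENNReal.toReal_ofReal (le_of_lt hr)]

theorem norm_polarMap {p : ℝ × ℝ} (hp : 0 < p.1) : ‖polarMap p‖ = p.1 := by
  have h : (p.1 * Real.cos p.2) ^ 2 + (p.1 * Real.sin p.2) ^ 2 = p.1 ^ 2 := by
    linear_combination p.1 ^ 2 * Real.sin_sq_add_cos_sq p.2
  rw [polarMap, EuclideanSpace.norm_eq]
  simp [h, Real.sqrt_sq hp.le]

theorem angle_polarMap {p : ℝ × ℝ} (hp : 0 < p.1) (hθ : p.2 ∈ Ioo (-Real.pi) Real.pi) :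
    angle (polarMap p) = p.2 := by
  have : (⟨polarMap p 0, polarMap p 1⟩ : ℂ)
      = p.1 * (Complex.cos p.2 + Complex.sin p.2 * Complex.I) := by
    apply Complex.ext <;> simp [polarMap, Complex.cos_ofReal_re, Complex.sin_ofReal_re]
  rw [angle, this, Complex.arg_mul_cos_add_sin_mul_I hp ⟨hθ.1, hθ.2.le⟩]

theorem ae_angularMeasure_mem : ∀ᵐ θ ∂angularMeasure, θ ∈ Ioo (-Real.pi) Real.pi :=
  ae_restrict_mem measurableSet_Ioo

/-- The angular exponential `e^{i k θ}`. -/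
def cexpMode (k : ℤ) (θ : ℝ) : ℂ := Complex.exp (Complex.I * k * θ)

theorem continuous_cexpMode (k : ℤ) : Continuous (cexpMode k) := by
  unfold cexpMode; fun_prop

theorem norm_cexpMode (k : ℤ) (θ : ℝ) : ‖cexpMode k θ‖ = 1 := by
  have : Complex.I * (k : ℂ) * θ = ((k * θ : ℝ) : ℂ) * Complex.I := by push_cast; ring
  rw [cexpMode, this, Complex.norm_exp_ofReal_mul_I]

theorem conj_cexpMode (k : ℤ) (θ : ℝ) : conj (cexpMode k θ) = cexpMode (-k) θ := by
  rw [cexpMode, cexpMode, ← Complex.exp_conj]; simp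

theorem cexpMode_add (k l : ℤ) (θ : ℝ) : cexpMode (k + l) θ = cexpMode k θ * cexpMode l θ := by
  rw [cexpMode, cexpMode, cexpMode, ← Complex.exp_add]; congr 1; push_cast; ring

theorem angularMode_polarMap {p : ℝ × ℝ} (k : ℤ) (hp : 0 < p.1)
    (hθ : p.2 ∈ Ioo (-Real.pi) Real.pi) : angularMode k (polarMap p) = cexpMode k p.2 := by
  rw [angularMode, angle_polarMap hp hθ, cexpMode]

theorem integral_cexpMode (k : ℤ) :
    ∫ θ, cexpMode k θ ∂angularMeasure = if k = 0 then 2 * (Real.pi : ℂ) else 0 := by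
  have h0 : ∫ θ, cexpMode k θ ∂angularMeasure = ∫ θ in (-Real.pi)..Real.pi, cexpMode k θ := by
    rw [angularMeasure, intervalIntegral.integral_of_le (by linarith [Real.pi_pos]),
      integral_Ioc_eq_integral_Ioo]
  rw [h0]
  split_ifs with h
  · subst h; simp [cexpMode]; ring
  · unfold cexpMode
    rw [integral_exp_mul_complex (by simp [h])]
    rw [div_eq_zero_iff]; left
    rw [sub_eq_zero, Complex.exp_eq_exp_iff_exists_int]
    exact ⟨k, by push_cast; ring⟩

/-- A square integrable function on the circle all of whose Fourier coefficients vanish is zero. -/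
theorem ae_eq_zero_of_integral_cexpMode {f : ℝ → ℂ} (hf : MemLp f 2 angularMeasure)
    (h : ∀ k : ℤ, ∫ θ, cexpMode k θ * f θ ∂angularMeasure = 0) : f =ᵐ[angularMeasure] 0 := by
  have hπ : -Real.pi < Real.pi := by linarith [Real.pi_pos]
  have hr : volume.restrict (Ioc (-Real.pi) Real.pi) = angularMeasure :=
    (Measure.restrict_congr_set Ioo_ae_eq_Ioc).symm
  have hf' : MemLp f 2 (volume.restrict (Ioc (-Real.pi) Real.pi)) := by rwa [hr]
  have hc : ∀ k, fourierCoeffOn hπ f k = 0 := by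
    intro k
    rw [fourierCoeffOn_eq_integral, intervalIntegral.integral_of_le hπ.le, hr,
      ← smul_zero (1 / (Real.pi - -Real.pi)), ← h (-k)]
    congr 1
    refine integral_congr_ae (ae_of_all _ fun θ => ?_)
    simp only [fourier_coe_apply, smul_eq_mul]
    congr 2
    have : (Real.pi : ℂ) ≠ 0 := by exact_mod_cast Real.pi_ne_zero
    push_cast
    field_simp
    ring
  -- Parseval: the sum of the squared coefficients, here zero, is the normalized L² norm.
  have hs := hasSum_sq_fourierCoeffOn hπ hf'
  simp only [hc, norm_zero, ne_eq, OfNat.ofNat_ne_zero, not_false_eq_true, zero_pow] at hs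
  have h0 := hs.unique hasSum_zero
  rw [smul_eq_mul, mul_eq_zero, intervalIntegral.integral_of_le hπ.le, hr] at h0
  have h1 : ∫ θ, ‖f θ‖ ^ 2 ∂angularMeasure = 0 :=
    h0.resolve_left (inv_ne_zero (by linarith))
  rw [integral_eq_zero_iff_of_nonneg (fun _ => by positivity) hf.integrable_norm_pow'] at h1
  filter_upwards [h1] with θ hθ
  simpa using hθ

/-! ### Angular Fourier coefficients -/

/-- The (unnormalized) angular Fourier coefficient of index `k` at radius `r`. -/
def modeCoeff (k : ℤ) (a : Plane → ℂ) (r : ℝ) : ℂ :=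
  ∫ θ, conj (cexpMode k θ) * a (polarMap (r, θ)) ∂angularMeasure

/-- Cauchy–Schwarz against the constant 1, obtained by expanding ∫ (‖f‖ - c)² ≥ 0 with `c` the mean
of `‖f‖`. -/
theorem sq_integral_norm_le {α : Type*} [MeasurableSpace α] {ν : Measure α} [IsFiniteMeasure ν]
    {f : α → ℂ} (hf : MemLp f 2 ν) :
    (∫ x, ‖f x‖ ∂ν) ^ 2 ≤ ν.real univ * ∫ x, ‖f x‖ ^ 2 ∂ν := by
  have h1 : Integrable (fun x => ‖f x‖) ν := (hf.integrable (by norm_num)).norm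
  have h2 : Integrable (fun x => ‖f x‖ ^ 2) ν := hf.integrable_norm_pow'
  rcases (measureReal_nonneg (μ := ν) (s := univ)).eq_or_lt with h0 | h0
  · have : ν = 0 := by
      rw [← Measure.measure_univ_eq_zero]
      exact (measureReal_eq_zero_iff).1 h0.symm
    simp [this]
  · set M := ν.real univ
    set c := (∫ x, ‖f x‖ ∂ν) / M with hc
    have h3 : 0 ≤ ∫ x, (‖f x‖ ^ 2 - 2 * c * ‖f x‖ + c ^ 2) ∂ν :=
      integral_nonneg fun x => by
        have := sq_nonneg (‖f x‖ - c)
        change 0 ≤ ‖f x‖ ^ 2 - 2 * c * ‖f x‖ + c ^ 2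
        nlinarith
    have h4 : Integrable (fun x => ‖f x‖ ^ 2 - 2 * c * ‖f x‖) ν := h2.sub (h1.const_mul _)
    rw [integral_add h4 (integrable_const _),
      integral_sub h2 (h1.const_mul _), integral_const_mul, integral_const, smul_eq_mul] at h3
    have e : ∫ x, ‖f x‖ ∂ν = c * M := by rw [hc]; field_simp
    rw [e] at h3 ⊢
    change 0 ≤ _ - _ + M * c ^ 2 at h3
    nlinarith

theorem memLp_comp_polarMap {a : Plane → ℂ} (ha : MemLp a 2 volume) :
    MemLp (fun p => a (polarMap p)) 2 (radialMeasure.prod angularMeasure) :=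
  ha.comp_measurePreserving measurePreserving_polarMap

theorem ae_memLp_slice {a : Plane → ℂ} (ha : MemLp a 2 volume) :
    ∀ᵐ r ∂radialMeasure, MemLp (fun θ => a (polarMap (r, θ))) 2 angularMeasure := by
  have h := memLp_comp_polarMap ha
  have h1 := h.aestronglyMeasurable
  filter_upwards [h1.prodMk_left, ((memLp_two_iff_integrable_sq_norm h1).1 h).prod_right_ae]
    with r hr hr'
  exact (memLp_two_iff_integrable_sq_norm hr).2 hr'

theorem memLp_cexpMode_mul {k : ℤ} {g : ℝ → ℂ} (hg : MemLp g 2 angularMeasure) :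
    MemLp (fun θ => conj (cexpMode k θ) * g θ) 2 angularMeasure := by
  refine hg.congr_norm ?_ (ae_of_all _ fun θ => by simp [norm_cexpMode])
  exact (Complex.continuous_conj.comp (continuous_cexpMode k)).aestronglyMeasurable.mul hg.1

/-- On almost every circle Cauchy–Schwarz bounds the squared coefficient by a constant times ∫ |a|²
dθ, and Fubini makes the latter integrable for r dr. -/
theorem memLp_modeCoeff (k : ℤ) {a : Plane → ℂ} (ha : MemLp a 2 volume) :
    MemLp (modeCoeff k a) 2 radialMeasure := by
  have h := memLp_comp_polarMap ha
  have hm : AEStronglyMeasurable (modeCoeff k a) radialMeasure := by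
    refine AEStronglyMeasurable.integral_prod_right' (f := fun p : ℝ × ℝ =>
      conj (cexpMode k p.2) * a (polarMap p)) ?_
    refine AEStronglyMeasurable.mul (Continuous.aestronglyMeasurable ?_) h.1
    exact Complex.continuous_conj.comp ((continuous_cexpMode k).comp continuous_snd)
  rw [memLp_two_iff_integrable_sq_norm hm]
  have hI : Integrable (fun p : ℝ × ℝ => ‖a (polarMap p)‖ ^ 2)
    (radialMeasure.prod angularMeasure) := (memLp_two_iff_integrable_sq_norm h.1).1 h
  refine Integrable.mono' (hI.integral_prod_left.const_mul (angularMeasure.real univ))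
    (hm.norm.pow 2) ?_
  filter_upwards [ae_memLp_slice ha] with r hr
  rw [Real.norm_of_nonneg (by positivity)]
  have h2 := sq_integral_norm_le (memLp_cexpMode_mul (k := k) hr)
  simp only [norm_mul, RCLike.norm_conj, norm_cexpMode, one_mul] at h2
  refine le_trans ?_ h2
  have h3 := norm_integral_le_integral_norm (μ := angularMeasure)
    (fun θ => conj (cexpMode k θ) * a (polarMap (r, θ)))
  simp only [norm_mul, RCLike.norm_conj, norm_cexpMode, one_mul] at h3
  exact pow_le_pow_left₀ (norm_nonneg _) h3 2

/-- In polar coordinates the angular integral of e^{-ikθ} a is, by definition, the coefficient of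
index k. This is how a planar weak equation becomes a radial one. -/
theorem integral_harm_mul (k : ℤ) (g : ℝ → ℂ) {a : Plane → ℂ}
    (hI : Integrable fun x => conj (harm k x * g ‖x‖) * a x) :
    ∫ x, conj (harm k x * g ‖x‖) * a x
      = ∫ r, conj ((r : ℂ) ^ k.natAbs * g r) * modeCoeff k a r ∂radialMeasure := by
  rw [← measurePreserving_polarMap.map_eq] at hI ⊢
  have hP := measurePreserving_polarMap.measurable.aemeasurable
    (μ := radialMeasure.prod angularMeasure)
  have hI' : Integrable (fun p => conj (harm k (polarMap p) * g ‖polarMap p‖) * a (polarMap p))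
    (radialMeasure.prod angularMeasure) := (integrable_map_measure hI.1 hP).1 hI
  rw [integral_map hP hI.1, integral_prod _ hI']
  refine integral_congr_ae ?_
  filter_upwards [ae_radialMeasure_pos] with r hr
  rw [modeCoeff, ← integral_const_mul]
  refine integral_congr_ae ?_
  filter_upwards [ae_angularMeasure_mem] with θ hθ
  rw [harm_eq, norm_polarMap (p := (r, θ)) hr, angularMode_polarMap (p := (r, θ)) k hr hθ]
  simp only [map_mul]
  ring

theorem ae_slice_of_ae {p : Plane → Prop} (h : ∀ᵐ x : Plane, p x) :
    ∀ᵐ r ∂radialMeasure, ∀ᵐ θ ∂angularMeasure, p (polarMap (r, θ)) :=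
  Measure.ae_ae_of_ae_prod (measurePreserving_polarMap.quasiMeasurePreserving.ae h)

/-- Radial factors leave the angular integral, and multiplication by e^{ilθ} shifts the Fourier
index by l. With l = ±2m this couples j + m to j - m. -/
theorem modeCoeff_combination (k l : ℤ) {a a' b : Plane → ℂ} (α β : ℝ → ℂ)
    (ha : MemLp a 2 volume) (ha' : MemLp a' 2 volume)
    (hb : ∀ᵐ x, b x = α ‖x‖ * a x + β ‖x‖ * (angularMode l x * a' x)) :
    ∀ᵐ r ∂radialMeasure,
      modeCoeff k b r = α r * modeCoeff k a r + β r * modeCoeff (k - l) a' r := by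
  filter_upwards [ae_slice_of_ae hb, ae_memLp_slice ha, ae_memLp_slice ha',
    ae_radialMeasure_pos] with r h1 h2 h3 hr
  have i1 := (memLp_cexpMode_mul (k := k) h2).integrable (by norm_num)
  have i2 := (memLp_cexpMode_mul (k := k - l) h3).integrable (by norm_num)
  simp only [modeCoeff]
  rw [← integral_const_mul, ← integral_const_mul,
    ← integral_add (i1.const_mul _) (i2.const_mul _)]
  refine integral_congr_ae ?_
  filter_upwards [h1, ae_angularMeasure_mem] with θ h4 hθ
  rw [h4, norm_polarMap (p := (r, θ)) hr, angularMode_polarMap (p := (r, θ)) l hr hθ,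
    conj_cexpMode, conj_cexpMode, show -(k - l) = -k + l by ring, cexpMode_add]
  ring

/-- There are countably many indices, so on almost every circle all coefficients vanish at once and
Parseval applies. -/
theorem ae_eq_zero_of_modeCoeff {a : Plane → ℂ} (ha : MemLp a 2 volume)
    (h : ∀ k, modeCoeff k a =ᵐ[radialMeasure] 0) : a =ᵐ[volume] 0 := by
  -- A measurable representative is needed: passing from almost every circle to almost every point
  -- requires a measurable zero set.
  set b := ha.1.mk a with hb
  have hab : a =ᵐ[volume] b := ha.1.ae_eq_mk
  have hbm : Measurable b := ha.1.stronglyMeasurable_mk.measurable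
  have hPm := measurePreserving_polarMap.measurable
  have hs : MeasurableSet {x | b x = 0} := hbm (measurableSet_singleton 0)
  have h1 : ∀ᵐ p ∂(radialMeasure.prod angularMeasure), b (polarMap p) = 0 := by
    refine (Measure.ae_prod_iff_ae_ae (p := fun p => b (polarMap p) = 0) (hPm hs)).2 ?_
    have hall : ∀ᵐ r ∂radialMeasure, ∀ k : ℤ, modeCoeff k a r = 0 := ae_all_iff.2 h
    filter_upwards [hall, ae_memLp_slice ha, ae_slice_of_ae hab] with r hr hr' hr2
    have h0 := ae_eq_zero_of_integral_cexpMode hr' fun k => by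
      rw [← hr (-k), modeCoeff]
      simp only [conj_cexpMode, neg_neg]
    filter_upwards [h0, hr2] with θ h1 h2
    exact h2.symm.trans h1
  refine hab.trans ?_
  change ∀ᵐ x, b x = 0
  rw [← measurePreserving_polarMap.map_eq, ae_map_iff hPm.aemeasurable hs]
  exact h1

/-! ### Distributions on the half line -/

theorem contDiff_infty_of_hasDerivAt {H φ : ℝ → ℝ} (h : ∀ x, HasDerivAt H (φ x) x)
    (hφ : ContDiff ℝ ∞ φ) : ContDiff ℝ ∞ H := by
  rw [contDiff_infty_iff_deriv]
  refine ⟨fun x => (h x).differentiableAt, ?_⟩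
  rwa [show deriv H = φ from funext fun x => (h x).deriv]

/-- The antiderivative vanishing at the right of the support. -/
theorem exists_antideriv {φ : ℝ → ℝ} (hφ : ContDiff ℝ ∞ φ) {a b : ℝ} (hab : a ≤ b)
    (hs : ∀ x, x ∉ Icc a b → φ x = 0) :
    ∃ H : ℝ → ℝ, ContDiff ℝ ∞ H ∧ (∀ x, HasDerivAt H (φ x) x) ∧ (∀ x, b ≤ x → H x = 0) ∧
      ∀ x, x ≤ a → H x = -∫ y, φ y := by
  have hd : ∀ x, HasDerivAt (fun x => ∫ y in b..x, φ y) (φ x) x := fun x =>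
    intervalIntegral.integral_hasDerivAt_right (hφ.continuous.intervalIntegrable _ _)
      hφ.continuous.aestronglyMeasurable.stronglyMeasurableAtFilter hφ.continuous.continuousAt
  refine ⟨fun x => ∫ y in b..x, φ y, contDiff_infty_of_hasDerivAt hd hφ, hd, fun x hx => ?_,
    fun x hx => ?_⟩
  · change ∫ y in b..x, φ y = 0
    rw [intervalIntegral.integral_of_le hx]
    exact setIntegral_eq_zero_of_forall_eq_zero fun y hy => hs y fun h => absurd h.2 (not_le.2 hy.1)
  · change ∫ y in b..x, φ y = _
    rw [intervalIntegral.integral_symm, intervalIntegral.integral_of_le (hx.trans hab),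
      setIntegral_eq_integral_of_ae_compl_eq_zero]
    have : ∀ᵐ y : ℝ, y ≠ x := by simp [ae_iff]
    filter_upwards [this] with y hyx hy
    refine hs y fun h => hy ⟨lt_of_le_of_ne (hx.trans h.1) (Ne.symm hyx), h.2⟩

theorem exists_Icc_of_tsupport {φ : ℝ → ℝ} (hc : HasCompactSupport φ)
    (hs : tsupport φ ⊆ Ioi 0) :
    ∃ a b : ℝ, 0 < a ∧ a ≤ b ∧ ∀ x, x ∉ Icc a b → φ x = 0 := by
  rcases (tsupport φ).eq_empty_or_nonempty with h | h
  · exact ⟨1, 1, one_pos, le_rfl, fun x _ => image_eq_zero_of_notMem_tsupport (by simp [h])⟩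
  · obtain ⟨a, ha, ha'⟩ := hc.isCompact.exists_isLeast h
    obtain ⟨b, hb, hb'⟩ := hc.isCompact.exists_isGreatest h
    exact ⟨a, b, hs ha, ha' hb, fun x hx => image_eq_zero_of_notMem_tsupport fun h =>
      hx ⟨ha' h, hb' h⟩⟩

theorem hasCompactSupport_of_Icc {φ : ℝ → ℝ} {a b : ℝ} (hs : ∀ x, x ∉ Icc a b → φ x = 0) :
    HasCompactSupport φ :=
  HasCompactSupport.intro isCompact_Icc hs

theorem tsupport_subset_of_Icc {φ : ℝ → ℝ} {a b : ℝ} (hs : ∀ x, x ∉ Icc a b → φ x = 0) :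
    tsupport φ ⊆ Icc a b :=
  closure_minimal (fun x hx => by_contra fun h => hx (hs x h)) isClosed_Icc

/-- A locally integrable function on `(0, ∞)` with vanishing distributional derivative is
constant. -/
theorem ae_eq_const_of_integral_deriv_smul {f : ℝ → ℂ} (hf : LocallyIntegrableOn f (Ioi 0))
    (h : ∀ η η' : ℝ → ℝ, ContDiff ℝ ∞ η → (∀ x, HasDerivAt η (η' x) x) → HasCompactSupport η →
      tsupport η ⊆ Ioi 0 → ∫ x, η' x • f x = 0) :
    ∃ c : ℂ, ∀ᵐ x, 0 < x → f x = c := by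
  let ρ : ContDiffBump (2 : ℝ) := ⟨1 / 2, 1, by norm_num, by norm_num⟩
  set η₀ : ℝ → ℝ := ρ.normed volume with hη₀
  have hρs : ContDiff ℝ ∞ η₀ := ρ.contDiff_normed
  have hρc : HasCompactSupport η₀ := ρ.hasCompactSupport_normed
  have hρt : tsupport η₀ ⊆ Ioi 0 := by
    rw [hη₀, ρ.tsupport_normed_eq, Real.closedBall_eq_Icc]
    intro x hx
    have := hx.1
    simp only [ρ] at this
    simp only [mem_Ioi]; linarith
  have hρi : ∫ x, η₀ x = 1 := ρ.integral_normed
  have hint : ∀ φ : ℝ → ℝ, Continuous φ → HasCompactSupport φ → tsupport φ ⊆ Ioi 0 →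
      Integrable fun x => φ x • f x := by
    intro φ hφ hc hs
    have h1 : IntegrableOn (fun x => φ x • f x) (tsupport φ) :=
      (hf.integrableOn_compact_subset hs hc.isCompact).continuousOn_smul hφ.continuousOn
        hc.isCompact
    refine (integrableOn_iff_integrable_of_support_subset fun x hx => ?_).1 h1
    exact subset_tsupport _ fun h0 => hx (by simp [h0])
  refine ⟨∫ x, η₀ x • f x, ?_⟩
  set c := ∫ x, η₀ x • f x with hc
  have hfc : LocallyIntegrableOn (fun x => f x - c) (Ioi 0) :=
    hf.sub ((locallyIntegrable_const c).locallyIntegrableOn _)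
  have := isOpen_Ioi.ae_eq_zero_of_integral_contDiff_smul_eq_zero (μ := volume) hfc ?_
  · filter_upwards [this] with x hx h0
    exact sub_eq_zero.1 (hx h0)
  intro φ hφ hφc hφs
  -- The du Bois-Reymond argument: subtracting a multiple of the fixed bump `η₀`, supported in [1,3]
  -- and of integral 1, gives total integral zero, so the antiderivative again has compact support
  -- in (0,∞).
  set φ₁ : ℝ → ℝ := fun x => φ x - (∫ y, φ y) * η₀ x with hφ₁
  obtain ⟨a, b, ha, hab, h1⟩ := exists_Icc_of_tsupport hφc hφs
  obtain ⟨a', b', ha', hab', h1'⟩ := exists_Icc_of_tsupport hρc hρt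
  have hz : ∀ x, x ∉ Icc (min a a') (max b b') → φ₁ x = 0 := by
    intro x hx
    have e1 : φ x = 0 := h1 x fun h => hx ⟨(min_le_left _ _).trans h.1, h.2.trans (le_max_left _ _)⟩
    have e2 : η₀ x = 0 :=
      h1' x fun h => hx ⟨(min_le_right _ _).trans h.1, h.2.trans (le_max_right _ _)⟩
    simp [hφ₁, e1, e2]
  have hφi : Integrable φ := hφ.continuous.integrable_of_hasCompactSupport hφc
  have hρI : Integrable η₀ := hρs.continuous.integrable_of_hasCompactSupport hρc
  have h0 : ∫ y, φ₁ y = 0 := by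
    rw [hφ₁, integral_sub hφi (hρI.const_mul _), integral_const_mul, hρi, mul_one, sub_self]
  obtain ⟨η, e1, e2, e3, e4⟩ := exists_antideriv (hφ.sub (contDiff_const.mul hρs))
    (((min_le_left _ _).trans hab).trans (le_max_left _ _)) hz
  have hηz : ∀ x, x ∉ Icc (min a a') (max b b') → η x = 0 := by
    intro x hx
    rcases le_total x (min a a') with h | h
    · rw [e4 x h]; exact neg_eq_zero.2 h0
    · exact e3 x (le_of_lt (not_le.1 fun h' => hx ⟨h, h'⟩))
  have h2 := h η φ₁ e1 e2 (hasCompactSupport_of_Icc hηz)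
    ((tsupport_subset_of_Icc hηz).trans fun x hx => (lt_min ha ha').trans_le hx.1)
  simp only [hφ₁, sub_smul, mul_smul] at h2
  have h3 : Integrable fun x => (∫ y, φ y) • η₀ x • f x :=
    (hint η₀ hρs.continuous hρc hρt).smul (∫ y, φ y)
  rw [integral_sub (hint φ hφ.continuous hφc hφs) h3, integral_smul, ← hc] at h2
  simp only [smul_sub]
  rw [integral_sub (hint φ hφ.continuous hφc hφs) (hφi.smul_const c), integral_smul_const]
  exact h2

/-- As `f` is only integrable, its primitive need not be differentiable everywhere. Integration by
parts is instead Fubini for g'(x) f(s) over the triangle 0 < s ≤ x ≤ B. -/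
theorem integral_smul_eq_neg_integral_deriv_smul {f : ℝ → ℂ} {g g' : ℝ → ℝ} {B : ℝ} (hB : 0 ≤ B)
    (hf : IntervalIntegrable f volume 0 B) (hg : ∀ x, HasDerivAt g (g' x) x)
    (hg' : Continuous g') (hgB : g B = 0) :
    ∫ x in 0..B, g x • f x = -∫ x in 0..B, g' x • ∫ s in 0..x, f s := by
  set ν : Measure ℝ := volume.restrict (Ioc 0 B) with hν
  have hfi : Integrable f ν := (intervalIntegrable_iff_integrableOn_Ioc_of_le hB).1 hf
  have hgi : Integrable g' ν :=
    (intervalIntegrable_iff_integrableOn_Ioc_of_le hB).1 (hg'.intervalIntegrable 0 B)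
  set K : ℝ → ℝ → ℂ := fun x s => {p : ℝ × ℝ | p.2 ≤ p.1}.indicator
    (fun p => g' p.1 • f p.2) (x, s) with hK
  have hKi : Integrable (Function.uncurry K) (ν.prod ν) :=
    (hgi.smul_prod hfi).indicator (measurableSet_le measurable_snd measurable_fst)
  have h1 : ∫ x in 0..B, g' x • ∫ s in 0..x, f s = ∫ x, ∫ s, K x s ∂ν ∂ν := by
    rw [intervalIntegral.integral_of_le hB]
    refine setIntegral_congr_fun measurableSet_Ioc fun x hx => ?_
    have e : K x = (Iic x).indicator fun s => g' x • f s := by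
      ext s; simp [hK, indicator]
    simp only [e]
    rw [integral_indicator measurableSet_Iic, integral_smul, hν,
      Measure.restrict_restrict measurableSet_Iic, intervalIntegral.integral_of_le hx.1.le]
    congr 3
    ext s
    simp only [mem_inter_iff, mem_Iic, mem_Ioc]
    exact ⟨fun h => ⟨h.2, h.1, h.2.trans hx.2⟩, fun h => ⟨h.2.1, h.1⟩⟩
  have h2 : ∫ s, ∫ x, K x s ∂ν ∂ν = -∫ x in 0..B, g x • f x := by
    rw [intervalIntegral.integral_of_le hB, ← integral_neg]
    refine setIntegral_congr_fun measurableSet_Ioc fun s hs => ?_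
    have e : (fun x => K x s) = (Ici s).indicator fun x => g' x • f s := by
      ext x; simp [hK, indicator]
    simp only [e]
    rw [integral_indicator measurableSet_Ici, integral_smul_const, hν,
      Measure.restrict_restrict measurableSet_Ici]
    have : Ici s ∩ Ioc 0 B = Icc s B := by
      ext x
      simp only [mem_inter_iff, mem_Ici, mem_Ioc, mem_Icc]
      exact ⟨fun h => ⟨h.1, h.2.2⟩, fun h => ⟨h.1, hs.1.trans_le h.1, h.2⟩⟩
    rw [this, integral_Icc_eq_integral_Ioc, ← intervalIntegral.integral_of_le hs.2,
      intervalIntegral.integral_eq_sub_of_hasDerivAt (fun x _ => hg x)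
        (hg'.intervalIntegrable _ _), hgB, zero_sub, neg_smul]
  rw [h1, integral_integral_swap hKi, h2, neg_neg]

/-! ### Moments and primitives of radial sources -/

theorem restrict_radialMeasure (R : ℝ) : radialMeasure.restrict (Iio R)
    = (volume.restrict (Ioo 0 R)).withDensity fun r => ENNReal.ofReal r := by
  rw [radialMeasure, restrict_withDensity measurableSet_Iio,
    Measure.restrict_restrict measurableSet_Iio]
  congr 2
  ext r; simp [and_comm]

theorem lintegral_id_Ioo {R : ℝ} (hR : 0 ≤ R) :
    ∫⁻ r in Ioo 0 R, ENNReal.ofReal r = ENNReal.ofReal (R ^ 2 / 2) := by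
  rw [← ofReal_integral_eq_lintegral_ofReal]
  · rw [← integral_Ioc_eq_integral_Ioo, ← intervalIntegral.integral_of_le hR]
    congr 1; simp
  · exact (continuous_id.integrableOn_Icc (a := 0) (b := R)).mono_set Ioo_subset_Icc_self
  · filter_upwards [ae_restrict_mem measurableSet_Ioo] with r hr using hr.1.le

theorem radialMeasure_Iio {R : ℝ} (hR : 0 ≤ R) :
    radialMeasure (Iio R) = ENNReal.ofReal (R ^ 2 / 2) := by
  rw [← Measure.restrict_apply_univ, restrict_radialMeasure, withDensity_apply _ .univ,
    Measure.restrict_univ, lintegral_id_Ioo hR]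

instance (R : ℝ) : IsFiniteMeasure (radialMeasure.restrict (Iio R)) := by
  refine ⟨?_⟩
  rw [Measure.restrict_apply_univ]
  refine (measure_mono (Iio_subset_Iio (le_abs_self R))).trans_lt ?_
  rw [radialMeasure_Iio (abs_nonneg R)]
  exact ENNReal.ofReal_lt_top

/-- Square integrability with respect to `r dr` near the origin. -/
def LocSq (F : ℝ → ℂ) : Prop := ∀ R : ℝ, MemLp F 2 (radialMeasure.restrict (Iio R))

theorem LocSq.integrableOn {F : ℝ → ℂ} (hF : LocSq F) (R : ℝ) :
    IntegrableOn (fun r => r • F r) (Ioo 0 R) := by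
  have h := (hF R).integrable (by norm_num)
  rw [restrict_radialMeasure, integrable_withDensity_iff_integrable_smul₀' (by fun_prop)
    (by simp)] at h
  refine h.congr ?_
  filter_upwards [ae_restrict_mem measurableSet_Ioo] with r hr
  simp [ENNReal.toReal_ofReal hr.1.le]

/-- `∫₀ᵗ s^(κ+1) F(s) ds` -/
def moment (κ : ℕ) (F : ℝ → ℂ) (t : ℝ) : ℂ := ∫ s in 0..t, s ^ (κ + 1) • F s

theorem LocSq.intervalIntegrable {F : ℝ → ℂ} (hF : LocSq F) (κ : ℕ) {a b : ℝ} (ha : 0 ≤ a)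
    (hb : 0 ≤ b) : IntervalIntegrable (fun s => s ^ (κ + 1) • F s) volume a b := by
  suffices h : ∀ b, 0 ≤ b → IntervalIntegrable (fun s => s ^ (κ + 1) • F s) volume 0 b from
    (h a ha).symm.trans (h b hb)
  intro b hb
  rw [intervalIntegrable_iff_integrableOn_Ioo_of_le hb]
  have h1 : IntegrableOn (fun s : ℝ => s ^ κ • (s • F s)) (Ioo 0 b) := by
    refine Integrable.bdd_smul (C := b ^ κ) (hF.integrableOn b)
      (continuous_pow κ).aestronglyMeasurable ?_
    filter_upwards [ae_restrict_mem measurableSet_Ioo] with s hs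
    rw [norm_pow, Real.norm_of_nonneg hs.1.le]
    exact pow_le_pow_left₀ hs.1.le hs.2.le _
  refine h1.congr (ae_of_all _ fun s => ?_)
  simp only [smul_smul, pow_succ]

/-- The factor s^κ is at most t^κ, and Cauchy–Schwarz for r dr on (0,t), a set of measure t²/2,
supplies one more power of t. -/
theorem LocSq.norm_moment_le {F : ℝ → ℂ} (hF : LocSq F) (κ : ℕ) :
    ∃ C, 0 ≤ C ∧ ∀ t, 0 ≤ t → t ≤ 1 → ‖moment κ F t‖ ≤ C * t ^ (κ + 1) := by
  set A := ∫ r, ‖F r‖ ^ 2 ∂(radialMeasure.restrict (Iio 1)) with hA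
  have hA0 : 0 ≤ A := integral_nonneg fun _ => by positivity
  refine ⟨√A, Real.sqrt_nonneg _, fun t ht ht1 => ?_⟩
  have h1 : ‖moment κ F t‖ ≤ t ^ κ * ∫ r, ‖F r‖ ∂(radialMeasure.restrict (Iio t)) := by
    have e : ∫ r, ‖F r‖ ∂(radialMeasure.restrict (Iio t)) = ∫ r in 0..t, r * ‖F r‖ := by
      rw [restrict_radialMeasure, integral_withDensity_eq_integral_toReal_smul (by fun_prop)
        (by simp), intervalIntegral.integral_of_le ht, integral_Ioc_eq_integral_Ioo]
      refine setIntegral_congr_fun measurableSet_Ioo fun r hr => ?_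
      simp [ENNReal.toReal_ofReal hr.1.le]
    rw [e, ← intervalIntegral.integral_const_mul, moment]
    have hi : IntervalIntegrable (fun r => r * ‖F r‖) volume 0 t := by
      rw [intervalIntegrable_iff_integrableOn_Ioo_of_le ht]
      refine (hF.integrableOn t).norm.congr ?_
      filter_upwards [ae_restrict_mem measurableSet_Ioo] with s hs
      rw [norm_smul, Real.norm_of_nonneg hs.1.le]
    refine intervalIntegral.norm_integral_le_of_norm_le ht (ae_of_all _ fun s hs => ?_)
      (hi.const_mul _)
    rw [norm_smul, norm_pow, Real.norm_of_nonneg hs.1.le, pow_succ, mul_assoc]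
    have := hs.1.le
    gcongr
    exact hs.2
  have h2 : (∫ r, ‖F r‖ ∂(radialMeasure.restrict (Iio t))) ≤ √A * t := by
    refine abs_le_of_sq_le_sq' ?_ (by positivity) |>.2
    refine (sq_integral_norm_le (hF t)).trans ?_
    have e1 : (radialMeasure.restrict (Iio t)).real univ = t ^ 2 / 2 := by
      rw [measureReal_def, Measure.restrict_apply_univ, radialMeasure_Iio ht,
        ENNReal.toReal_ofReal (by positivity)]
    have e2 : ∫ r, ‖F r‖ ^ 2 ∂(radialMeasure.restrict (Iio t)) ≤ A := by
      refine integral_mono_measure (Measure.restrict_mono (Iio_subset_Iio ht1) le_rfl)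
        (ae_of_all _ fun _ => by positivity) ?_
      exact (memLp_two_iff_integrable_sq_norm (hF 1).1).1 (hF 1)
    rw [e1, mul_pow, Real.sq_sqrt hA0]
    nlinarith [sq_nonneg t]
  refine h1.trans ((mul_le_mul_of_nonneg_left h2 (by positivity)).trans (le_of_eq ?_))
  ring

theorem LocSq.continuousOn_moment {F : ℝ → ℂ} (hF : LocSq F) (κ : ℕ) :
    ContinuousOn (moment κ F) (Ici 0) := by
  intro t ht
  have ht0 : (0 : ℝ) ≤ t := ht
  have hi := (intervalIntegrable_iff_integrableOn_Icc_of_le (by linarith)).1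
    (hF.intervalIntegrable κ le_rfl (by linarith : 0 ≤ t + 1))
  rw [← uIcc_of_le (by linarith)] at hi
  have h : ContinuousOn (moment κ F) (uIcc 0 (t + 1)) :=
    intervalIntegral.continuousOn_primitive_interval hi
  rw [uIcc_of_le (by linarith)] at h
  refine (h t ⟨ht0, by linarith⟩).mono_of_mem_nhdsWithin ?_
  refine mem_of_superset (inter_mem_nhdsWithin _ (Iio_mem_nhds (lt_add_one t))) ?_
  exact fun x hx => ⟨hx.1, le_of_lt hx.2⟩

/-- The continuous representative of `r^(-κ) H` up to an additive constant. -/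
def primitive (κ : ℕ) (F : ℝ → ℂ) (r : ℝ) : ℂ :=
  ∫ t in 1..r, (t ^ (2 * κ + 1))⁻¹ • moment κ F t

theorem LocSq.hasDerivAt_primitive {F : ℝ → ℂ} (hF : LocSq F) (κ : ℕ) {r : ℝ} (hr : 0 < r) :
    HasDerivAt (primitive κ F) ((r ^ (2 * κ + 1))⁻¹ • moment κ F r) r := by
  have hc : ContinuousOn (fun t : ℝ => (t ^ (2 * κ + 1))⁻¹ • moment κ F t) (Ioi 0) := by
    refine ContinuousOn.smul (ContinuousOn.inv₀ (continuous_pow _).continuousOn fun t ht => ?_)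
      ((hF.continuousOn_moment κ).mono Ioi_subset_Ici_self)
    exact pow_ne_zero _ (ne_of_gt ht)
  refine intervalIntegral.integral_hasDerivAt_right (ContinuousOn.intervalIntegrable ?_) ?_
    (hc.continuousAt (Ioi_mem_nhds hr))
  · refine hc.mono fun t ht => ?_
    exact (lt_min one_pos hr).trans_le ht.1
  · exact hc.stronglyMeasurableAtFilter isOpen_Ioi r hr

/-! ### Weak radial equations -/

/-- `H` solves `H'' + H'/r - (κ²/r²) H = F` distributionally on `[0, ∞)`, tested against
`r^κ h(r²)`. -/
def WeakRadialEq (κ : ℕ) (H F : ℝ → ℂ) : Prop :=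
  ∀ h h' h'' : ℝ → ℝ, ContDiff ℝ ∞ h → (∀ s, HasDerivAt h (h' s) s) →
    (∀ s, HasDerivAt h' (h'' s) s) → (∃ b, ∀ s, b ≤ s → h s = 0) →
    ∫ r, (r ^ κ * (4 * r ^ 2 * h'' (r ^ 2) + 4 * (κ + 1) * h' (r ^ 2))) • H r ∂radialMeasure
      = ∫ r, (r ^ κ * h (r ^ 2)) • F r ∂radialMeasure

/-- The singularities of √s and s^{-n} at s ≤ 0 are harmless, because the numerator vanishes for all
s < a². -/
theorem contDiff_comp_sqrt_div {η : ℝ → ℝ} (hη : ContDiff ℝ ∞ η) (n : ℕ) {a : ℝ} (ha : 0 < a)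
    (hs : ∀ x, x < a → η x = 0) :
    ContDiff ℝ ∞ fun s => η (√s) / (2 * s ^ n) := by
  rw [contDiff_iff_contDiffAt]
  intro s
  rcases lt_or_ge 0 s with h | h
  · refine ContDiffAt.div (hη.contDiffAt.comp s (Real.contDiffAt_sqrt h.ne')) ?_ (by positivity)
    exact (contDiff_const.mul (contDiff_id.pow n)).contDiffAt
  · have : (fun s => η (√s) / (2 * s ^ n)) =ᶠ[𝓝 s] fun _ => 0 := by
      filter_upwards [Iio_mem_nhds (h.trans_lt (by positivity : 0 < a ^ 2))] with x hx
      rw [hs _ ((Real.sqrt_lt' ha).2 hx), zero_div]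
    exact contDiffAt_const.congr_of_eventuallyEq this

theorem LocSq.locallyIntegrableOn {F : ℝ → ℂ} (hF : LocSq F) : LocallyIntegrableOn F (Ioi 0) := by
  rw [locallyIntegrableOn_iff isLocallyClosed_Ioi]
  intro K hK hKc
  rcases K.eq_empty_or_nonempty with rfl | hne
  · exact integrableOn_empty
  obtain ⟨b, hb⟩ := hKc.bddAbove
  have h1 : IntegrableOn (fun r => r • F r) K := (hF.integrableOn (b + 1)).mono_set fun x hx =>
    ⟨hK hx, (hb hx).trans_lt (lt_add_one b)⟩
  have h2 : IntegrableOn (fun r => r⁻¹ • r • F r) K :=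
    h1.continuousOn_smul (continuousOn_inv₀.mono fun x hx => ne_of_gt (hK hx)) hKc
  refine h2.congr_fun (fun r hr => ?_) hKc.measurableSet
  simp only
  rw [smul_smul, inv_mul_cancel₀ (ne_of_gt (hK hr)), one_smul]

/-- The point is that r^{-κ} H - `primitive κ F` has zero distributional derivative on (0,∞). Given
a test function η there, h is chosen with h'(r²) = η(r) / (2 r^{2κ+2}); the radial operator applied
to r^κ h(r²), times the weight r, is then exactly r^{-κ} η'. Such an h is constant near 0 and in
general nonzero there, so the hypothesis sees the origin, and no singular homogeneous solution
survives. -/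
theorem WeakRadialEq.exists_ae_eq {κ : ℕ} {H F : ℝ → ℂ} (hw : WeakRadialEq κ H F)
    (hH : LocSq H) (hF : LocSq F) :
    ∃ c : ℂ, ∀ᵐ r, 0 < r → H r = r ^ κ • (c + primitive κ F r) := by
  have hQd : ∀ r, 0 < r → HasDerivAt (primitive κ F) _ r := fun r hr => hF.hasDerivAt_primitive κ hr
  have hQc : ContinuousOn (primitive κ F) (Ioi 0) := fun r hr =>
    (hQd r hr).continuousAt.continuousWithinAt
  have hpc : ContinuousOn (fun t : ℝ => (t ^ (2 * κ + 1))⁻¹ • moment κ F t) (Ioi 0) := by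
    refine ContinuousOn.smul (ContinuousOn.inv₀ (continuous_pow _).continuousOn fun t ht => ?_)
      ((hF.continuousOn_moment κ).mono Ioi_subset_Ici_self)
    exact pow_ne_zero _ (ne_of_gt ht)
  have hHl : LocallyIntegrableOn (fun r => (r ^ κ)⁻¹ • H r) (Ioi 0) := by
    rw [locallyIntegrableOn_iff isLocallyClosed_Ioi]
    intro K hK hKc
    refine (hH.locallyIntegrableOn.integrableOn_compact_subset hK hKc).continuousOn_smul ?_ hKc
    exact ContinuousOn.inv₀ (continuous_pow _).continuousOn fun t ht => pow_ne_zero _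
      (ne_of_gt (hK ht))
  have hfl : LocallyIntegrableOn (fun r => (r ^ κ)⁻¹ • H r - primitive κ F r) (Ioi 0) :=
    hHl.sub (hQc.locallyIntegrableOn measurableSet_Ioi)
  suffices hkey : ∀ η η' : ℝ → ℝ, ContDiff ℝ ∞ η → (∀ x, HasDerivAt η (η' x) x) →
      HasCompactSupport η → tsupport η ⊆ Ioi 0 →
      ∫ x, η' x • ((x ^ κ)⁻¹ • H x - primitive κ F x) = 0 by
    obtain ⟨c, hc⟩ := ae_eq_const_of_integral_deriv_smul hfl hkey
    refine ⟨c, ?_⟩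
    filter_upwards [hc] with r hr h0
    rw [← hr h0, sub_add_cancel, smul_smul, mul_inv_cancel₀ (pow_ne_zero _ h0.ne'), one_smul]
  intro η η' hη hηd hηc hηs
  obtain ⟨a, b, ha, hab, hz⟩ := exists_Icc_of_tsupport hηc hηs
  have hη'c : Continuous η' := by
    rw [← show deriv η = η' from funext fun x => (hηd x).deriv]
    exact hη.continuous_deriv (by simp)
  have hz' : ∀ x, x ∉ Icc a b → η' x = 0 := by
    intro x hx
    have : η =ᶠ[𝓝 x] fun _ => 0 := by
      filter_upwards [isClosed_Icc.isOpen_compl.mem_nhds hx] with y hy using hz y hy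
    rw [← (hηd x).deriv, this.deriv_eq, deriv_const]
  have hb : 0 < b := ha.trans_le hab
  -- This is h', found by solving 2 r^{2κ+2} h'(r²) = η(r).
  set χ : ℝ → ℝ := fun s => η (√s) / (2 * s ^ (κ + 1)) with hχ
  have hχs : ContDiff ℝ ∞ χ := contDiff_comp_sqrt_div hη _ ha fun x hx =>
    hz x fun h => absurd h.1 (not_le.2 hx)
  have hχz : ∀ s, s ∉ Icc 0 (b ^ 2) → χ s = 0 := by
    intro s hs
    have : √s ∉ Icc a b := by
      intro h
      have hs0 : 0 < s := Real.sqrt_pos.1 (ha.trans_le h.1)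
      exact hs ⟨hs0.le, (Real.sqrt_le_left hb.le).1 h.2⟩
    simp [hχ, hz _ this]
  obtain ⟨h, h1, h2, h3, -⟩ := exists_antideriv hχs (sq_nonneg b) hχz
  have hχd : ∀ s, HasDerivAt χ (deriv χ s) s := fun s =>
    (hχs.differentiable (by simp) s).hasDerivAt
  have hχr : ∀ r, 0 < r → 2 * r ^ (2 * κ + 2) * χ (r ^ 2) = η r := by
    intro r hr
    simp only [hχ, Real.sqrt_sq hr.le]
    field_simp
    ring
  have hηr : ∀ r, 0 < r →
      η' r = r ^ (2 * κ + 1) * (4 * r ^ 2 * deriv χ (r ^ 2) + 4 * (κ + 1) * χ (r ^ 2)) := by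
    intro r hr
    have e1 : HasDerivAt (fun r => 2 * r ^ (2 * κ + 2) * χ (r ^ 2))
        (2 * (((2 * κ + 2 : ℕ) : ℝ) * r ^ (2 * κ + 1)) * χ (r ^ 2)
          + 2 * r ^ (2 * κ + 2) * (deriv χ (r ^ 2) * (2 * r))) r := by
      refine HasDerivAt.mul ((hasDerivAt_pow (2 * κ + 2) r).const_mul 2) ?_
      refine ((hχd (r ^ 2)).comp r (hasDerivAt_pow 2 r)).congr_deriv ?_
      simp
    have e2 : HasDerivAt (fun r => 2 * r ^ (2 * κ + 2) * χ (r ^ 2)) (η' r) r := by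
      refine (hηd r).congr_of_eventuallyEq ?_
      filter_upwards [Ioi_mem_nhds hr] with x hx using hχr x hx
    rw [e2.unique e1]
    push_cast
    ring
  have hweak := hw h χ (deriv χ) h1 h2 hχd ⟨_, h3⟩
  rw [integral_radialMeasure, integral_radialMeasure] at hweak
  have eL : ∫ r in Ioi (0 : ℝ), r • (r ^ κ * (4 * r ^ 2 * deriv χ (r ^ 2)
      + 4 * (κ + 1) * χ (r ^ 2))) • H r = ∫ r, η' r • (r ^ κ)⁻¹ • H r := by
    rw [← setIntegral_eq_integral_of_forall_compl_eq_zero (s := Ioi (0 : ℝ))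
      (f := fun r => η' r • (r ^ κ)⁻¹ • H r)]
    · refine setIntegral_congr_fun measurableSet_Ioi fun r hr => ?_
      have hr0 : (0 : ℝ) < r := hr
      rw [hηr r hr, smul_smul, smul_smul]
      congr 1
      field_simp
      ring
    · intro x hx
      rw [hz' x fun h => hx (ha.trans_le h.1), zero_smul]
  have eR : ∫ r in Ioi (0 : ℝ), r • (r ^ κ * h (r ^ 2)) • F r
      = ∫ r in 0..b, h (r ^ 2) • (r ^ (κ + 1) • F r) := by
    rw [intervalIntegral.integral_of_le hb.le, ← integral_indicator measurableSet_Ioi,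
      ← integral_indicator measurableSet_Ioc]
    congr 1
    ext r
    by_cases hr : r ∈ Ioc 0 b
    · rw [indicator_of_mem hr, indicator_of_mem (show r ∈ Ioi 0 from hr.1), smul_smul, smul_smul]
      congr 1; ring
    · rw [indicator_of_notMem hr]
      by_cases hr0 : r ∈ Ioi (0 : ℝ)
      · have : b < r := not_le.1 fun h => hr ⟨hr0, h⟩
        rw [indicator_of_mem hr0, h3 (r ^ 2) (pow_le_pow_left₀ hb.le this.le 2)]
        simp
      · rw [indicator_of_notMem hr0]
  have hg : ∀ r, HasDerivAt (fun r => h (r ^ 2)) (2 * r * χ (r ^ 2)) r := fun r => by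
    have := (h2 (r ^ 2)).comp r (hasDerivAt_pow 2 r)
    refine this.congr_deriv ?_
    simp; ring
  rw [eL, eR, integral_smul_eq_neg_integral_deriv_smul hb.le (hF.intervalIntegrable κ le_rfl hb.le)
    hg (by have := hχs.continuous; fun_prop) (h3 _ le_rfl)] at hweak
  -- Both sides equal -∫ η r^{-2κ-1} `moment κ F`: on the left by parts, on the right because 2r
  -- χ(r²) = r^{-2κ-1} η.
  have eI : ∫ r, η' r • primitive κ F r
      = -∫ r in 0..b, (2 * r * χ (r ^ 2)) • ∫ s in 0..r, s ^ (κ + 1) • F s := by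
    have i1 : ∫ r, η' r • primitive κ F r = ∫ r in (a / 2)..(b + 1), η' r • primitive κ F r := by
      rw [intervalIntegral.integral_of_le (by linarith),
        setIntegral_eq_integral_of_forall_compl_eq_zero]
      intro x hx
      rw [hz' x fun h => hx ⟨by linarith [h.1], by linarith [h.2]⟩, zero_smul]
    have hsub : uIcc (a / 2) (b + 1) ⊆ Ioi 0 := by
      rw [uIcc_of_le (by linarith)]
      exact fun x hx => (half_pos ha).trans_le hx.1
    have i2 := intervalIntegral.integral_smul_deriv_eq_deriv_smul_of_hasDerivAt
      (u := η) (v := primitive κ F) (u' := η')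
      (v' := fun t : ℝ => (t ^ (2 * κ + 1))⁻¹ • moment κ F t) (a := a / 2) (b := b + 1)
      hη.continuous.continuousOn (hQc.mono hsub) (fun x _ => hηd x)
      (fun x hx => hQd x (hsub ⟨hx.1.le, hx.2.le⟩)) (hη'c.intervalIntegrable _ _)
      ((hpc.mono hsub).intervalIntegrable)
    rw [hz (a / 2) fun h => by linarith [h.1], hz (b + 1) fun h => by linarith [h.2], zero_smul,
      zero_smul, sub_zero, zero_sub] at i2
    rw [i1, ← neg_eq_iff_eq_neg, ← i2, intervalIntegral.integral_of_le (by linarith),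
      intervalIntegral.integral_of_le hb.le, ← integral_indicator measurableSet_Ioc,
      ← integral_indicator measurableSet_Ioc]
    congr 1
    ext1 r
    by_cases hr : r ∈ Icc a b
    · have hr0 : 0 < r := ha.trans_le hr.1
      rw [indicator_of_mem (show r ∈ Ioc (a / 2) (b + 1) from
          ⟨by linarith [hr.1], by linarith [hr.2]⟩), indicator_of_mem (show r ∈ Ioc 0 b from
          ⟨hr0, hr.2⟩), ← hχr r hr0, smul_smul, moment]
      congr 1
      field_simp
      ring
    · have e1 : η r = 0 := hz r hr
      have e2 : 0 < r → χ (r ^ 2) = 0 := fun hr0 => by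
        have := hχr r hr0
        rw [e1] at this
        exact (mul_eq_zero.1 this).resolve_left (by positivity)
      rw [indicator_apply, indicator_apply]
      simp only [e1, zero_smul, ite_self]
      split_ifs with h0
      · rw [e2 h0.1]; simp
      · rfl
  have i3 : Integrable fun r => η' r • (r ^ κ)⁻¹ • H r := by
    refine (integrableOn_iff_integrable_of_support_subset (s := Icc a b) fun x hx => ?_).1 ?_
    · exact by_contra fun h => hx (by simp [hz' x h])
    · exact (hHl.integrableOn_compact_subset (fun x hx => ha.trans_le hx.1)
        isCompact_Icc).continuousOn_smul hη'c.continuousOn isCompact_Icc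
  have i4 : Integrable fun r => η' r • primitive κ F r := by
    refine (integrableOn_iff_integrable_of_support_subset (s := Icc a b) fun x hx => ?_).1 ?_
    · exact by_contra fun h => hx (by simp [hz' x h])
    · exact (hη'c.continuousOn.smul (hQc.mono fun x hx => ha.trans_le hx.1)).integrableOn_Icc
  simp only [smul_sub]
  rw [integral_sub i3 i4, hweak, eI, sub_self]

section

/-! ### Regular radial solutions -/

theorem contDiffOn_two_of_hasDerivAt {y y₁ y₂ : ℝ → ℂ} (h1 : ∀ r, 0 < r → HasDerivAt y (y₁ r) r)
    (h2 : ∀ r, 0 < r → HasDerivAt y₁ (y₂ r) r) (h3 : ContinuousOn y₂ (Ioi 0)) :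
    ContDiffOn ℝ 2 y (Ioi 0) := by
  have e1 : EqOn (deriv y) y₁ (Ioi 0) := fun r hr => (h1 r hr).deriv
  have e2 : EqOn (deriv y₁) y₂ (Ioi 0) := fun r hr => (h2 r hr).deriv
  rw [show (2 : WithTop ℕ∞) = 1 + 1 by norm_num, contDiffOn_succ_iff_deriv_of_isOpen isOpen_Ioi]
  refine ⟨fun r hr => (h1 r hr).differentiableAt.differentiableWithinAt, by simp, ?_⟩
  refine ContDiffOn.congr ?_ e1
  rw [show (1 : WithTop ℕ∞) = 0 + 1 by norm_num, contDiffOn_succ_iff_deriv_of_isOpen isOpen_Ioi]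
  refine ⟨fun r hr => (h2 r hr).differentiableAt.differentiableWithinAt, by simp, ?_⟩
  exact contDiffOn_zero.2 (h3.congr e2)

section ContDiffOn
variable {E : Type*} [NormedAddCommGroup E] [NormedSpace ℝ E] {y : ℝ → E}

theorem hasDerivAt_of_contDiffOn (hy : ContDiffOn ℝ 2 y (Ioi 0)) {r : ℝ} (hr : 0 < r) :
    HasDerivAt y (deriv y r) r :=
  ((hy.differentiableOn (by norm_num) r hr).differentiableAt (Ioi_mem_nhds hr)).hasDerivAt

theorem hasDerivAt_deriv_of_contDiffOn (hy : ContDiffOn ℝ 2 y (Ioi 0)) {r : ℝ} (hr : 0 < r) :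
    HasDerivAt (deriv y) (deriv (deriv y) r) r :=
  (((hy.deriv_of_isOpen isOpen_Ioi (m := 1) (by norm_num)).differentiableOn one_ne_zero
    r hr).differentiableAt (Ioi_mem_nhds hr)).hasDerivAt

theorem continuousOn_deriv_of_contDiffOn (hy : ContDiffOn ℝ 2 y (Ioi 0)) :
    ContinuousOn (deriv y) (Ioi 0) := fun _ hr =>
  (hasDerivAt_deriv_of_contDiffOn hy hr).continuousAt.continuousWithinAt

end ContDiffOn

theorem hasDerivAt_moment {F : ℝ → ℂ} (hF : LocSq F) (hc : ContinuousOn F (Ioi 0)) (κ : ℕ) {r : ℝ}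
    (hr : 0 < r) : HasDerivAt (moment κ F) ((r : ℂ) ^ (κ + 1) * F r) r := by
  have hc' : ContinuousOn (fun s : ℝ => s ^ (κ + 1) • F s) (Ioi 0) :=
    (continuous_pow _).continuousOn.smul hc
  have := intervalIntegral.integral_hasDerivAt_right (hF.intervalIntegrable κ le_rfl hr.le)
    (hc'.stronglyMeasurableAtFilter isOpen_Ioi r hr) (hc'.continuousAt (Ioi_mem_nhds hr))
  refine this.congr_deriv ?_
  simp

theorem hasDerivAt_ofReal_pow (n : ℕ) (r : ℝ) :
    HasDerivAt (fun r : ℝ => (r : ℂ) ^ n) (n * (r : ℂ) ^ (n - 1)) r := by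
  simpa using (hasDerivAt_pow n (r : ℂ)).comp_ofReal

/-- `y = r^κ (c + ∫₁ʳ t^(-2κ-1) ∫₀ᵗ s^(κ+1) F)` on `r > 0`: the solution of
`y'' + y'/r - (κ²/r²) y = F` with no singular part at the origin. -/
structure RegularSol (κ : ℕ) (c : ℂ) (F y : ℝ → ℂ) : Prop where
  locSq : LocSq F
  cont : ContinuousOn F (Ioi 0)
  eq : ∀ r, 0 < r → y r = (r : ℂ) ^ κ * (c + primitive κ F r)

namespace RegularSol
variable {κ : ℕ} {c : ℂ} {F y : ℝ → ℂ}

theorem hasDerivAt_primitive (h : RegularSol κ c F y) {r : ℝ} (hr : 0 < r) :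
    HasDerivAt (primitive κ F) (((r : ℂ) ^ (2 * κ + 1))⁻¹ * moment κ F r) r := by
  refine (h.locSq.hasDerivAt_primitive κ hr).congr_deriv ?_
  simp

theorem hasDerivAt (h : RegularSol κ c F y) {r : ℝ} (hr : 0 < r) :
    HasDerivAt y (κ / r * y r + ((r : ℂ) ^ (κ + 1))⁻¹ * moment κ F r) r := by
  have h1 : HasDerivAt (fun r : ℝ => (r : ℂ) ^ κ * (c + primitive κ F r)) _ r :=
    (hasDerivAt_ofReal_pow κ r).mul ((h.hasDerivAt_primitive hr).const_add c)
  have h2 : HasDerivAt y _ r := h1.congr_of_eventuallyEq (by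
    filter_upwards [Ioi_mem_nhds hr] with x hx using h.eq x hx)
  refine h2.congr_deriv ?_
  have hr' : (r : ℂ) ≠ 0 := by exact_mod_cast hr.ne'
  rw [h.eq r hr]
  have e : (κ : ℂ) * (r : ℂ) ^ (κ - 1) = κ / r * (r : ℂ) ^ κ := by
    rcases κ with _ | n
    · simp
    · simp only [Nat.add_sub_cancel]; field_simp; ring
  rw [e]
  have e3 : (r : ℂ) ^ κ * ((r : ℂ) ^ (2 * κ + 1))⁻¹ = ((r : ℂ) ^ (κ + 1))⁻¹ := by
    field_simp; ring
  rw [← e3]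
  ring

theorem hasDerivAt_deriv (h : RegularSol κ c F y) {r : ℝ} (hr : 0 < r) :
    HasDerivAt (fun r : ℝ => κ / (r : ℂ) * y r + ((r : ℂ) ^ (κ + 1))⁻¹ * moment κ F r)
      (κ ^ 2 / (r : ℂ) ^ 2 * y r + F r
        - (κ / r * y r + ((r : ℂ) ^ (κ + 1))⁻¹ * moment κ F r) / r) r := by
  have hr' : (r : ℂ) ≠ 0 := by exact_mod_cast hr.ne'
  have h1 : HasDerivAt (fun r : ℝ => (κ : ℂ) / (r : ℂ)) (-(κ : ℂ) / (r : ℂ) ^ 2) r := by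
    have := ((hasDerivAt_inv hr').comp_ofReal).const_mul (κ : ℂ)
    refine (this.congr_deriv ?_)
    ring
  have h2 : HasDerivAt (fun r : ℝ => ((r : ℂ) ^ (κ + 1))⁻¹)
      (-((κ + 1 : ℕ) * (r : ℂ) ^ κ) / ((r : ℂ) ^ (κ + 1)) ^ 2) r :=
    (hasDerivAt_ofReal_pow (κ + 1) r).fun_inv (pow_ne_zero _ hr')
  refine ((h1.mul (h.hasDerivAt hr)).add (h2.mul (hasDerivAt_moment h.locSq h.cont κ hr))).congr_deriv
    ?_
  push_cast
  field_simp
  ring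

theorem contDiffOn (h : RegularSol κ c F y) : ContDiffOn ℝ 2 y (Ioi 0) := by
  refine contDiffOn_two_of_hasDerivAt (fun r hr => h.hasDerivAt hr)
    (fun r hr => h.hasDerivAt_deriv hr) ?_
  have hy : ContinuousOn y (Ioi 0) := fun r hr =>
    (h.hasDerivAt hr).continuousAt.continuousWithinAt
  have hy1 : ContinuousOn (fun r : ℝ => κ / (r : ℂ) * y r + ((r : ℂ) ^ (κ + 1))⁻¹ * moment κ F r)
    (Ioi 0) := fun r hr => (h.hasDerivAt_deriv hr).continuousAt.continuousWithinAt
  have hrc : ContinuousOn (fun r : ℝ => (r : ℂ)) (Ioi 0) := Complex.continuous_ofReal.continuousOn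
  have hr0 : ∀ r ∈ Ioi (0 : ℝ), (r : ℂ) ≠ 0 := fun r hr => by exact_mod_cast (ne_of_gt hr)
  exact (((continuousOn_const.div (hrc.pow 2) fun r hr => pow_ne_zero 2 (hr0 r hr)).mul hy).add
    h.cont).sub (hy1.div hrc hr0)

theorem ode (h : RegularSol κ c F y) {r : ℝ} (hr : 0 < r) :
    deriv (deriv y) r + (1 / (r : ℂ)) * deriv y r = κ ^ 2 / (r : ℂ) ^ 2 * y r + F r := by
  have e : deriv y =ᶠ[𝓝 r]
      fun r : ℝ => κ / (r : ℂ) * y r + ((r : ℂ) ^ (κ + 1))⁻¹ * moment κ F r := by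
    filter_upwards [Ioi_mem_nhds hr] with x hx using (h.hasDerivAt hx).deriv
  rw [e.deriv_eq, (h.hasDerivAt_deriv hr).deriv, (h.hasDerivAt hr).deriv]
  ring

end RegularSol

end

/-! ### Behavior at the origin -/

/-- The exponent `n` is κ+1 for locally square integrable `F` and κ+2 for locally bounded `F`; `g`
is a majorant whose integral is explicit. -/
theorem norm_primitive_le {κ n : ℕ} {F : ℝ → ℂ} {C : ℝ}
    (hM : ∀ t, 0 ≤ t → t ≤ 1 → ‖moment κ F t‖ ≤ C * t ^ n) {g : ℝ → ℝ} {r : ℝ}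
    (hr : 0 < r) (hr1 : r ≤ 1) (hg : ∀ t, r < t → t ≤ 1 → C * (t ^ n / t ^ (2 * κ + 1)) ≤ g t)
    (hi : IntervalIntegrable g volume r 1) :
    ‖primitive κ F r‖ ≤ ∫ t in r..1, g t := by
  rw [primitive, intervalIntegral.integral_symm, norm_neg]
  refine intervalIntegral.norm_integral_le_of_norm_le hr1 (ae_of_all _ fun t ht => ?_) hi
  have ht0 : 0 < t := hr.trans ht.1
  refine le_trans ?_ (hg t ht.1 ht.2)
  rw [norm_smul, norm_inv, norm_pow, Real.norm_of_nonneg ht0.le, mul_div_assoc', inv_mul_eq_div]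
  gcongr
  exact hM t ht0.le ht.2

/-- For κ = 0 the moment is O(t), so t^{-1} times it is bounded and integrable up to 0. -/
theorem exists_tendsto_primitive_zero {F : ℝ → ℂ} (hF : LocSq F) :
    ∃ l, Tendsto (primitive 0 F) (𝓝[>] 0) (𝓝 l) := by
  obtain ⟨C, hC, hM⟩ := hF.norm_moment_le 0
  have hi : IntervalIntegrable (fun t : ℝ => (t ^ (2 * 0 + 1))⁻¹ • moment 0 F t) volume 0 1 := by
    rw [intervalIntegrable_iff_integrableOn_Ioc_of_le zero_le_one]
    refine IntegrableOn.of_bound (C := C) (by simp) ?_ ?_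
    · refine ContinuousOn.aestronglyMeasurable ?_ measurableSet_Ioc
      refine ContinuousOn.smul (ContinuousOn.inv₀ (continuous_pow _).continuousOn fun t ht => ?_)
        ((hF.continuousOn_moment 0).mono fun t ht => ht.1.le)
      exact pow_ne_zero _ (ne_of_gt ht.1)
    · filter_upwards [ae_restrict_mem measurableSet_Ioc] with t ht
      have := hM t ht.1.le ht.2
      rw [norm_smul, norm_inv, norm_pow, Real.norm_of_nonneg ht.1.le, inv_mul_eq_div]
      rw [div_le_iff₀ (by have := ht.1; positivity)]
      simpa using this
  have hc : ContinuousOn (primitive 0 F) (uIcc 0 1) :=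
    intervalIntegral.continuousOn_primitive_interval' hi (by simp)
  rw [uIcc_of_le zero_le_one] at hc
  refine ⟨_, ((hc 0 (by simp)).mono_of_mem_nhdsWithin ?_).tendsto⟩
  exact mem_of_superset (Ioo_mem_nhdsGT zero_lt_one) Ioo_subset_Icc_self

/-- For order κ+1 the integrand is O(t^{-κ-1}), at most a constant times r^{-κ} t^{-1} on (r,1). The
product is thus O(r log(1/r)). -/
theorem tendsto_pow_mul_primitive {F : ℝ → ℂ} (hF : LocSq F) (κ : ℕ) :
    Tendsto (fun r : ℝ => (r : ℂ) ^ (κ + 1) * primitive (κ + 1) F r) (𝓝[>] 0) (𝓝 0) := by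
  obtain ⟨C, hC, hM⟩ := hF.norm_moment_le (κ + 1)
  have hlim : Tendsto (fun r : ℝ => C * -(Real.log r * r ^ (1 : ℝ))) (𝓝[>] 0) (𝓝 0) := by
    simpa using ((tendsto_log_mul_rpow_nhdsGT_zero one_pos).neg).const_mul C
  refine squeeze_zero_norm' ?_ hlim
  filter_upwards [Ioo_mem_nhdsGT zero_lt_one] with r hr
  have hr0 := hr.1
  have h := norm_primitive_le hM hr.1 hr.2.le (g := fun t => C * ((r ^ κ)⁻¹ * t⁻¹)) ?_ ?_
  · rw [intervalIntegral.integral_const_mul, intervalIntegral.integral_const_mul,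
      integral_inv_of_pos hr.1 one_pos] at h
    rw [norm_mul, norm_pow, Complex.norm_real, Real.norm_of_nonneg hr.1.le, Real.rpow_one]
    refine (mul_le_mul_of_nonneg_left h (by positivity)).trans (le_of_eq ?_)
    rw [one_div, Real.log_inv]
    field_simp
    ring
  · intro t ht ht1
    have ht0 : 0 < t := hr.1.trans ht
    have e : t ^ (κ + 1 + 1) / t ^ (2 * (κ + 1) + 1) = (t ^ κ)⁻¹ * t⁻¹ := by
      field_simp; ring
    rw [e]
    gcongr
  · refine ContinuousOn.intervalIntegrable ?_
    rw [uIcc_of_le hr.2.le]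
    refine continuousOn_const.mul (continuousOn_const.mul (continuousOn_inv₀.mono fun t ht => ?_))
    exact ne_of_gt (hr.1.trans_le ht.1)

theorem RegularSol.exists_tendsto_zero {κ : ℕ} {c : ℂ} {F y : ℝ → ℂ} (h : RegularSol κ c F y) :
    ∃ l, Tendsto y (𝓝[>] 0) (𝓝 l) := by
  have he : (fun r : ℝ => (r : ℂ) ^ κ * (c + primitive κ F r)) =ᶠ[𝓝[>] 0] y := by
    filter_upwards [self_mem_nhdsWithin] with r hr using (h.eq r hr).symm
  rcases κ with _ | κ
  · obtain ⟨l, hl⟩ := exists_tendsto_primitive_zero h.locSq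
    exact ⟨c + l, (by simpa using hl.const_add c : Tendsto _ _ _).congr' he⟩
  · have h1 : Tendsto (fun r : ℝ => (r : ℂ) ^ (κ + 1) * c) (𝓝[>] 0) (𝓝 0) := by
      have : Continuous fun r : ℝ => (r : ℂ) ^ (κ + 1) * c := by fun_prop
      simpa using (this.tendsto 0).mono_left nhdsWithin_le_nhds
    refine ⟨0 + 0, (h1.add (tendsto_pow_mul_primitive h.locSq κ)).congr' ?_⟩
    filter_upwards [he] with r hr
    rw [← hr, mul_add]

/-- Boundedness on bounded subintervals of `(0, ∞)`. -/
def LocBdd {E : Type*} [NormedAddCommGroup E] (F : ℝ → E) : Prop :=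
  ∀ R : ℝ, ∃ B, 0 ≤ B ∧ ∀ r, 0 < r → r < R → ‖F r‖ ≤ B

theorem LocBdd.of_continuousOn {E : Type*} [NormedAddCommGroup E] {F : ℝ → E}
    (hc : ContinuousOn F (Ioi 0))
    (hb : ∃ M, ∀ᶠ r in 𝓝[>] (0 : ℝ), ‖F r‖ ≤ M) : LocBdd F := by
  intro R
  obtain ⟨M, hM⟩ := hb
  obtain ⟨δ, hδ, hδ'⟩ := (mem_nhdsGT_iff_exists_Ioo_subset).1 hM
  have hδ0 : (0 : ℝ) < δ := hδ
  obtain ⟨B, hB⟩ := isCompact_Icc.exists_bound_of_continuousOn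
    (hc.mono fun r (hr : r ∈ Icc δ R) => hδ0.trans_le hr.1)
  refine ⟨max 0 (max M B), le_max_left _ _, fun r hr hrR => ?_⟩
  rcases lt_or_ge r δ with h | h
  · exact (hδ' ⟨hr, h⟩ : ‖F r‖ ≤ M).trans ((le_max_left _ _).trans (le_max_right _ _))
  · exact (hB r ⟨h, hrR.le⟩).trans ((le_max_right _ _).trans (le_max_right _ _))

theorem LocBdd.of_tendsto {E : Type*} [NormedAddCommGroup E] {F : ℝ → E}
    (hc : ContinuousOn F (Ioi 0))
    (hb : ∃ l, Tendsto F (𝓝[>] 0) (𝓝 l)) : LocBdd F := by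
  obtain ⟨l, hl⟩ := hb
  exact .of_continuousOn hc ⟨‖l‖ + 1,
    hl.norm.eventually (ge_mem_nhds (lt_add_one _))⟩

theorem LocBdd.add {F G : ℝ → ℂ} (hF : LocBdd F) (hG : LocBdd G) :
    LocBdd fun r => F r + G r := by
  intro R
  obtain ⟨A, hA, hA'⟩ := hF R
  obtain ⟨B, hB, hB'⟩ := hG R
  exact ⟨A + B, add_nonneg hA hB, fun r hr hrR =>
    (norm_add_le _ _).trans (add_le_add (hA' r hr hrR) (hB' r hr hrR))⟩

theorem LocBdd.mul {F G : ℝ → ℂ} (hF : LocBdd F) (hG : LocBdd G) :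
    LocBdd fun r => F r * G r := by
  intro R
  obtain ⟨A, hA, hA'⟩ := hF R
  obtain ⟨B, hB, hB'⟩ := hG R
  refine ⟨A * B, mul_nonneg hA hB, fun r hr hrR => ?_⟩
  rw [norm_mul]
  exact mul_le_mul (hA' r hr hrR) (hB' r hr hrR) (norm_nonneg _) hA

theorem radialMeasure_absolutelyContinuous : radialMeasure ≪ volume.restrict (Ioi 0) :=
  withDensity_absolutelyContinuous _ _

theorem ContinuousOn.aestronglyMeasurable_radialMeasure {F : ℝ → ℂ}
    (hc : ContinuousOn F (Ioi 0)) : AEStronglyMeasurable F radialMeasure :=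
  (hc.aestronglyMeasurable measurableSet_Ioi).mono_ac radialMeasure_absolutelyContinuous

theorem LocBdd.locSq {F : ℝ → ℂ} (hF : LocBdd F) (hc : ContinuousOn F (Ioi 0)) : LocSq F := by
  intro R
  obtain ⟨B, hB, hB'⟩ := hF R
  refine MemLp.of_bound (ContinuousOn.aestronglyMeasurable_radialMeasure hc).restrict B ?_
  filter_upwards [ae_restrict_mem measurableSet_Iio, ae_restrict_of_ae ae_radialMeasure_pos]
    with r h1 h2 using hB' r h2 h1

theorem LocBdd.mul_locSq {q F : ℝ → ℂ} (hq : LocBdd q) (hqc : ContinuousOn q (Ioi 0))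
    (hF : LocSq F) : LocSq fun r => q r * F r := by
  intro R
  obtain ⟨B, hB, hB'⟩ := hq R
  refine (hF R).of_le_mul (c := B)
    ((ContinuousOn.aestronglyMeasurable_radialMeasure hqc).restrict.mul (hF R).1) ?_
  filter_upwards [ae_restrict_mem measurableSet_Iio, ae_restrict_of_ae ae_radialMeasure_pos]
    with r h1 h2
  rw [norm_mul]
  exact mul_le_mul_of_nonneg_right (hB' r h2 h1) (norm_nonneg _)

theorem LocBdd.norm_moment_le {F : ℝ → ℂ} (hF : LocBdd F) (κ : ℕ) :
    ∃ C, 0 ≤ C ∧ ∀ t, 0 ≤ t → t ≤ 1 → ‖moment κ F t‖ ≤ C * t ^ (κ + 2) := by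
  -- Any radius above 1 would do, as `LocBdd` bounds only r strictly below it.
  obtain ⟨B, hB, hB'⟩ := hF 2
  refine ⟨B, hB, fun t ht ht1 => ?_⟩
  have := intervalIntegral.norm_integral_le_of_norm_le_const (a := 0) (b := t)
    (f := fun s : ℝ => s ^ (κ + 1) • F s) (C := t ^ (κ + 1) * B) fun s hs => by
      rw [uIoc_of_le ht] at hs
      rw [norm_smul, norm_pow, Real.norm_of_nonneg hs.1.le]
      have h1 := hs.1.le
      gcongr
      · exact hs.2
      · exact hB' s hs.1 (by linarith [hs.2])
  rw [moment]
  refine this.trans (le_of_eq ?_)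
  rw [sub_zero, abs_of_nonneg ht]
  ring

/-- A bounded source gains a power over a square integrable one: the integrand is O(t^{-κ}), so the
logarithm of `tendsto_pow_mul_primitive` disappears. -/
theorem norm_pow_mul_primitive_le {F : ℝ → ℂ} (hF : LocBdd F) (κ : ℕ) :
    ∃ C, 0 ≤ C ∧ ∀ r : ℝ, 0 < r → r ≤ 1 → r ^ (κ + 1) * ‖primitive (κ + 1) F r‖ ≤ C * r := by
  obtain ⟨C, hC, hM⟩ := hF.norm_moment_le (κ + 1)
  refine ⟨C, hC, fun r hr hr1 => ?_⟩
  have h := norm_primitive_le hM hr hr1 (g := fun t => C * (r ^ κ)⁻¹) ?_ (by simp)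
  · rw [intervalIntegral.integral_const, smul_eq_mul] at h
    refine (mul_le_mul_of_nonneg_left h (by positivity)).trans ?_
    have : r ^ (κ + 1) * ((1 - r) * (C * (r ^ κ)⁻¹)) = (1 - r) * (C * r) := by
      field_simp
      ring
    rw [this]
    nlinarith [mul_nonneg hC hr.le]
  · intro t ht ht1
    have ht0 : 0 < t := hr.trans ht
    have e : t ^ (κ + 1 + 2) / t ^ (2 * (κ + 1) + 1) = (t ^ κ)⁻¹ := by
      field_simp; ring
    rw [e]
    gcongr

theorem exists_const_of_hasDerivAt_zero {f : ℝ → ℂ} (h : ∀ r, 0 < r → HasDerivAt f 0 r) :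
    ∃ K, ∀ r, 0 < r → f r = K :=
  ⟨f 1, fun _ hr => isOpen_Ioi.is_const_of_deriv_eq_zero isPreconnected_Ioi
    (fun x hx => (h x hx).differentiableAt.differentiableWithinAt)
    (fun x hx => (h x hx).deriv) hr (one_pos : (0 : ℝ) < 1)⟩

/-- Bounded solutions have no singular part at the origin. -/
theorem exists_regularSol {κ : ℕ} {F y : ℝ → ℂ} (hy : ContDiffOn ℝ 2 y (Ioi 0))
    (hF : LocBdd F) (hFc : ContinuousOn F (Ioi 0)) (hyb : LocBdd y)
    (hode : ∀ r : ℝ, 0 < r →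
      deriv (deriv y) r + (1 / (r : ℂ)) * deriv y r = κ ^ 2 / (r : ℂ) ^ 2 * y r + F r) :
    ∃ c, RegularSol κ c F y := by
  have hFs := hF.locSq hFc
  have hcast : ∀ r : ℝ, 0 < r → (r : ℂ) ≠ 0 := fun r hr => by exact_mod_cast hr.ne'
  -- First integration: r^{κ+1} y' - κ r^κ y has derivative r^{κ+1} F, which is also the derivative
  -- of the moment.
  obtain ⟨K, hK⟩ := exists_const_of_hasDerivAt_zero (f := fun r : ℝ =>
      (r : ℂ) ^ (κ + 1) * deriv y r - κ * (r : ℂ) ^ κ * y r - moment κ F r) fun r hr => by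
    have hr' := hcast r hr
    have h1 := ((((hasDerivAt_ofReal_pow (κ + 1) r).mul (hasDerivAt_deriv_of_contDiffOn hy hr)).sub
      (((hasDerivAt_ofReal_pow κ r).const_mul (κ : ℂ)).mul (hasDerivAt_of_contDiffOn hy hr))).sub
      (hasDerivAt_moment hFs hFc κ hr))
    refine h1.congr_deriv ?_
    have h2 := hode r hr
    have h3 : deriv (deriv y) r
        = κ ^ 2 / (r : ℂ) ^ 2 * y r + F r - (1 / (r : ℂ)) * deriv y r := by
      rw [← h2]; ring
    rw [h3]
    rcases κ with _ | n
    · simp; field_simp; ring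
    · simp only [Nat.add_sub_cancel]
      push_cast
      field_simp
      ring
  -- Second integration: (r^{-κ} y)' = r^{-2κ-1} (`moment κ F` + K), and `E` is an antiderivative of
  -- r^{-2κ-1}.
  set E : ℝ → ℂ := if κ = 0 then fun r => ((Real.log r : ℝ) : ℂ)
    else fun r => -((r : ℂ) ^ (2 * κ))⁻¹ / (2 * κ) with hE
  have hEd : ∀ r : ℝ, 0 < r → HasDerivAt E (((r : ℂ) ^ (2 * κ + 1))⁻¹) r := by
    intro r hr
    have hr' := hcast r hr
    rw [hE]
    split_ifs with h
    · subst h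
      simpa using (Real.hasDerivAt_log hr.ne').ofReal_comp
    · have h0 : (κ : ℂ) ≠ 0 := by exact_mod_cast h
      refine ((((hasDerivAt_ofReal_pow (2 * κ) r).fun_inv (pow_ne_zero _ hr')).neg).div_const
        (2 * (κ : ℂ))).congr_deriv ?_
      obtain ⟨n, rfl⟩ : ∃ n, κ = n + 1 := Nat.exists_eq_succ_of_ne_zero h
      rw [show 2 * (n + 1) - 1 = 2 * n + 1 by omega]
      push_cast at h0 ⊢
      field_simp
      ring
  obtain ⟨c, hc⟩ := exists_const_of_hasDerivAt_zero (f := fun r : ℝ =>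
      ((r : ℂ) ^ κ)⁻¹ * y r - primitive κ F r - K * E r) fun r hr => by
    have hr' := hcast r hr
    have hP : HasDerivAt (primitive κ F) (((r : ℂ) ^ (2 * κ + 1))⁻¹ * moment κ F r) r := by
      refine (hFs.hasDerivAt_primitive κ hr).congr_deriv ?_
      simp
    refine ((((hasDerivAt_ofReal_pow κ r).fun_inv (pow_ne_zero _ hr')).mul
      (hasDerivAt_of_contDiffOn hy hr)).sub hP |>.sub ((hEd r hr).const_mul K)).congr_deriv ?_
    have h2 := hK r hr
    rw [← h2]
    rcases κ with _ | n
    · simp; field_simp; ring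
    · simp only [Nat.add_sub_cancel]
      push_cast
      field_simp
      ring
  have hrep : ∀ r : ℝ, 0 < r → y r = (r : ℂ) ^ κ * (c + primitive κ F r + K * E r) := by
    intro r hr
    rw [← hc r hr]
    have := pow_ne_zero κ (hcast r hr)
    field_simp
    ring
  suffices hK0 : K = 0 by
    exact ⟨c, hFs, hFc, fun r hr => by rw [hrep r hr, hK0]; ring⟩
  -- If K ≠ 0, then r^κ E would be bounded near 0, because y, r^κ c and r^κ times the primitive are.
  -- But it grows like log r or r^{-κ}.
  by_contra hK0
  have hPb : LocBdd fun r : ℝ => (r : ℂ) ^ κ * primitive κ F r := by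
    refine .of_tendsto (fun r hr => ?_) ?_
    · refine ContinuousAt.continuousWithinAt ?_
      exact ContinuousAt.mul (by fun_prop) (hFs.hasDerivAt_primitive κ hr).continuousAt
    · rcases κ with _ | n
      · simpa using exists_tendsto_primitive_zero hFs
      · exact ⟨0, tendsto_pow_mul_primitive hFs n⟩
  obtain ⟨A, hA, hA'⟩ := hPb 1
  obtain ⟨B, hB, hB'⟩ := hyb 1
  have hbd : ∀ r : ℝ, 0 < r → r < 1 → r ^ κ * ‖E r‖ ≤ (B + A + ‖c‖) / ‖K‖ := by
    intro r hr hr1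
    rw [le_div_iff₀ (norm_pos_iff.2 hK0)]
    have e : (r : ℂ) ^ κ * E r * K = y r - (r : ℂ) ^ κ * primitive κ F r - (r : ℂ) ^ κ * c := by
      rw [hrep r hr]; ring
    have e2 := congrArg norm e
    rw [norm_mul, norm_mul, norm_pow, Complex.norm_real, Real.norm_of_nonneg hr.le] at e2
    rw [e2]
    refine (norm_sub_le _ _).trans (add_le_add ((norm_sub_le _ _).trans
      (add_le_add (hB' r hr hr1) (hA' r hr hr1))) ?_)
    rw [norm_mul, norm_pow, Complex.norm_real, Real.norm_of_nonneg hr.le]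
    exact mul_le_of_le_one_left (norm_nonneg _) (pow_le_one₀ hr.le hr1.le)
  have hlim : Tendsto (fun r : ℝ => r ^ κ * ‖E r‖) (𝓝[>] 0) atTop := by
    rw [hE]
    split_ifs with h
    · subst h
      simp only [pow_zero, one_mul, Complex.norm_real, Real.norm_eq_abs]
      exact tendsto_abs_atBot_atTop.comp Real.tendsto_log_nhdsGT_zero
    · have h0 : 0 < (κ : ℝ) := by exact_mod_cast Nat.pos_of_ne_zero h
      have h1 : Tendsto (fun r : ℝ => (r⁻¹) ^ κ / (2 * κ)) (𝓝[>] 0) atTop :=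
        ((tendsto_pow_atTop h).comp tendsto_inv_nhdsGT_zero).atTop_div_const (by positivity)
      refine h1.congr' ?_
      filter_upwards [self_mem_nhdsWithin] with r hr
      have hr0 : (0 : ℝ) < r := hr
      rw [norm_div, norm_neg, norm_inv, norm_pow, Complex.norm_real, Real.norm_of_nonneg hr0.le,
        norm_mul]
      simp only [RCLike.norm_ofNat, RCLike.norm_natCast, inv_pow]
      field_simp
      ring
  obtain ⟨r, h1, h2⟩ := ((hlim.eventually_gt_atTop ((B + A + ‖c‖) / ‖K‖)).and
    (Ioo_mem_nhdsGT (zero_lt_one' ℝ))).exists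
  exact absurd (hbd r h2.1 h2.2) (not_le.2 h1)

/-- For κ ≥ 1 the solution is O(r), and for κ = 0 the factor κ removes the quotient. The derivative
is κ y / r plus r^{-κ-1} times a moment that is O(r^{κ+2}). -/
theorem RegularSol.norm_le {κ : ℕ} {c : ℂ} {F y : ℝ → ℂ} (h : RegularSol κ c F y)
    (hF : LocBdd F) :
    ∃ B, ∀ r, 0 < r → r ≤ 1 → κ * ‖y r‖ / r ≤ B ∧ ‖deriv y r‖ ≤ B := by
  obtain ⟨C, hC, hM⟩ := hF.norm_moment_le κ
  have h1 : ∃ B, ∀ r, 0 < r → r ≤ 1 → κ * ‖y r‖ / r ≤ B := by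
    rcases κ with _ | n
    · exact ⟨0, fun r _ _ => by simp⟩
    · obtain ⟨D, hD, hP⟩ := norm_pow_mul_primitive_le hF n
      refine ⟨(n + 1 : ℕ) * (‖c‖ + D), fun r hr hr1 => ?_⟩
      rw [div_le_iff₀ hr, mul_assoc]
      refine mul_le_mul_of_nonneg_left ?_ (by positivity)
      rw [h.eq r hr, mul_add]
      refine (norm_add_le _ _).trans ?_
      simp only [norm_mul, norm_pow, Complex.norm_real, Real.norm_of_nonneg hr.le]
      rw [add_mul]
      refine add_le_add ?_ (hP r hr hr1)
      rw [mul_comm]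
      refine mul_le_mul_of_nonneg_left ?_ (norm_nonneg _)
      rw [pow_succ]
      exact mul_le_of_le_one_left hr.le (pow_le_one₀ hr.le hr1)
  obtain ⟨B, hB⟩ := h1
  refine ⟨B + C, fun r hr hr1 => ⟨(hB r hr hr1).trans (by linarith), ?_⟩⟩
  rw [(h.hasDerivAt hr).deriv]
  refine (norm_add_le _ _).trans (add_le_add ?_ ?_)
  · refine le_trans (le_of_eq ?_) (hB r hr hr1)
    simp [abs_of_pos hr]; ring
  · rw [norm_mul, norm_inv, norm_pow, Complex.norm_real, Real.norm_of_nonneg hr.le,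
      inv_mul_eq_div, div_le_iff₀ (by positivity)]
    refine (hM r hr.le hr1).trans ?_
    refine mul_le_mul_of_nonneg_left ?_ hC
    exact pow_le_pow_of_le_one hr.le hr1 (by omega)

section

/-! ### Growth of solutions of the pair system -/

section Growth
variable {f q : ℝ → ℝ}

/-- In the variable log r the function `q` is the derivative of `f`, so `f - c log` is
nondecreasing. -/
theorem le_of_logDeriv_le {c : ℝ} {a b : ℝ} (ha : 0 < a) (hab : a ≤ b)
    (hf : ∀ r, 0 < r → HasDerivAt f (q r / r) r) (hq : ∀ r, a ≤ r → r ≤ b → c ≤ q r) :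
    f a + c * (Real.log b - Real.log a) ≤ f b := by
  have hm : MonotoneOn (fun r => f r - c * Real.log r) (Icc a b) := by
    have hd : ∀ r ∈ Icc a b, HasDerivAt (fun r => f r - c * Real.log r)
        (q r / r - c * r⁻¹) r := fun r hr =>
      (hf r (ha.trans_le hr.1)).sub ((Real.hasDerivAt_log (ha.trans_le hr.1).ne').const_mul c)
    refine monotoneOn_of_deriv_nonneg (convex_Icc a b)
      (fun r hr => (hd r hr).continuousAt.continuousWithinAt) (fun r hr => ?_) fun r hr => ?_
    · exact (hd r (interior_subset hr)).differentiableAt.differentiableWithinAt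
    · have hr' := interior_subset hr
      have hr0 := ha.trans_le hr'.1
      rw [(hd r hr').deriv, div_eq_mul_inv, ← sub_mul]
      exact mul_nonneg (sub_nonneg.2 (hq r hr'.1 hr'.2)) (by positivity)
  have := hm (left_mem_Icc.2 hab) (right_mem_Icc.2 hab) hab
  simp only at this
  linarith

theorem tendsto_atTop_of_pos {R : ℝ} (hR : 0 < R) (hf : ∀ r, 0 < r → HasDerivAt f (q r / r) r)
    (hq : MonotoneOn q (Ici R)) {a : ℝ} (ha : R ≤ a) (hqa : 0 < q a) : Tendsto f atTop atTop := by
  have h1 : Tendsto (fun r => f a + q a * (Real.log r - Real.log a)) atTop atTop :=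
    tendsto_atTop_add_const_left _ _
      ((tendsto_atTop_add_const_right _ _ Real.tendsto_log_atTop).const_mul_atTop hqa)
  refine tendsto_atTop_mono' _ ?_ h1
  filter_upwards [eventually_ge_atTop a] with r hr
  exact le_of_logDeriv_le (hR.trans_le ha) hr hf fun s hs _ => hq ha (ha.trans hs) hs

theorem nonpos_of_tendsto_zero {R : ℝ} (hR : 0 < R)
    (hf : ∀ r, 0 < r → HasDerivAt f (q r / r) r) (hq : MonotoneOn q (Ici R))
    (h0 : Tendsto f atTop (𝓝 0)) {r : ℝ} (hr : R ≤ r) : q r ≤ 0 := by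
  by_contra h
  exact not_tendsto_nhds_of_tendsto_atTop (tendsto_atTop_of_pos hR hf hq hr (not_le.1 h)) 0 h0

/-- A negative value of `q` at r persists to the left by monotonicity, and then f(s) grows at least
like |q(r)| log(1/s) as s → 0. -/
theorem nonneg_of_locBdd (hf : ∀ r, 0 < r → HasDerivAt f (q r / r) r)
    (hq : MonotoneOn q (Ioi 0)) (h0 : LocBdd f) {r : ℝ} (hr : 0 < r) : 0 ≤ q r := by
  by_contra h
  rw [not_le] at h
  obtain ⟨B, hB, hB'⟩ := h0 (r + 1)
  have h1 : Tendsto (fun s => f r + q r * (Real.log s - Real.log r)) (𝓝[>] 0) atTop := by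
    refine tendsto_atTop_add_const_left _ _ ?_
    exact ((tendsto_atBot_add_const_right _ _ Real.tendsto_log_nhdsGT_zero).const_mul_atBot_of_neg h)
  obtain ⟨s, hs1, hs2⟩ := ((h1.eventually_gt_atTop B).and (Ioo_mem_nhdsGT hr)).exists
  have h2 := le_of_logDeriv_le (f := fun x => -f x) (q := fun x => -q x) (c := -q r) hs2.1 hs2.2.le
    (fun x hx => ((hf x hx).neg).congr_deriv (by ring))
    (fun x hx hx' => neg_le_neg (hq (hs2.1.trans_le hx) hr hx'))
  have h3 := hB' s hs2.1 (hs2.2.trans (lt_add_one r))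
  have h4 := (le_abs_self (f s)).trans h3
  linarith

/-- A positive value of `q` would force f → ∞ and contradict integrability, so f is nonincreasing on
[R,∞). Then R (r - R) f(r) is bounded by the integral of s f(s), which gives decay. -/
theorem tendsto_zero_of_integrable {R : ℝ} (hR : 0 < R)
    (hf : ∀ r, 0 < r → HasDerivAt f (q r / r) r) (hq : MonotoneOn q (Ici R))
    (hf0 : ∀ r, 0 < r → 0 ≤ f r) (hi : IntegrableOn (fun r => r * f r) (Ioi R)) :
    Tendsto f atTop (𝓝 0) := by
  have hcont : ContinuousOn (fun r => r * f r) (Ioi 0) := fun r hr =>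
    (continuousAt_id.mul (hf r hr).continuousAt).continuousWithinAt
  have hint : ∀ a b, R ≤ a → a ≤ b → ∫ r in a..b, r * f r ≤ ∫ r in Ioi R, r * f r := by
    intro a b ha hab
    rw [intervalIntegral.integral_of_le hab]
    refine setIntegral_mono_set hi ?_ (Eventually.of_forall fun x hx => ha.trans_lt hx.1)
    filter_upwards [ae_restrict_mem measurableSet_Ioi] with r hr
    exact mul_nonneg (hR.trans hr).le (hf0 r (hR.trans hr))
  have hII : ∀ a b, R ≤ a → a ≤ b → IntervalIntegrable (fun r => r * f r) volume a b := by
    intro a b ha hab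
    refine (hcont.mono fun x hx => ?_).intervalIntegrable
    rw [uIcc_of_le hab] at hx
    exact (hR.trans_le ha).trans_le hx.1
  set I := ∫ r in Ioi R, r * f r with hI
  have hq0 : ∀ r, R ≤ r → q r ≤ 0 := by
    intro a ha
    by_contra h
    have h1 := tendsto_atTop_of_pos hR hf hq ha (not_le.1 h)
    obtain ⟨b, hb⟩ := (h1.eventually_ge_atTop 1).exists_forall_of_atTop
    -- Beyond `c` both r and f are at least 1, so an interval of length I + 1 already contributes
    -- more than I.
    set c := max 1 (max b R) with hc
    have hcR : R ≤ c := (le_max_right _ _).trans (le_max_right _ _)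
    have hcb : b ≤ c := (le_max_left _ _).trans (le_max_right _ _)
    have hc1 : 1 ≤ c := le_max_left _ _
    have hI0 : 0 ≤ I := by simpa using hint R R le_rfl le_rfl
    have h2 := hint c (c + (I + 1)) hcR (by linarith)
    have h3 : ∫ r in c..(c + (I + 1)), (1 : ℝ) ≤ ∫ r in c..(c + (I + 1)), r * f r :=
      intervalIntegral.integral_mono_on (by linarith) (by simp) (hII _ _ hcR (by linarith))
        fun x hx => by
          have h4 : 1 ≤ f x := hb x (hcb.trans hx.1)
          have h5 : 1 ≤ x := hc1.trans hx.1
          nlinarith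
    simp at h3
    linarith
  have hanti : AntitoneOn f (Ici R) := by
    refine antitoneOn_of_deriv_nonpos (convex_Ici R)
      (fun r hr => (hf r (hR.trans_le hr)).continuousAt.continuousWithinAt) (fun r hr => ?_)
      fun r hr => ?_
    · have hr' : R ≤ r := interior_subset hr
      exact (hf r (hR.trans_le hr')).differentiableAt.differentiableWithinAt
    · have hr' : R ≤ r := interior_subset hr
      rw [(hf r (hR.trans_le hr')).deriv]
      exact div_nonpos_of_nonpos_of_nonneg (hq0 r hr') (hR.trans_le hr').le
  have hlim : Tendsto (fun r : ℝ => I * (r - R)⁻¹ * R⁻¹) atTop (𝓝 0) := by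
    have : Tendsto (fun r : ℝ => (r - R)⁻¹) atTop (𝓝 0) :=
      tendsto_inv_atTop_zero.comp (tendsto_atTop_add_const_right _ (-R) tendsto_id)
    simpa using (this.const_mul I).mul_const R⁻¹
  refine squeeze_zero' ?_ ?_ hlim
  · filter_upwards [eventually_gt_atTop 0] with r hr using hf0 r hr
  · filter_upwards [eventually_gt_atTop R] with r hr
    have h1 : ∫ s in R..r, R * f r ≤ ∫ s in R..r, s * f s :=
      intervalIntegral.integral_mono_on hr.le (by simp) (hII _ _ le_rfl hr.le) fun x hx =>
        mul_le_mul hx.1 (hanti hx.1 hr.le hx.2) (hf0 r (hR.trans hr)) (hR.trans_le hx.1).le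
    have h2 := h1.trans (hint R r le_rfl hr.le)
    rw [intervalIntegral.integral_const, smul_eq_mul] at h2
    have h3 : 0 < r - R := sub_pos.2 hr
    rw [← div_eq_mul_inv, ← div_eq_mul_inv, le_div_iff₀ hR, le_div_iff₀ h3]
    linarith

end Growth

/-- The arithmetic–geometric mean inequality. It makes the centrifugal and harmonic terms together
beat μ and λ at every radius once κ is large. -/
theorem nonneg_sub_of_sq_le {κ r M : ℝ} (hr : 0 < r) (hM : M ≤ κ) :
    0 ≤ κ ^ 2 / r ^ 2 + r ^ 2 - 2 * M := by
  have h : 0 ≤ (κ / r - r) ^ 2 := sq_nonneg _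
  have h2 : (κ / r - r) ^ 2 = κ ^ 2 / r ^ 2 + r ^ 2 - 2 * κ := by field_simp; ring
  linarith

/-- The right-hand side `F` of the component equation `y'' + y'/r - (k²/r²) y = F`. -/
def source (μ : ℝ) (w : ℝ → ℝ) (lam : ℂ) (y y' : ℝ → ℂ) (r : ℝ) : ℂ :=
  ((r ^ 2 - 2 * μ + 4 * |w r| ^ 2 : ℝ) - 2 * (Complex.I * lam)) * y r
    + ((2 * |w r| ^ 2 : ℝ) : ℂ) * y' r

theorem natAbs_sq_cast (k : ℤ) : ((k.natAbs : ℕ) : ℂ) ^ 2 = (k : ℂ) ^ 2 := by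
  have h : ((k.natAbs : ℤ)) ^ 2 = k ^ 2 := Int.natAbs_sq k
  rw [← Int.cast_natCast (R := ℂ), ← Int.cast_pow, h, Int.cast_pow]

theorem radialOp_eq_iff (k : ℤ) (μ : ℝ) (w : ℝ → ℝ) (lam : ℂ) (y y' : ℝ → ℂ) {r : ℝ}
    (hr : 0 < r) :
    radialOp k μ y r + ((|w r| ^ 2 : ℝ) : ℂ) * (2 * y r + y' r) = Complex.I * lam * y r ↔
      deriv (deriv y) r + (1 / (r : ℂ)) * deriv y r
        = ((k.natAbs : ℕ) : ℂ) ^ 2 / (r : ℂ) ^ 2 * y r + source μ w lam y y' r := by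
  have hr' : (r : ℂ) ≠ 0 := by exact_mod_cast hr.ne'
  rw [natAbs_sq_cast, radialOp, source]
  push_cast
  constructor
  · intro h
    linear_combination (-2 : ℂ) * h
  · intro h
    linear_combination (-1 / 2 : ℂ) * h

/-- The second equation is the first with the components exchanged, λ replaced by -λ and j + m by j
- m; hence one function `source` serves both. -/
theorem isPairSolution_iff {m : ℤ} {μ : ℝ} {w : ℝ → ℝ} {j : ℤ} {lam : ℂ} {yp ym : ℝ → ℂ} :
    IsPairSolution m μ w j lam yp ym ↔
      ContDiffOn ℝ 2 yp (Ioi 0) ∧ ContDiffOn ℝ 2 ym (Ioi 0) ∧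
      (∀ r : ℝ, 0 < r → deriv (deriv yp) r + (1 / (r : ℂ)) * deriv yp r
        = (((j + m).natAbs : ℕ) : ℂ) ^ 2 / (r : ℂ) ^ 2 * yp r + source μ w lam yp ym r) ∧
      ∀ r : ℝ, 0 < r → deriv (deriv ym) r + (1 / (r : ℂ)) * deriv ym r
        = (((j - m).natAbs : ℕ) : ℂ) ^ 2 / (r : ℂ) ^ 2 * ym r + source μ w (-lam) ym yp r := by
  constructor
  · rintro ⟨h1, h2, h3, h4⟩
    refine ⟨h1, h2, fun r hr => (radialOp_eq_iff _ _ _ _ _ _ hr).1 (h3 r hr), fun r hr =>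
      (radialOp_eq_iff _ _ _ _ _ _ hr).1 ?_⟩
    rw [add_comm (2 * ym r), h4 r hr]; ring
  · rintro ⟨h1, h2, h3, h4⟩
    refine ⟨h1, h2, fun r hr => (radialOp_eq_iff _ _ _ _ _ _ hr).2 (h3 r hr), fun r hr => ?_⟩
    rw [add_comm (yp r), (radialOp_eq_iff _ _ _ _ _ _ hr).2 (h4 r hr)]; ring

/-- `|y₊|² + |y₋|²` -/
def density (yp ym : ℝ → ℂ) (r : ℝ) : ℝ := ‖yp r‖ ^ 2 + ‖ym r‖ ^ 2

/-- `r` times the derivative of the density -/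
def flux (yp ym : ℝ → ℂ) (r : ℝ) : ℝ :=
  r * (2 * inner ℝ (yp r) (deriv yp r) + 2 * inner ℝ (ym r) (deriv ym r))

theorem hasDerivAt_density {yp ym : ℝ → ℂ} (h1 : ContDiffOn ℝ 2 yp (Ioi 0))
    (h2 : ContDiffOn ℝ 2 ym (Ioi 0)) {r : ℝ} (hr : 0 < r) :
    HasDerivAt (density yp ym) (flux yp ym r / r) r := by
  refine ((hasDerivAt_of_contDiffOn h1 hr).norm_sq.add
    (hasDerivAt_of_contDiffOn h2 hr).norm_sq).congr_deriv ?_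
  rw [flux]; field_simp

theorem inner_source (μ : ℝ) (w : ℝ → ℝ) (lam : ℂ) (y y' : ℝ → ℂ) (r : ℝ) :
    (r ^ 2 - 2 * μ + 4 * |w r| ^ 2 - 2 * ‖lam‖) * ‖y r‖ ^ 2 - 2 * |w r| ^ 2 * (‖y r‖ * ‖y' r‖)
      ≤ inner ℝ (y r) (source μ w lam y y' r) := by
  have e : source μ w lam y y' r = (r ^ 2 - 2 * μ + 4 * |w r| ^ 2) • y r
      + (-(2 * (Complex.I * lam)) * y r) + (2 * |w r| ^ 2) • y' r := by
    simp only [source, Complex.real_smul]; ring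
  rw [e, inner_add_right, inner_add_right, real_inner_smul_right, real_inner_smul_right,
    real_inner_self_eq_norm_sq]
  have h1 := (abs_le.1 (abs_real_inner_le_norm (y r) (-(2 * (Complex.I * lam)) * y r))).1
  have h2 := (abs_le.1 (abs_real_inner_le_norm (y r) (y' r))).1
  have h3 : ‖-(2 * (Complex.I * lam)) * y r‖ = 2 * ‖lam‖ * ‖y r‖ := by simp
  rw [h3] at h1
  nlinarith [mul_le_mul_of_nonneg_left h2 (by positivity : 0 ≤ 2 * |w r| ^ 2)]

/-- By the equation, (2r Re⟨y,y'⟩)' = 2r (|y'|² + κ²/r² |y|² + Re⟨y,F⟩) for each component. In the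
sum the nonlinear terms are nonnegative and can be dropped, so no bound on w enters. -/
theorem IsPairSolution.exists_hasDerivAt_flux {m : ℤ} {μ : ℝ} {w : ℝ → ℝ} {j : ℤ} {lam : ℂ}
    {yp ym : ℝ → ℂ} (h : IsPairSolution m μ w j lam yp ym) {r : ℝ} (hr : 0 < r) :
    ∃ d, HasDerivAt (flux yp ym) d r ∧
      2 * r * (‖deriv yp r‖ ^ 2 + ‖deriv ym r‖ ^ 2
        + ((((j + m).natAbs : ℕ) : ℝ) ^ 2 / r ^ 2 + r ^ 2 - 2 * (|μ| + ‖lam‖)) * ‖yp r‖ ^ 2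
        + ((((j - m).natAbs : ℕ) : ℝ) ^ 2 / r ^ 2 + r ^ 2 - 2 * (|μ| + ‖lam‖)) * ‖ym r‖ ^ 2) ≤ d := by
  obtain ⟨h1, h2, h3, h4⟩ := isPairSolution_iff.1 h
  have key : ∀ (y F : ℝ → ℂ) (κ : ℕ), ContDiffOn ℝ 2 y (Ioi 0) →
      (deriv (deriv y) r + (1 / (r : ℂ)) * deriv y r = (κ : ℂ) ^ 2 / (r : ℂ) ^ 2 * y r + F r) →
      HasDerivAt (fun r => r * (2 * inner ℝ (y r) (deriv y r)))
        (2 * r * (‖deriv y r‖ ^ 2 + κ ^ 2 / r ^ 2 * ‖y r‖ ^ 2 + inner ℝ (y r) (F r))) r := by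
    intro y F κ hy hode
    have d1 := hasDerivAt_of_contDiffOn hy hr
    have d2 := hasDerivAt_deriv_of_contDiffOn hy hr
    refine ((hasDerivAt_id r).mul ((d1.inner ℝ d2).const_mul 2)).congr_deriv ?_
    have e : deriv (deriv y) r
        = ((κ : ℝ) ^ 2 / r ^ 2) • y r + F r - (1 / r) • deriv y r := by
      rw [eq_sub_iff_add_eq]
      simp only [Complex.real_smul]
      push_cast
      exact hode
    rw [e, inner_sub_right, inner_add_right, real_inner_smul_right, real_inner_smul_right,
      real_inner_self_eq_norm_sq, real_inner_self_eq_norm_sq]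
    simp only [id]
    field_simp
    ring
  have d := (key yp _ _ h1 (h3 r hr)).add (key ym _ _ h2 (h4 r hr))
  refine ⟨_, d.congr_of_eventuallyEq (Eventually.of_forall fun s => by simp only [flux, Pi.add_apply]; ring), ?_⟩
  have i1 := inner_source μ w lam yp ym r
  have i2 := inner_source μ w (-lam) ym yp r
  rw [norm_neg] at i2
  have hμ := le_abs_self μ
  -- With W = |w|², the nonlinear contribution 4W(a² + b²) - 4Wab is 2W(a - b)² + 2W(a² + b²).
  have a1 : 0 ≤ |w r| ^ 2 * (‖yp r‖ - ‖ym r‖) ^ 2 := by positivity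
  have a2 : 0 ≤ (|μ| - μ) * ‖yp r‖ ^ 2 := mul_nonneg (by linarith) (by positivity)
  have a3 : 0 ≤ (|μ| - μ) * ‖ym r‖ ^ 2 := mul_nonneg (by linarith) (by positivity)
  have a4 : 0 ≤ |w r| ^ 2 * ‖yp r‖ ^ 2 := by positivity
  have a5 : 0 ≤ |w r| ^ 2 * ‖ym r‖ ^ 2 := by positivity
  rw [← mul_add]
  refine mul_le_mul_of_nonneg_left ?_ (by positivity)
  nlinarith

end

section

/-! ### Decay, and finiteness of the set of indices -/

section PairSolution
variable {m : ℤ} {μ : ℝ} {w : ℝ → ℝ} {j : ℤ} {lam : ℂ} {yp ym : ℝ → ℂ}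

theorem monotoneOn_flux (h : IsPairSolution m μ w j lam yp ym) {S : Set ℝ} (hS : Convex ℝ S)
    (hS0 : S ⊆ Ioi 0)
    (hp : ∀ r ∈ S, 0 ≤ (((j + m).natAbs : ℕ) : ℝ) ^ 2 / r ^ 2 + r ^ 2 - 2 * (|μ| + ‖lam‖))
    (hm : ∀ r ∈ S, 0 ≤ (((j - m).natAbs : ℕ) : ℝ) ^ 2 / r ^ 2 + r ^ 2 - 2 * (|μ| + ‖lam‖)) :
    MonotoneOn (flux yp ym) S := by
  refine monotoneOn_of_deriv_nonneg hS (fun r hr => ?_) (fun r hr => ?_) fun r hr => ?_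
  · obtain ⟨d, hd, -⟩ := h.exists_hasDerivAt_flux (hS0 hr)
    exact hd.continuousAt.continuousWithinAt
  · obtain ⟨d, hd, -⟩ := h.exists_hasDerivAt_flux (hS0 (interior_subset hr))
    exact hd.differentiableAt.differentiableWithinAt
  · have hr' := interior_subset hr
    have hr0 : 0 < r := hS0 hr'
    obtain ⟨d, hd, hd'⟩ := h.exists_hasDerivAt_flux hr0
    rw [hd.deriv]
    refine le_trans ?_ hd'
    have h1 := mul_nonneg (hp r hr') (sq_nonneg ‖yp r‖)
    have h2 := mul_nonneg (hm r hr') (sq_nonneg ‖ym r‖)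
    positivity

theorem density_nonneg (r : ℝ) : 0 ≤ density yp ym r := by unfold density; positivity

theorem tendsto_density_atTop (hp : Tendsto yp atTop (𝓝 0)) (hm : Tendsto ym atTop (𝓝 0)) :
    Tendsto (density yp ym) atTop (𝓝 0) := by
  have : Tendsto (fun r => ‖yp r‖ ^ 2 + ‖ym r‖ ^ 2) atTop (𝓝 0) := by
    simpa using (hp.norm.pow 2).add (hm.norm.pow 2)
  exact this

theorem coeff_nonneg_of_le {κ : ℕ} {M r : ℝ} (hM : 0 ≤ M) (hr : 1 + 2 * M ≤ r) :
    r ^ 2 / 2 ≤ (κ : ℝ) ^ 2 / r ^ 2 + r ^ 2 - 2 * M := by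
  have : 0 ≤ (κ : ℝ) ^ 2 / r ^ 2 := by positivity
  nlinarith

theorem monotoneOn_flux_Ici (h : IsPairSolution m μ w j lam yp ym) :
    MonotoneOn (flux yp ym) (Ici (1 + 2 * (|μ| + ‖lam‖))) := by
  have hM : 0 ≤ |μ| + ‖lam‖ := by positivity
  refine monotoneOn_flux h (convex_Ici _) (fun r hr => ?_) (fun r hr => ?_) fun r hr => ?_
  · have : 1 + 2 * (|μ| + ‖lam‖) ≤ r := hr
    simp only [mem_Ioi]; linarith
  · exact le_trans (by positivity) (coeff_nonneg_of_le hM hr)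
  · exact le_trans (by positivity) (coeff_nonneg_of_le hM hr)

theorem IsPairSolution.hasDerivAt_density (h : IsPairSolution m μ w j lam yp ym) (r : ℝ)
    (hr : 0 < r) : HasDerivAt (density yp ym) (flux yp ym r / r) r :=
  GPVortex.hasDerivAt_density h.contDiffOn_plus h.contDiffOn_minus hr

theorem norm_sq_le_density_left (r : ℝ) : ‖yp r‖ ^ 2 ≤ density yp ym r := by
  unfold density; nlinarith [sq_nonneg ‖ym r‖]

theorem norm_sq_le_density_right (r : ℝ) : ‖ym r‖ ^ 2 ≤ density yp ym r := by
  unfold density; nlinarith [sq_nonneg ‖yp r‖]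

theorem tendsto_zero_of_norm_sq_le {y : ℝ → ℂ} {g : ℝ → ℝ} (h : ∀ r, ‖y r‖ ^ 2 ≤ g r)
    (hg : Tendsto g atTop (𝓝 0)) : Tendsto y atTop (𝓝 0) := by
  have h1 : Tendsto (fun r => ‖y r‖ ^ 2) atTop (𝓝 0) :=
    squeeze_zero (fun _ => by positivity) h hg
  rw [tendsto_zero_iff_norm_tendsto_zero]
  simpa using h1.sqrt

/-- Square integrable solutions of the pair system tend to zero at infinity. -/
theorem IsPairSolution.tendsto_atTop (h : IsPairSolution m μ w j lam yp ym)
    (hp : MemLp yp 2 radialMeasure) (hm : MemLp ym 2 radialMeasure) :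
    Tendsto yp atTop (𝓝 0) ∧ Tendsto ym atTop (𝓝 0) := by
  set R := 1 + 2 * (|μ| + ‖lam‖) with hR
  have hR0 : 0 < R := by positivity
  have hi : IntegrableOn (fun r => r * density yp ym r) (Ioi R) := by
    have h1 := ((memLp_two_iff_integrable_sq_norm hp.1).1 hp).add
      ((memLp_two_iff_integrable_sq_norm hm.1).1 hm)
    exact (integrable_radialMeasure_iff.1 h1).mono_set (Ioi_subset_Ioi hR0.le)
  have h0 := tendsto_zero_of_integrable hR0 h.hasDerivAt_density (monotoneOn_flux_Ici h)
    (fun r _ => density_nonneg r) hi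
  exact ⟨tendsto_zero_of_norm_sq_le norm_sq_le_density_left h0,
    tendsto_zero_of_norm_sq_le norm_sq_le_density_right h0⟩

theorem IsPairMode.locBdd (h : IsPairMode m μ w j lam yp ym) : LocBdd yp ∧ LocBdd ym :=
  ⟨.of_tendsto h.solution.contDiffOn_plus.continuousOn h.boundary_plus.1,
    .of_tendsto h.solution.contDiffOn_minus.continuousOn h.boundary_minus.1⟩

/-- Here the flux is nondecreasing on all of (0,∞), and boundedness at the origin makes it
nonnegative. The density is then nondecreasing with limit 0 at infinity, so it vanishes. -/
theorem IsPairMode.lt_of_mode (h : IsPairMode m μ w j lam yp ym)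
    (h1 : |μ| + ‖lam‖ ≤ (j + m).natAbs) (h2 : |μ| + ‖lam‖ ≤ (j - m).natAbs) : False := by
  have hmono := monotoneOn_flux h.solution (convex_Ioi 0) Subset.rfl
    (fun r hr => nonneg_sub_of_sq_le hr h1) (fun r hr => nonneg_sub_of_sq_le hr h2)
  obtain ⟨b1, b2⟩ := h.locBdd
  have hb : LocBdd (density yp ym) := by
    intro R
    obtain ⟨A, hA, hA'⟩ := b1 R
    obtain ⟨B, hB, hB'⟩ := b2 R
    refine ⟨A ^ 2 + B ^ 2, by positivity, fun r hr hrR => ?_⟩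
    rw [Real.norm_of_nonneg (density_nonneg r), density]
    gcongr
    · exact hA' r hr hrR
    · exact hB' r hr hrR
  have hpos : ∀ r, 0 < r → 0 ≤ flux yp ym r := fun r hr =>
    nonneg_of_locBdd h.solution.hasDerivAt_density hmono hb hr
  have hlim := tendsto_density_atTop h.boundary_plus.2 h.boundary_minus.2
  have hm : MonotoneOn (density yp ym) (Ioi 0) := by
    refine monotoneOn_of_deriv_nonneg (convex_Ioi 0)
      (fun r hr => (h.solution.hasDerivAt_density r hr).continuousAt.continuousWithinAt)
      (fun r hr => ?_) fun r hr => ?_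
    · have hr' := interior_subset hr
      exact (h.solution.hasDerivAt_density r hr').differentiableAt.differentiableWithinAt
    · have hr' : (0 : ℝ) < r := interior_subset hr
      rw [(h.solution.hasDerivAt_density r hr').deriv]
      exact div_nonneg (hpos r hr') hr'.le
  obtain ⟨r, hr, hne⟩ := h.nontrivial
  have h0 : density yp ym r ≤ 0 := by
    refine ge_of_tendsto hlim ?_
    filter_upwards [eventually_ge_atTop r] with s hs using hm hr (hr.trans_le hs) hs
  rcases hne with hne | hne
  · have := norm_sq_le_density_left (yp := yp) (ym := ym) r
    have : 0 < ‖yp r‖ := norm_pos_iff.2 hne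
    nlinarith
  · have := norm_sq_le_density_right (yp := yp) (ym := ym) r
    have : 0 < ‖ym r‖ := norm_pos_iff.2 hne
    nlinarith

theorem finite_setOf_isPairMode (m : ℤ) (μ : ℝ) (w : ℝ → ℝ) (lam : ℂ) :
    {j : ℤ | ∃ yp ym, IsPairMode m μ w j lam yp ym}.Finite := by
  obtain ⟨N, hN⟩ := exists_nat_ge (|μ| + ‖lam‖)
  refine (finite_Icc (-(N + |m|) : ℤ) (N + |m|)).subset fun j hj => ?_
  obtain ⟨yp, ym, h⟩ := hj
  by_contra hj
  have h1 : N ≤ (j + m).natAbs ∧ N ≤ (j - m).natAbs := by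
    rw [mem_Icc] at hj
    rcases abs_cases m with h | h <;> omega
  exact h.lt_of_mode (hN.trans (by exact_mod_cast h1.1)) (hN.trans (by exact_mod_cast h1.2))

/-- Beyond R the flux is nondecreasing, and decay of the density keeps it nonpositive, so it
converges and its derivative is integrable. That derivative dominates all four integrands. -/
theorem IsPairMode.exists_integrableOn (h : IsPairMode m μ w j lam yp ym) :
    ∃ R, 1 ≤ R ∧
      (IntegrableOn (fun r => r * ‖deriv yp r‖ ^ 2) (Ioi R) ∧
        IntegrableOn (fun r => r ^ 3 * ‖yp r‖ ^ 2) (Ioi R)) ∧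
      (IntegrableOn (fun r => r * ‖deriv ym r‖ ^ 2) (Ioi R) ∧
        IntegrableOn (fun r => r ^ 3 * ‖ym r‖ ^ 2) (Ioi R)) := by
  have hM : 0 ≤ |μ| + ‖lam‖ := by positivity
  set R := 1 + 2 * (|μ| + ‖lam‖) with hR
  have hR1 : 1 ≤ R := by linarith
  have hR0 : 0 < R := by linarith
  have hmono : MonotoneOn (flux yp ym) (Ici R) := monotoneOn_flux_Ici h.solution
  have hq := fun r hr => nonpos_of_tendsto_zero hR0 h.solution.hasDerivAt_density hmono
    (tendsto_density_atTop h.boundary_plus.2 h.boundary_minus.2) (r := r) hr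
  have hder : ∀ r, R ≤ r → ∃ d, HasDerivAt (flux yp ym) d r ∧
      2 * r * (‖deriv yp r‖ ^ 2 + ‖deriv ym r‖ ^ 2 + r ^ 2 / 2 * ‖yp r‖ ^ 2
        + r ^ 2 / 2 * ‖ym r‖ ^ 2) ≤ d := by
    intro r hr
    have hr0 := hR0.trans_le hr
    obtain ⟨d, hd, hd'⟩ := h.solution.exists_hasDerivAt_flux hr0
    refine ⟨d, hd, le_trans ?_ hd'⟩
    have e1 := coeff_nonneg_of_le (κ := (j + m).natAbs) hM hr
    have e2 := coeff_nonneg_of_le (κ := (j - m).natAbs) hM hr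
    gcongr
  -- Freezing the flux to the left of R makes it monotone on the whole line, as the convergence
  -- theorem for monotone functions requires.
  set q : ℝ → ℝ := fun r => flux yp ym (max R r) with hqdef
  have hqm : Monotone q := fun a b hab =>
    hmono (mem_Ici.2 (le_max_left R a)) (mem_Ici.2 (le_max_left R b)) (max_le_max le_rfl hab)
  have hqb : BddAbove (range q) := ⟨0, by rintro _ ⟨r, rfl⟩; exact hq _ (le_max_left _ _)⟩
  have hlim : Tendsto (flux yp ym) atTop (𝓝 (⨆ r, q r)) := by
    refine (tendsto_atTop_ciSup hqm hqb).congr' ?_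
    filter_upwards [eventually_ge_atTop R] with r hr
    simp [hqdef, max_eq_right hr]
  have hint : IntegrableOn (deriv (flux yp ym)) (Ioi R) := by
    refine integrableOn_Ioi_deriv_of_nonneg (g := flux yp ym) (l := ⨆ r, q r) ?_ ?_ ?_ hlim
    · obtain ⟨d, hd, -⟩ := hder R le_rfl
      exact hd.continuousAt.continuousWithinAt
    · intro r hr
      obtain ⟨d, hd, -⟩ := hder r (le_of_lt hr)
      exact hd.differentiableAt.hasDerivAt
    · intro r hr
      have hr0 : 0 < r := hR0.trans hr
      obtain ⟨d, hd, hd'⟩ := hder r (le_of_lt hr)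
      rw [hd.deriv]
      exact le_trans (by positivity) hd'
  have hsub : Ioi R ⊆ Ioi 0 := Ioi_subset_Ioi hR0.le
  have c1 := h.solution.contDiffOn_plus.continuousOn.mono hsub
  have c2 := h.solution.contDiffOn_minus.continuousOn.mono hsub
  have c3 := (continuousOn_deriv_of_contDiffOn h.solution.contDiffOn_plus).mono hsub
  have c4 := (continuousOn_deriv_of_contDiffOn h.solution.contDiffOn_minus).mono hsub
  have fin : ∀ g : ℝ → ℝ, ContinuousOn g (Ioi R) → (∀ r, R < r → 0 ≤ g r) →
      (∀ r, R < r → g r ≤ 2 * r * (‖deriv yp r‖ ^ 2 + ‖deriv ym r‖ ^ 2 + r ^ 2 / 2 * ‖yp r‖ ^ 2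
        + r ^ 2 / 2 * ‖ym r‖ ^ 2)) → IntegrableOn g (Ioi R) := by
    intro g hg hg0 hgb
    refine Integrable.mono' hint (hg.aestronglyMeasurable measurableSet_Ioi) ?_
    filter_upwards [ae_restrict_mem measurableSet_Ioi] with r hr
    obtain ⟨d, hd, hd'⟩ := hder r (le_of_lt hr)
    rw [hd.deriv, Real.norm_of_nonneg (hg0 r hr)]
    exact (hgb r hr).trans hd'
  have fb : ∀ r, R < r → ∀ a b c d : ℝ, 0 ≤ a → 0 ≤ b → 0 ≤ c → 0 ≤ d →
      r * a ≤ 2 * r * (a + b + c + d) ∧ r * b ≤ 2 * r * (a + b + c + d) ∧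
      2 * r * c ≤ 2 * r * (a + b + c + d) ∧ 2 * r * d ≤ 2 * r * (a + b + c + d) := by
    intro r hr a b c d ha hb hc hd
    have hr0 : 0 < r := hR0.trans hr
    have := mul_nonneg hr0.le ha
    have := mul_nonneg hr0.le hb
    have := mul_nonneg hr0.le hc
    have := mul_nonneg hr0.le hd
    refine ⟨?_, ?_, ?_, ?_⟩ <;> linarith
  refine ⟨R, hR1, ⟨fin _ (continuousOn_id.mul (c3.norm.pow 2)) (fun r hr => ?_) fun r hr => ?_,
    fin _ ((continuousOn_id.pow 3).mul (c1.norm.pow 2)) (fun r hr => ?_) fun r hr => ?_⟩,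
    ⟨fin _ (continuousOn_id.mul (c4.norm.pow 2)) (fun r hr => ?_) fun r hr => ?_,
    fin _ ((continuousOn_id.pow 3).mul (c2.norm.pow 2)) (fun r hr => ?_) fun r hr => ?_⟩⟩
  all_goals have hr0 : 0 < r := hR0.trans hr
  · positivity
  · exact (fb r hr (‖deriv yp r‖ ^ 2) (‖deriv ym r‖ ^ 2) (r ^ 2 / 2 * ‖yp r‖ ^ 2)
      (r ^ 2 / 2 * ‖ym r‖ ^ 2) (by positivity) (by positivity) (by positivity) (by positivity)).1
  · positivity
  · refine le_trans (le_of_eq ?_) (fb r hr (‖deriv yp r‖ ^ 2) (‖deriv ym r‖ ^ 2)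
      (r ^ 2 / 2 * ‖yp r‖ ^ 2) (r ^ 2 / 2 * ‖ym r‖ ^ 2) (by positivity) (by positivity)
      (by positivity) (by positivity)).2.2.1
    ring
  · positivity
  · exact (fb r hr (‖deriv yp r‖ ^ 2) (‖deriv ym r‖ ^ 2) (r ^ 2 / 2 * ‖yp r‖ ^ 2)
      (r ^ 2 / 2 * ‖ym r‖ ^ 2) (by positivity) (by positivity) (by positivity)
      (by positivity)).2.1
  · positivity
  · refine le_trans (le_of_eq ?_) (fb r hr (‖deriv yp r‖ ^ 2) (‖deriv ym r‖ ^ 2)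
      (r ^ 2 / 2 * ‖yp r‖ ^ 2) (r ^ 2 / 2 * ‖ym r‖ ^ 2) (by positivity) (by positivity)
      (by positivity) (by positivity)).2.2.2
    ring

end PairSolution

end

/-! ### Diagonalization -/

/-- The vector `(1, -i)`; `⟪(1,-i), v⟫ = v₀ + i v₁`. -/
def ePlus : C2 := !₂[1, -Complex.I]

/-- The vector `(1, i)`; `⟪(1,i), v⟫ = v₀ - i v₁`. -/
def eMinus : C2 := !₂[1, Complex.I]

theorem inner_ePlus (v : C2) : inner ℂ ePlus v = v 0 + Complex.I * v 1 := by
  simp [ePlus, PiLp.inner_apply, mul_comm]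

theorem inner_eMinus (v : C2) : inner ℂ eMinus v = v 0 - Complex.I * v 1 := by
  simp [eMinus, PiLp.inner_apply]; ring

theorem expJ_mode (m : ℤ) (x : Plane) :
    angularMode (2 * m) x = Real.cos (2 * m * angle x) + Complex.I * Real.sin (2 * m * angle x)
    ∧ angularMode (-(2 * m)) x
      = Real.cos (2 * m * angle x) - Complex.I * Real.sin (2 * m * angle x) := by
  constructor
  · rw [angularMode, show Complex.I * ((2 * m : ℤ) : ℂ) * angle x
      = ((2 * m * angle x : ℝ) : ℂ) * Complex.I by push_cast; ring, Complex.exp_mul_I]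
    push_cast; ring
  · rw [angularMode, show Complex.I * ((-(2 * m) : ℤ) : ℂ) * angle x
      = (-(2 * m * angle x : ℝ) : ℂ) * Complex.I by push_cast; ring, Complex.exp_mul_I]
    push_cast [Complex.cos_neg, Complex.sin_neg]; ring

/-- The eigenvalue relation in the basis that diagonalizes `J`. -/
theorem eigen_pointwise_iff (m : ℤ) (μ : ℝ) (w : ℝ → ℝ) (lam : ℂ) (x : Plane) (Φ G : C2) :
    (lam • Φ).ofLp = (-matJ) *ᵥ (G.ofLp + potential m μ w x *ᵥ Φ.ofLp) ↔
      inner ℂ ePlus G = (Complex.I * lam - (2 * |w ‖x‖| ^ 2 - μ : ℝ)) * inner ℂ ePlus Φ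
          + (-(|w ‖x‖| ^ 2 : ℝ) : ℂ) * (angularMode (2 * m) x * inner ℂ eMinus Φ) ∧
      inner ℂ eMinus G = (-(Complex.I * lam) - (2 * |w ‖x‖| ^ 2 - μ : ℝ)) * inner ℂ eMinus Φ
          + (-(|w ‖x‖| ^ 2 : ℝ) : ℂ) * (angularMode (-(2 * m)) x * inner ℂ ePlus Φ) := by
  obtain ⟨h1, h2⟩ := expJ_mode m x
  rw [h1, h2]
  simp only [inner_ePlus, inner_eMinus]
  set c := Real.cos (2 * m * angle x)
  set s := Real.sin (2 * m * angle x)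
  set W := |w ‖x‖| ^ 2
  have hJ : ∀ v : Fin 2 → ℂ, (-matJ) *ᵥ v = ![v 1, -v 0] := by
    intro v; ext i; fin_cases i <;> simp [matJ, Matrix.mulVec, dotProduct, Fin.sum_univ_two]
  have hV : potential m μ w x *ᵥ Φ.ofLp = ![(2 * W - μ) * Φ 0 + W * (c * Φ 0 + s * Φ 1),
      (2 * W - μ) * Φ 1 + W * (s * Φ 0 - c * Φ 1)] := by
    ext i
    fin_cases i <;>
    · simp [potential, expJ, matJ, matR, Matrix.mulVec, dotProduct, Fin.sum_univ_two,
        Matrix.add_apply, Matrix.sub_apply, Matrix.mul_apply, Matrix.one_apply,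
        W, c, s]
      ring
  rw [hJ, hV]
  have hl : (lam • Φ).ofLp = ![lam * Φ 0, lam * Φ 1] := by
    ext i; fin_cases i <;> simp
  rw [hl]
  have hI := Complex.I_mul_I
  constructor
  · intro h
    have a0 := congrFun h 0
    have a1 := congrFun h 1
    simp at a0 a1
    constructor
    · push_cast
      linear_combination (-Complex.I) * a0 + a1 - (lam * Φ 1 + (W : ℂ) * s * Φ 1) * hI
    · push_cast
      linear_combination (Complex.I) * a0 + a1 + (-lam * Φ 1 - (W : ℂ) * s * Φ 1) * hI
  · rintro ⟨e1, e2⟩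
    push_cast at e1 e2
    ext i
    fin_cases i
    · simp
      linear_combination (Complex.I / 2) * e1 - (Complex.I / 2) * e2
        - (G 1 - lam * Φ 0 + (2 * W - μ) * Φ 1 + (W : ℂ) * (s * Φ 0 - c * Φ 1)) * hI
    · simp
      linear_combination (1 / 2 : ℂ) * e1 + (1 / 2 : ℂ) * e2 + (lam + (W : ℂ) * s) * Φ 1 * hI

/-! ### The radial equations of an eigenfunction -/

theorem memLp_inner_coe (e : C2) (Ψ : L2) : MemLp (fun x => inner ℂ e (Ψ x)) 2 volume :=
  (Lp.memLp Ψ).const_inner e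

theorem LocSq.of_memLp {H : ℝ → ℂ} (hH : MemLp H 2 radialMeasure) : LocSq H :=
  fun _ => hH.mono_measure Measure.restrict_le_self

theorem LocSq.integrable_smul {H : ℝ → ℂ} (hH : LocSq H) {g : ℝ → ℝ} (hg : Continuous g) {b : ℝ}
    (hb : ∀ r, b ≤ r → g r = 0) : Integrable (fun r => g r • H r) radialMeasure := by
  obtain ⟨B, hB⟩ := (isCompact_Icc (a := (0 : ℝ)) (b := b)).exists_bound_of_continuousOn
    hg.continuousOn
  have h1 : Integrable (fun r => g r • H r) (radialMeasure.restrict (Iio b)) := by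
    refine Integrable.bdd_smul (C := B) ((hH b).integrable (by norm_num))
      hg.aestronglyMeasurable ?_
    filter_upwards [ae_restrict_mem measurableSet_Iio, ae_restrict_of_ae ae_radialMeasure_pos]
      with r h1 h2 using hB r ⟨h2.le, le_of_lt h1⟩
  refine (integrableOn_iff_integrable_of_support_subset (s := Iio b) fun x hx => ?_).1 h1
  by_contra h
  exact hx (by simp [hb x (not_lt.1 h)])

theorem conj_real_mul (z : ℝ) (u : ℂ) : conj (z : ℂ) * u = z • u := by
  rw [Complex.conj_ofReal, Complex.real_smul]

theorem integral_eq_combination {α : Type*} [MeasurableSpace α] {ν : Measure α} {p q s : α → ℂ}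
    (hp : Integrable p ν) (hq : Integrable q ν) (c d : ℂ) (h : ∀ x, s x = c * p x + d * q x) :
    ∫ x, s x ∂ν = c * (∫ x, p x ∂ν) + d * ∫ x, q x ∂ν := by
  rw [← integral_const_mul, ← integral_const_mul,
    ← integral_add (hp.const_mul c) (hq.const_mul d)]
  exact integral_congr_ae (ae_of_all _ h)

/-- The test field r^|k| e^{ikθ} g(r²) e is a harmonic polynomial times a smooth function of |x|²,
hence smooth also at the origin, and its Laplacian has the same form. Multiplying L_c by -2 accounts
for the source r² H minus twice the coefficient of `G`. -/
theorem weakRadialEq_of_lcEq {Ψ G : L2} (h : LcEq Ψ G) (k : ℤ) (e : C2) :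
    WeakRadialEq k.natAbs (modeCoeff k fun x => inner ℂ e (Ψ x))
      (fun r => ((r ^ 2 : ℝ) : ℂ) * modeCoeff k (fun x => inner ℂ e (Ψ x)) r
        - 2 * modeCoeff k (fun x => inner ℂ e (G x)) r) := by
  intro g g' g'' hg hg' hg'' ⟨b, hb⟩
  set κ := k.natAbs with hκ
  set a := fun x => inner ℂ e (Ψ x) with ha
  set a' := fun x => inner ℂ e (G x) with ha'
  have hgd : deriv g = g' := funext fun s => (hg' s).deriv
  have hgd' : deriv g' = g'' := funext fun s => (hg'' s).deriv
  have hg1 : ContDiff ℝ ∞ g' := by rw [← hgd]; exact (contDiff_infty_iff_deriv.1 hg).2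
  have hg2 : ContDiff ℝ ∞ g'' := by rw [← hgd']; exact (contDiff_infty_iff_deriv.1 hg1).2
  have hz' : ∀ s, b + 1 ≤ s → g' s = 0 := by
    intro s hs
    have : g =ᶠ[𝓝 s] fun _ => 0 := by
      filter_upwards [Ioi_mem_nhds (by linarith : b < s)] with x hx using hb x (le_of_lt hx)
    rw [← hgd, this.deriv_eq, deriv_const]
  have hz'' : ∀ s, b + 2 ≤ s → g'' s = 0 := by
    intro s hs
    have : g' =ᶠ[𝓝 s] fun _ => 0 := by
      filter_upwards [Ioi_mem_nhds (by linarith : b + 1 < s)] with x hx using hz' x (le_of_lt hx)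
    rw [← hgd', this.deriv_eq, deriv_const]
  set u : ℝ → ℂ := fun s => (g s : ℂ) with hu
  have hus : ContDiff ℝ ∞ u := Complex.ofRealCLM.contDiff.comp hg
  have hud : deriv u = fun s => (g' s : ℂ) := funext fun s => (hg' s).ofReal_comp.deriv
  have hud' : deriv (deriv u) = fun s => (g'' s : ℂ) := by
    rw [hud]; exact funext fun s => (hg'' s).ofReal_comp.deriv
  set ψ : Plane → ℂ := fun x => harm k x * u (‖x‖ ^ 2) with hψ
  have hns : ContDiff ℝ ∞ fun x : Plane => ‖x‖ ^ 2 := contDiff_norm_sq ℝ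
  have hψs : ContDiff ℝ ∞ ψ := (contDiff_harm k).mul (hus.comp hns)
  -- r ≥ B implies r² ≥ b + 2, whatever the sign of b; from there on g(r²), g'(r²) and g''(r²) all
  -- vanish.
  set B := b ^ 2 + 3 with hB
  have hBb : ∀ r : ℝ, B ≤ r → b + 2 ≤ r ^ 2 := by
    intro r hr
    nlinarith [sq_nonneg (b - 1), sq_nonneg b, sq_nonneg (r - 1)]
  have hψc : HasCompactSupport ψ := by
    refine HasCompactSupport.intro (isCompact_closedBall (0 : Plane) B) fun x hx => ?_
    have hx' : B ≤ ‖x‖ := by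
      rw [Metric.mem_closedBall, dist_zero_right, not_le] at hx
      exact hx.le
    simp only [hψ, hu]
    rw [hb _ (by linarith [hBb _ hx'])]
    simp
  have hL : ∀ x, ∑ i, pderiv i (pderiv i ψ) x
      = harm k x * ((4 * ‖x‖ ^ 2 * g'' (‖x‖ ^ 2) + 4 * (κ + 1) * g' (‖x‖ ^ 2) : ℝ) : ℂ) := by
    intro x
    have := laplacian_zetaL_pow_mul (unitOf_sq k) κ isOpen_univ (hus.of_le (WithTop.coe_le_coe.2 le_top)).contDiffOn
      (x := x) (mem_univ _)
    rw [hud', hud] at this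
    rw [show ψ = fun x => zetaL (unitOf k) x ^ κ * u (‖x‖ ^ 2) from rfl, this]
    simp only [harm]
    push_cast
    ring
  have htest := h.integral_test (hψs.of_le (WithTop.coe_le_coe.2 le_top)) hψc e
  set D : ℝ → ℝ := fun r => 4 * r ^ 2 * g'' (r ^ 2) + 4 * (κ + 1) * g' (r ^ 2) with hD
  have hDc : Continuous D := by
    have := hg1.continuous; have := hg2.continuous; fun_prop
  have hgc : Continuous fun r : ℝ => g (r ^ 2) := by have := hg.continuous; fun_prop
  have hD0 : ∀ r, B ≤ r → D r = 0 := fun r hr => by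
    simp only [hD]
    rw [hz'' _ (hBb r hr), hz' _ (by linarith [hBb r hr])]; ring
  have hg0 : ∀ r, B ≤ r → g (r ^ 2) = 0 := fun r hr => hb _ (by linarith [hBb r hr])
  set T : ℝ → ℝ := fun r => -(1 / 2) * D r + r ^ 2 / 2 * g (r ^ 2) with hT
  have hTc : Continuous T := by fun_prop
  have hT0 : ∀ r, B ≤ r → T r = 0 := fun r hr => by
    simp only [hT]; rw [hD0 r hr, hg0 r hr]; ring
  have eT : ∀ x : Plane, -(1 / 2 : ℂ) * (∑ i, pderiv i (pderiv i ψ) x)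
      + ((‖x‖ ^ 2 / 2 : ℝ) : ℂ) * ψ x = harm k x * (T ‖x‖ : ℝ) := by
    intro x
    rw [hL]
    simp only [hT, hD, hψ, hu]
    push_cast
    ring
  simp_rw [eT] at htest
  have hint : ∀ (Θ : L2) (S : ℝ → ℝ), Continuous S → (∀ r, B ≤ r → S r = 0) →
      ∫ x, conj (harm k x * (S ‖x‖ : ℝ)) * inner ℂ e (Θ x)
        = ∫ r, (r ^ κ * S r) • modeCoeff k (fun x => inner ℂ e (Θ x)) r ∂radialMeasure := by
    intro Θ S hS hS0
    rw [integral_harm_mul k (fun r => (S r : ℂ))]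
    · refine integral_congr_ae (ae_of_all _ fun r => ?_)
      simp only
      rw [← Complex.ofReal_pow, ← Complex.ofReal_mul, conj_real_mul]
    · have h1 : Integrable fun x => inner ℂ e (conj (harm k x * (S ‖x‖ : ℝ)) • Θ x) := by
        refine (integrable_smul_coe Θ ?_ ?_).const_inner e
        · refine Complex.continuous_conj.comp (((contDiff_harm k (n := 1)).continuous).mul ?_)
          exact Complex.continuous_ofReal.comp (hS.comp continuous_norm)
        · refine HasCompactSupport.intro (isCompact_closedBall (0 : Plane) B) fun x hx => ?_
          rw [Metric.mem_closedBall, dist_zero_right, not_le] at hx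
          rw [hS0 _ hx.le]; simp
      simpa only [inner_smul_right] using h1
  have e1 := hint Ψ T hTc hT0
  have e2 := hint G (fun r => g (r ^ 2)) hgc hg0
  have e3 : ∫ x, conj (ψ x) * inner ℂ e (G x)
      = ∫ x, conj (harm k x * ((fun r => g (r ^ 2)) ‖x‖ : ℝ)) * inner ℂ e (G x) := rfl
  rw [e1, e3, e2] at htest
  have hH : LocSq (modeCoeff k a) := .of_memLp (memLp_modeCoeff k (memLp_inner_coe e Ψ))
  have hG : LocSq (modeCoeff k a') := .of_memLp (memLp_modeCoeff k (memLp_inner_coe e G))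
  have i1 : Integrable (fun r => (r ^ κ * D r) • modeCoeff k a r) radialMeasure :=
    hH.integrable_smul ((continuous_pow κ).mul hDc) (b := B) fun r hr => by rw [hD0 r hr, mul_zero]
  have i2 : Integrable (fun r => (r ^ κ * (r ^ 2 * g (r ^ 2))) • modeCoeff k a r)
      radialMeasure :=
    hH.integrable_smul (by fun_prop) (b := B) fun r hr => by rw [hg0 r hr, mul_zero, mul_zero]
  have i3 : Integrable (fun r => (r ^ κ * g (r ^ 2)) • modeCoeff k a' r) radialMeasure :=
    hG.integrable_smul (by fun_prop) (b := B) fun r hr => by rw [hg0 r hr, mul_zero]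
  have e4 : ∫ r, (r ^ κ * T r) • modeCoeff k a r ∂radialMeasure
      = -(1 / 2) * (∫ r, (r ^ κ * D r) • modeCoeff k a r ∂radialMeasure)
        + (1 / 2) * ∫ r, (r ^ κ * (r ^ 2 * g (r ^ 2))) • modeCoeff k a r ∂radialMeasure := by
    refine integral_eq_combination i1 i2 _ _ fun r => ?_
    simp only [hT, Complex.real_smul]
    push_cast
    ring
  have e5 : ∫ r, (r ^ κ * g (r ^ 2)) • (((r ^ 2 : ℝ) : ℂ) * modeCoeff k a r
        - 2 * modeCoeff k a' r) ∂radialMeasure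
      = 1 * (∫ r, (r ^ κ * (r ^ 2 * g (r ^ 2))) • modeCoeff k a r ∂radialMeasure)
        + (-2) * ∫ r, (r ^ κ * g (r ^ 2)) • modeCoeff k a' r ∂radialMeasure := by
    refine integral_eq_combination i2 i3 _ _ fun r => ?_
    simp only [Complex.real_smul]
    push_cast
    ring
  change ∫ r, (r ^ κ * D r) • modeCoeff k a r ∂radialMeasure
    = ∫ r, (r ^ κ * g (r ^ 2)) • (((r ^ 2 : ℝ) : ℂ) * modeCoeff k a r
        - 2 * modeCoeff k a' r) ∂radialMeasure
  rw [e5, ← htest, e4]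
  ring

/-! ### Bounds on the profile, and regularity of the Fourier coefficients of an eigenfunction -/

section

namespace IsVortexProfile

variable {m : ℤ} {μ : ℝ} {w : ℝ → ℝ}

theorem locBdd (hw : IsVortexProfile m μ w) : LocBdd w :=
  .of_continuousOn hw.contDiffOn.continuousOn hw.bounded_zero

theorem exists_bound (hw : IsVortexProfile m μ w) : ∃ W, 0 ≤ W ∧ ∀ r, 0 < r → |w r| ≤ W := by
  have h1 : ∀ᶠ r in atTop, |w r| < 1 := by
    simpa using hw.tendsto_atTop.abs.eventually_lt_const (by simp : |(0 : ℝ)| < 1)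
  obtain ⟨R, hR⟩ := eventually_atTop.1 h1
  obtain ⟨B, hB0, hB⟩ := hw.locBdd (R + 1)
  refine ⟨max B 1, le_max_of_le_right zero_le_one, fun r hr => ?_⟩
  rcases lt_or_ge r (R + 1) with h | h
  · exact (hB r hr h).trans (le_max_left _ _)
  · exact (hR r (by linarith)).le.trans (le_max_right _ _)

theorem continuousOn_sq (hw : IsVortexProfile m μ w) :
    ContinuousOn (fun r => |w r| ^ 2) (Ioi 0) :=
  (hw.contDiffOn.continuousOn.abs).pow 2

theorem continuousOn_source (hw : IsVortexProfile m μ w) (lam : ℂ) {y y' : ℝ → ℂ}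
    (hy : ContinuousOn y (Ioi 0)) (hy' : ContinuousOn y' (Ioi 0)) :
    ContinuousOn (source μ w lam y y') (Ioi 0) := by
  have h := hw.continuousOn_sq
  unfold source
  refine ContinuousOn.add (ContinuousOn.mul (ContinuousOn.sub ?_ continuousOn_const) hy)
    (ContinuousOn.mul ?_ hy')
  · exact Complex.continuous_ofReal.comp_continuousOn (by fun_prop)
  · exact Complex.continuous_ofReal.comp_continuousOn (by fun_prop)

theorem locBdd_source (hw : IsVortexProfile m μ w) (lam : ℂ) {y y' : ℝ → ℂ}
    (hy : LocBdd y) (hy' : LocBdd y') : LocBdd (source μ w lam y y') := by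
  obtain ⟨W, hW0, hW⟩ := hw.exists_bound
  refine LocBdd.add (LocBdd.mul (F := fun r => ((r ^ 2 - 2 * μ + 4 * |w r| ^ 2 : ℝ) : ℂ)
    - 2 * (Complex.I * lam)) ?_ hy) (LocBdd.mul (F := fun r => ((2 * |w r| ^ 2 : ℝ) : ℂ)) ?_ hy')
  · intro R
    refine ⟨R ^ 2 + 2 * |μ| + 4 * W ^ 2 + 2 * ‖lam‖, by positivity, fun r hr hrR => ?_⟩
    have h1 : |w r| ^ 2 ≤ W ^ 2 := pow_le_pow_left₀ (abs_nonneg _) (hW r hr) 2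
    have h2 : r ^ 2 ≤ R ^ 2 := pow_le_pow_left₀ hr.le hrR.le 2
    refine (norm_sub_le _ _).trans ?_
    rw [Complex.norm_real, Real.norm_eq_abs, norm_mul, norm_mul, Complex.norm_I, Complex.norm_two]
    have h3 : |r ^ 2 - 2 * μ + 4 * |w r| ^ 2| ≤ R ^ 2 + 2 * |μ| + 4 * W ^ 2 := by
      rw [abs_le]
      constructor <;>
      nlinarith [neg_abs_le μ, le_abs_self μ, sq_nonneg r, sq_nonneg |w r|]
    linarith
  · intro R
    refine ⟨2 * W ^ 2, by positivity, fun r hr hrR => ?_⟩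
    have h1 : |w r| ^ 2 ≤ W ^ 2 := pow_le_pow_left₀ (abs_nonneg _) (hW r hr) 2
    rw [Complex.norm_real, Real.norm_of_nonneg (by positivity)]
    linarith

end IsVortexProfile

theorem moment_congr {F F' : ℝ → ℂ} (h : ∀ᵐ r : ℝ, 0 < r → F r = F' r) (κ : ℕ) {t : ℝ}
    (ht : 0 ≤ t) : moment κ F t = moment κ F' t := by
  refine intervalIntegral.integral_congr_ae ?_
  filter_upwards [h] with s hs hst
  rw [uIoc_of_le ht] at hst
  rw [hs hst.1]

theorem primitive_congr {F F' : ℝ → ℂ} (h : ∀ᵐ r : ℝ, 0 < r → F r = F' r) (κ : ℕ) {r : ℝ}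
    (hr : 0 < r) : primitive κ F r = primitive κ F' r := by
  refine intervalIntegral.integral_congr fun t ht => ?_
  have : 0 < t := lt_of_lt_of_le (lt_min one_pos hr) ht.1
  rw [moment_congr h κ this.le]

/-- A square integrable weak solution is a.e. equal to a regular one, provided that its source
has a continuous version. -/
theorem WeakRadialEq.exists_continuousOn {κ : ℕ} {H F : ℝ → ℂ} (hw : WeakRadialEq κ H F)
    (hH : LocSq H) (hF : LocSq F) :
    ∃ (c : ℂ) (y : ℝ → ℂ), ContinuousOn y (Ioi 0) ∧ H =ᵐ[radialMeasure] y ∧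
      ∀ F', ContinuousOn F' (Ioi 0) → F =ᵐ[radialMeasure] F' → RegularSol κ c F' y := by
  obtain ⟨c, hc⟩ := hw.exists_ae_eq hH hF
  refine ⟨c, fun r => (r : ℂ) ^ κ * (c + primitive κ F r), fun r hr => ?_, ?_,
    fun F' hc' hF' => ⟨fun R => ?_, hc', fun r hr => ?_⟩⟩
  · exact (((hasDerivAt_ofReal_pow κ r).continuousAt).mul
      (continuousAt_const.add (hF.hasDerivAt_primitive κ hr).continuousAt)).continuousWithinAt
  · refine ae_radialMeasure_iff.2 ?_
    filter_upwards [hc] with r h hr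
    rw [h hr, Complex.real_smul, Complex.ofReal_pow]
  · exact (memLp_congr_ae (ae_restrict_of_ae hF')).1 (hF R)
  · rw [primitive_congr (ae_radialMeasure_iff.1 hF') κ hr]

theorem LocSq.sub {F G : ℝ → ℂ} (hF : LocSq F) (hG : LocSq G) : LocSq fun r => F r - G r :=
  fun R => (hF R).sub (hG R)

theorem source_ae_congr {μ : ℝ} {w : ℝ → ℝ} {lam : ℂ} {y y' z z' : ℝ → ℂ}
    (h : y =ᵐ[radialMeasure] z) (h' : y' =ᵐ[radialMeasure] z') :
    source μ w lam y y' =ᵐ[radialMeasure] source μ w lam z z' := by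
  filter_upwards [h, h'] with r h1 h2
  simp only [source, h1, h2]

variable {m : ℤ} {μ : ℝ} {w : ℝ → ℝ} {lam : ℂ}

theorem source_coeff_eq {a b : ℂ} {r : ℝ} {W : ℝ} :
    ((r ^ 2 : ℝ) : ℂ) * a - 2 * ((Complex.I * lam - ((2 * W ^ 2 - μ : ℝ) : ℂ)) * a
        + (-((W ^ 2 : ℝ) : ℂ)) * b)
      = (((r ^ 2 - 2 * μ + 4 * W ^ 2 : ℝ) : ℂ) - 2 * (Complex.I * lam)) * a
        + ((2 * W ^ 2 : ℝ) : ℂ) * b := by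
  push_cast; ring

/-- A bootstrap: the eigenvalue relation expresses the coefficients of `G` through those of `Φ`, so
both weak sources equal `source` almost everywhere. The integral formula provides continuous
representatives, these make the sources continuous, and the same formula then gives C² solutions
with limits at 0. -/
theorem exists_isPairSolution (hw : IsVortexProfile m μ w) {Φ G : L2} (hG : LcEq Φ G)
    (hE : ∀ᵐ x : Plane, (lam • Φ x).ofLp
      = (-matJ) *ᵥ ((G x).ofLp + potential m μ w x *ᵥ (Φ x).ofLp)) (j : ℤ) :
    ∃ yp ym, IsPairSolution m μ w j lam yp ym ∧ BoundaryCondition yp ∧ BoundaryCondition ym ∧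
      modeCoeff (j + m) (fun x => inner ℂ ePlus (Φ x)) =ᵐ[radialMeasure] yp ∧
      modeCoeff (j - m) (fun x => inner ℂ eMinus (Φ x)) =ᵐ[radialMeasure] ym := by
  have mp := memLp_inner_coe ePlus Φ
  have mm := memLp_inner_coe eMinus Φ
  set Hp := modeCoeff (j + m) fun x => inner ℂ ePlus (Φ x) with hHp
  set Hm := modeCoeff (j - m) fun x => inner ℂ eMinus (Φ x) with hHm
  have mHp : MemLp Hp 2 radialMeasure := memLp_modeCoeff _ mp
  have mHm : MemLp Hm 2 radialMeasure := memLp_modeCoeff _ mm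
  have eqp : (fun r => ((r ^ 2 : ℝ) : ℂ) * Hp r
      - 2 * modeCoeff (j + m) (fun x => inner ℂ ePlus (G x)) r) =ᵐ[radialMeasure]
        source μ w lam Hp Hm := by
    have := modeCoeff_combination (j + m) (2 * m) (b := fun x => inner ℂ ePlus (G x))
      (fun r => Complex.I * lam - ((2 * |w r| ^ 2 - μ : ℝ) : ℂ))
      (fun r => -((|w r| ^ 2 : ℝ) : ℂ)) mp mm (by
        filter_upwards [hE] with x hx
        exact ((eigen_pointwise_iff m μ w lam x _ _).1 hx).1)
    filter_upwards [this] with r hr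
    rw [hr, show j + m - 2 * m = j - m by ring]
    exact source_coeff_eq
  have eqm : (fun r => ((r ^ 2 : ℝ) : ℂ) * Hm r
      - 2 * modeCoeff (j - m) (fun x => inner ℂ eMinus (G x)) r) =ᵐ[radialMeasure]
        source μ w (-lam) Hm Hp := by
    have := modeCoeff_combination (j - m) (-(2 * m)) (b := fun x => inner ℂ eMinus (G x))
      (fun r => -(Complex.I * lam) - ((2 * |w r| ^ 2 - μ : ℝ) : ℂ))
      (fun r => -((|w r| ^ 2 : ℝ) : ℂ)) mm mp (by
        filter_upwards [hE] with x hx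
        exact ((eigen_pointwise_iff m μ w lam x _ _).1 hx).2)
    filter_upwards [this] with r hr
    rw [hr, show j - m - -(2 * m) = j + m by ring, ← mul_neg]
    exact source_coeff_eq
  have hsq : LocBdd fun r : ℝ => ((r ^ 2 : ℝ) : ℂ) := by
    refine .of_tendsto (by fun_prop) ⟨((0 ^ 2 : ℝ) : ℂ), ?_⟩
    exact (Continuous.tendsto (by fun_prop) 0).mono_left nhdsWithin_le_nhds
  have hloc : ∀ {k : ℤ} {e : C2}, LocSq (fun r => ((r ^ 2 : ℝ) : ℂ)
      * modeCoeff k (fun x => inner ℂ e (Φ x)) r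
      - 2 * modeCoeff k (fun x => inner ℂ e (G x)) r) := by
    intro k e
    refine (hsq.mul_locSq (by fun_prop) (.of_memLp (memLp_modeCoeff k (memLp_inner_coe e Φ)))).sub
      ?_
    exact fun R => (LocSq.of_memLp (memLp_modeCoeff k (memLp_inner_coe e G)) R).const_mul 2
  obtain ⟨cp, yp, hyp, hHyp, hregp⟩ := (weakRadialEq_of_lcEq hG (j + m) ePlus).exists_continuousOn
    (.of_memLp mHp) hloc
  obtain ⟨cm, ym, hym, hHym, hregm⟩ := (weakRadialEq_of_lcEq hG (j - m) eMinus).exists_continuousOn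
    (.of_memLp mHm) hloc
  -- The continuous source involves both representatives, so it can be supplied only after `yp` and
  -- `ym` have been fixed.
  have rp := hregp _ (hw.continuousOn_source lam hyp hym) (eqp.trans (source_ae_congr hHyp hHym))
  have rm := hregm _ (hw.continuousOn_source (-lam) hym hyp)
    (eqm.trans (source_ae_congr hHym hHyp))
  have hsol : IsPairSolution m μ w j lam yp ym :=
    isPairSolution_iff.2 ⟨rp.contDiffOn, rm.contDiffOn, fun r hr => rp.ode hr,
      fun r hr => rm.ode hr⟩
  have hinf := hsol.tendsto_atTop ((memLp_congr_ae hHyp).1 mHp) ((memLp_congr_ae hHym).1 mHm)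
  exact ⟨yp, ym, hsol, ⟨rp.exists_tendsto_zero, hinf.1⟩, ⟨rm.exists_tendsto_zero, hinf.2⟩,
    hHyp, hHym⟩

end

/-! ### Expansion of eigenfunctions in modes -/

theorem ext_inner_ePlus_eMinus {v v' : C2} (hp : inner ℂ ePlus v = inner ℂ ePlus v')
    (hm : inner ℂ eMinus v = inner ℂ eMinus v') : v = v' := by
  rw [inner_ePlus, inner_ePlus] at hp
  rw [inner_eMinus, inner_eMinus] at hm
  ext i
  fin_cases i
  · simp only [Fin.zero_eta]
    linear_combination (1 / 2) * hp + (1 / 2) * hm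
  · simp only [Fin.mk_one]
    linear_combination (-(Complex.I / 2)) * hp + (Complex.I / 2) * hm
      + (v 1 - v' 1) * Complex.I_mul_I

theorem inner_ePlus_modeVector (m j : ℤ) (yp ym : ℝ → ℂ) (x : Plane) :
    inner ℂ ePlus (modeVector m j yp ym x) = angularMode (j + m) x * yp ‖x‖ := by
  rw [inner_ePlus]
  simp only [modeVector, PiLp.add_apply, PiLp.smul_apply, smul_eq_mul, Matrix.cons_val_zero,
    Matrix.cons_val_one]
  linear_combination (-(1 / 2) * (angularMode (j + m) x * yp ‖x‖)
    + (1 / 2) * (angularMode (j - m) x * ym ‖x‖)) * Complex.I_mul_I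

theorem inner_eMinus_modeVector (m j : ℤ) (yp ym : ℝ → ℂ) (x : Plane) :
    inner ℂ eMinus (modeVector m j yp ym x) = angularMode (j - m) x * ym ‖x‖ := by
  rw [inner_eMinus]
  simp only [modeVector, PiLp.add_apply, PiLp.smul_apply, smul_eq_mul, Matrix.cons_val_zero,
    Matrix.cons_val_one]
  linear_combination ((1 / 2) * (angularMode (j + m) x * yp ‖x‖)
    - (1 / 2) * (angularMode (j - m) x * ym ‖x‖)) * Complex.I_mul_I

theorem perturbation_eq_inner (lam : ℂ) (Φ : L2) (t : ℝ) (x : Plane) :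
    perturbation lam Φ t x = Complex.exp (lam * t) * inner ℂ ePlus (Φ x)
      + conj (Complex.exp (lam * t) * inner ℂ eMinus (Φ x)) := by
  rw [inner_ePlus, inner_eMinus]
  simp only [perturbation, map_sub, map_mul, Complex.conj_I]
  ring

/-- The perturbation associated with a finite sum of modes. -/
theorem perturbation_eq_sum {m : ℤ} {lam : ℂ} {Φ : L2} {S : Finset ℤ} {C : ℤ → ℂ}
    {yp ym : ℤ → ℝ → ℂ} {x : Plane}
    (h : Φ x = ∑ j ∈ S, C j • modeVector m j (yp j) (ym j) x) (t : ℝ) :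
    perturbation lam Φ t x = ∑ j ∈ S, modePerturbation m j lam (C j) (yp j) (ym j) t x := by
  rw [perturbation_eq_inner, h, inner_sum, inner_sum, Finset.mul_sum, Finset.mul_sum, map_sum,
    ← Finset.sum_add_distrib]
  refine Finset.sum_congr rfl fun j _ => ?_
  rw [inner_smul_right, inner_smul_right, inner_ePlus_modeVector, inner_eMinus_modeVector,
    modePerturbation]
  congr 1
  · ring
  · congr 1; ring

theorem map_norm_volume :
    (volume : Measure Plane).map norm = angularMeasure univ • radialMeasure := by
  rw [← measurePreserving_polarMap.map_eq, Measure.map_map measurable_norm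
    measurePreserving_polarMap.measurable, ← Measure.map_fst_prod]
  refine Measure.map_congr ?_
  have : ∀ᵐ p ∂radialMeasure.prod angularMeasure, 0 < p.1 :=
    Measure.quasiMeasurePreserving_fst.ae ae_radialMeasure_pos
  filter_upwards [this] with p hp using norm_polarMap hp

theorem measurable_angularMode (k : ℤ) : Measurable (angularMode k) := by
  have h : Measurable fun x : Plane => (⟨x 0, x 1⟩ : ℂ) := by
    have : (fun x : Plane => (⟨x 0, x 1⟩ : ℂ)) = fun x => zetaL Complex.I x := by
      ext x; rw [zetaL_apply]; apply Complex.ext <;> simp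
    rw [this]; exact (zetaL Complex.I).continuous.measurable
  have h2 : Measurable angle := Complex.measurable_arg.comp h
  unfold angularMode
  fun_prop

theorem memLp_angularMode_mul (k : ℤ) {y : ℝ → ℂ} (hy : MemLp y 2 radialMeasure) :
    MemLp (fun x => angularMode k x * y ‖x‖) 2 volume := by
  have h1 : MemLp y 2 ((volume : Measure Plane).map norm) := by
    rw [map_norm_volume]; exact hy.smul_measure (measure_ne_top _ _)
  have h2 := (memLp_map_measure_iff h1.1 measurable_norm.aemeasurable).1 h1
  refine h2.of_le_mul (c := 1) ((measurable_angularMode k).aestronglyMeasurable.mul h2.1)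
    (ae_of_all _ fun x => ?_)
  rw [norm_mul, norm_angularMode, one_mul, one_mul]; rfl

theorem modeCoeff_angularMode_mul (k l : ℤ) (y : ℝ → ℂ) :
    ∀ᵐ r ∂radialMeasure, modeCoeff k (fun x => angularMode l x * y ‖x‖) r
      = if k = l then 2 * (Real.pi : ℂ) * y r else 0 := by
  filter_upwards [ae_radialMeasure_pos] with r hr
  have h : modeCoeff k (fun x => angularMode l x * y ‖x‖) r
      = ∫ θ, cexpMode (-k + l) θ * y r ∂angularMeasure := by
    refine integral_congr_ae ?_
    filter_upwards [ae_angularMeasure_mem] with θ hθ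
    rw [angularMode_polarMap l (p := (r, θ)) hr hθ, norm_polarMap (p := (r, θ)) hr, conj_cexpMode,
      cexpMode_add, mul_assoc]
  rw [h, integral_mul_const, integral_cexpMode]
  by_cases hkl : k = l
  · simp [hkl]
  · rw [if_neg hkl, if_neg (by omega), zero_mul]

/-- The factor 1/(2π) compensates for the missing normalization in `modeCoeff`; orthogonality of the
exponentials does the rest, one index at a time. -/
theorem modeCoeff_sub_sum (k l : ℤ) {a : Plane → ℂ} (ha : MemLp a 2 volume) {y : ℤ → ℝ → ℂ}
    (hy : ∀ j, MemLp (y j) 2 radialMeasure) (S : Finset ℤ) :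
    MemLp (fun x => a x - ∑ j ∈ S, 1 / (2 * (Real.pi : ℂ))
      * (angularMode (j + l) x * y j ‖x‖)) 2 volume ∧
    ∀ᵐ r ∂radialMeasure, modeCoeff k (fun x => a x - ∑ j ∈ S, 1 / (2 * (Real.pi : ℂ))
        * (angularMode (j + l) x * y j ‖x‖)) r
      = modeCoeff k a r - ∑ j ∈ S, if k = j + l then y j r else 0 := by
  classical
  induction S using Finset.induction_on with
  | empty => simpa using ha
  | insert j S hj ih =>
    have hm := memLp_angularMode_mul (j + l) (hy j)
    simp only [Finset.sum_insert hj]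
    refine ⟨?_, ?_⟩
    · convert ih.1.sub (hm.const_mul (1 / (2 * (Real.pi : ℂ)))) using 2 with x
      simp only [Pi.sub_apply]; ring
    · have h := modeCoeff_combination k 0 (b := fun x => a x - (1 / (2 * (Real.pi : ℂ))
          * (angularMode (j + l) x * y j ‖x‖) + ∑ j ∈ S, 1 / (2 * (Real.pi : ℂ))
          * (angularMode (j + l) x * y j ‖x‖))) (fun _ => 1) (fun _ => -(1 / (2 * (Real.pi : ℂ))))
        ih.1 hm (ae_of_all _ fun x => by
          have : angularMode 0 x = 1 := by simp [angularMode]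
          rw [this]; ring)
      filter_upwards [h, ih.2, modeCoeff_angularMode_mul k (j + l) (y j)] with r h1 h2 h3
      rw [h1, h2, sub_zero, h3]
      have hpi : (Real.pi : ℂ) ≠ 0 := by simp
      split_ifs
      · field_simp; ring
      · ring

theorem ae_eq_sum_of_modeCoeff (l : ℤ) {a : Plane → ℂ} (ha : MemLp a 2 volume) {y : ℤ → ℝ → ℂ}
    (hy : ∀ j, modeCoeff (j + l) a =ᵐ[radialMeasure] y j) {S : Finset ℤ}
    (hS : ∀ j ∉ S, ∀ r, 0 < r → y j r = 0) :
    ∀ᵐ x, a x = ∑ j ∈ S, 1 / (2 * (Real.pi : ℂ)) * (angularMode (j + l) x * y j ‖x‖) := by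
  have hyL : ∀ j, MemLp (y j) 2 radialMeasure := fun j =>
    (memLp_congr_ae (hy j)).1 (memLp_modeCoeff _ ha)
  have h0 := ae_eq_zero_of_modeCoeff (modeCoeff_sub_sum 0 l ha hyL S).1 fun k => by
    have h1 := hy (k - l)
    rw [sub_add_cancel] at h1
    filter_upwards [(modeCoeff_sub_sum k l ha hyL S).2, h1, ae_radialMeasure_pos] with r h2 h3 hr
    have h4 : ∀ j, (k = j + l) ↔ (k - l = j) := fun j => by omega
    rw [h2, h3]
    simp only [h4, Finset.sum_ite_eq, Pi.zero_apply]
    split_ifs with h5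
    · exact sub_self _
    · rw [hS _ h5 r hr, sub_zero]
  filter_upwards [h0] with x hx
  exact sub_eq_zero.1 hx

/-- Every j yields a pair satisfying the boundary conditions, but it is nontrivial for finitely many
j only. The other pairs vanish on (0,∞), so the finite sum has all the Fourier coefficients of Φ; it
is nonempty since Φ ≠ 0. -/
theorem IsEigenfunction.exists_modes {m : ℤ} {μ : ℝ} {w : ℝ → ℝ} {lam : ℂ}
    (hw : IsVortexProfile m μ w) {Φ : L2} (h : IsEigenfunction m μ w lam Φ) :
    ∃ (S : Finset ℤ) (C : ℤ → ℂ) (yp ym : ℤ → ℝ → ℂ), S.Nonempty ∧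
      (∀ j ∈ S, C j ≠ 0 ∧ IsPairMode m μ w j lam (yp j) (ym j)) ∧
      ∀ᵐ x : Plane, Φ x = ∑ j ∈ S, C j • modeVector m j (yp j) (ym j) x := by
  obtain ⟨hne, G, hG, hE⟩ := h
  have hE' : ∀ᵐ x : Plane, (lam • Φ x).ofLp
      = (-matJ) *ᵥ ((G x).ofLp + potential m μ w x *ᵥ (Φ x).ofLp) := by
    filter_upwards [hE, Lp.coeFn_smul lam Φ] with x h1 h2
    rw [← h1, h2]; rfl
  choose yp ym hsol hbp hbm hp hm using exists_isPairSolution hw hG hE'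
  have hfin : {j | IsPairMode m μ w j lam (yp j) (ym j)}.Finite :=
    (finite_setOf_isPairMode m μ w lam).subset fun j hj => ⟨_, _, hj⟩
  have hmem : ∀ j, j ∈ hfin.toFinset ↔ IsPairMode m μ w j lam (yp j) (ym j) := fun j => by simp
  have hz : ∀ j ∉ hfin.toFinset, ∀ r, 0 < r → yp j r = 0 ∧ ym j r = 0 := by
    intro j hj r hr
    by_contra hcon
    refine hj ((hmem j).2 ⟨hsol j, hbp j, hbm j, r, hr, ?_⟩)
    tauto
  have hsum : ∀ᵐ x : Plane, Φ x = ∑ j ∈ hfin.toFinset,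
      (1 / (2 * (Real.pi : ℂ))) • modeVector m j (yp j) (ym j) x := by
    filter_upwards [ae_eq_sum_of_modeCoeff m (memLp_inner_coe ePlus Φ) hp
      fun j hj r hr => (hz j hj r hr).1, ae_eq_sum_of_modeCoeff (-m) (memLp_inner_coe eMinus Φ)
      (by simpa only [← sub_eq_add_neg] using hm) fun j hj r hr => (hz j hj r hr).2] with x h1 h2
    refine ext_inner_ePlus_eMinus ?_ ?_
    · rw [h1, inner_sum]
      simp only [inner_smul_right, inner_ePlus_modeVector]
    · rw [h2, inner_sum]
      simp only [inner_smul_right, inner_eMinus_modeVector, ← sub_eq_add_neg]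
  refine ⟨hfin.toFinset, fun _ => 1 / (2 * (Real.pi : ℂ)), yp, ym, ?_, fun j hj =>
    ⟨by simp, (hmem j).1 hj⟩, hsum⟩
  by_contra hS
  rw [Finset.not_nonempty_iff_eq_empty] at hS
  refine hne (Lp.ext ?_)
  filter_upwards [hsum, Lp.coeFn_zero C2 2 (volume : Measure Plane)] with x h1 h2
  rw [h1, h2, hS]; simp

/-! ### Cutoff functions -/

theorem exists_bound_deriv_smoothTransition :
    ∃ M, 0 ≤ M ∧ (∀ s, |deriv Real.smoothTransition s| ≤ M) ∧
      ∀ s, s < 0 ∨ 1 < s → deriv Real.smoothTransition s = 0 := by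
  have hz : ∀ s, s < 0 ∨ 1 < s → deriv Real.smoothTransition s = 0 := by
    rintro s (h | h)
    · have : Real.smoothTransition =ᶠ[𝓝 s] fun _ => 0 := by
        filter_upwards [Iio_mem_nhds h] with x hx
          using Real.smoothTransition.zero_of_nonpos (le_of_lt hx)
      rw [this.deriv_eq, deriv_const]
    · have : Real.smoothTransition =ᶠ[𝓝 s] fun _ => 1 := by
        filter_upwards [Ioi_mem_nhds h] with x hx
          using Real.smoothTransition.one_of_one_le (le_of_lt hx)
      rw [this.deriv_eq, deriv_const]
  have hc : Continuous (deriv Real.smoothTransition) :=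
    (Real.smoothTransition.contDiff (n := 1)).continuous_deriv le_rfl
  obtain ⟨M, hM⟩ := (isCompact_Icc (a := (0 : ℝ)) (b := 1)).exists_bound_of_continuousOn
    hc.continuousOn
  refine ⟨max M 0, le_max_right _ _, fun s => ?_, hz⟩
  by_cases hs : s < 0 ∨ 1 < s
  · rw [hz s hs, abs_zero]; exact le_max_right _ _
  · rw [not_or, not_lt, not_lt] at hs
    exact (hM s hs).trans (le_max_left _ _)

/-- The profile of `cutoff` as a function of `‖x‖²`. -/
def cutoffProfile (N s : ℝ) : ℝ :=
  Real.smoothTransition (N ^ 2 * s - 1) * Real.smoothTransition (2 - s / N ^ 2)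

/-- A smooth function that vanishes for `‖x‖ ≤ 1/N` and for `‖x‖ ≥ √2 N` and is `1` on
`√2/N ≤ ‖x‖ ≤ N`. -/
def cutoff (N : ℝ) (x : Plane) : ℂ := (cutoffProfile N (‖x‖ ^ 2) : ℝ)

theorem contDiff_cutoffProfile (N : ℝ) {n : ℕ∞} : ContDiff ℝ n (cutoffProfile N) := by
  have h := Real.smoothTransition.contDiff (n := n)
  refine (h.comp (g := Real.smoothTransition) (f := fun s => N ^ 2 * s - 1) ?_).mul
    (h.comp (g := Real.smoothTransition) (f := fun s => 2 - s / N ^ 2) ?_)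
  · fun_prop
  · fun_prop

theorem contDiff_cutoff (N : ℝ) {n : ℕ∞} : ContDiff ℝ n (cutoff N) :=
  Complex.ofRealCLM.contDiff.comp ((contDiff_cutoffProfile N).comp (contDiff_norm_sq ℝ))

theorem norm_cutoff_le (N : ℝ) (x : Plane) : ‖cutoff N x‖ ≤ 1 := by
  rw [cutoff, Complex.norm_real, cutoffProfile, Real.norm_of_nonneg
    (mul_nonneg (Real.smoothTransition.nonneg _) (Real.smoothTransition.nonneg _))]
  exact mul_le_one₀ (Real.smoothTransition.le_one _) (Real.smoothTransition.nonneg _)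
    (Real.smoothTransition.le_one _)

theorem cutoff_eq_zero_of_small {N : ℝ} {x : Plane} (hx : N ^ 2 * ‖x‖ ^ 2 ≤ 1) :
    cutoff N x = 0 := by
  rw [cutoff, cutoffProfile, Real.smoothTransition.zero_of_nonpos (by linarith), zero_mul,
    Complex.ofReal_zero]

theorem cutoff_eq_zero_of_large {N : ℝ} (hN : 0 < N) {x : Plane} (hx : 2 * N ^ 2 ≤ ‖x‖ ^ 2) :
    cutoff N x = 0 := by
  have : 2 ≤ ‖x‖ ^ 2 / N ^ 2 := (le_div_iff₀ (by positivity)).2 hx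
  rw [cutoff, cutoffProfile, Real.smoothTransition.zero_of_nonpos (x := 2 - _) (by linarith),
    mul_zero, Complex.ofReal_zero]

theorem hasCompactSupport_cutoff {N : ℝ} (hN : 1 ≤ N) : HasCompactSupport (cutoff N) := by
  refine HasCompactSupport.intro (isCompact_closedBall (0 : Plane) (2 * N)) fun x hx => ?_
  rw [Metric.mem_closedBall, dist_zero_right, not_le] at hx
  exact cutoff_eq_zero_of_large (by linarith) (by nlinarith)

theorem tendsto_cutoff {x : Plane} (hx : x ≠ 0) :
    Tendsto (fun N : ℝ => cutoff N x) atTop (𝓝 1) := by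
  have hx' : 0 < ‖x‖ := norm_pos_iff.2 hx
  refine tendsto_const_nhds.congr' ?_
  filter_upwards [eventually_ge_atTop (2 / ‖x‖), eventually_ge_atTop ‖x‖] with N h1 h2
  rw [div_le_iff₀ hx'] at h1
  have h3 : ‖x‖ ^ 2 / N ^ 2 ≤ 1 := by
    have : 0 < N := hx'.trans_le h2
    rw [div_le_one (by positivity)]
    exact pow_le_pow_left₀ hx'.le h2 2
  rw [cutoff, cutoffProfile, Real.smoothTransition.one_of_one_le (by nlinarith),
    Real.smoothTransition.one_of_one_le (by linarith)]
  simp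

/-- The inner transition takes place inside |x| < 2/N and has slope of order N; the outer one takes
place inside |x| ≤ 2N and has slope of order 1/N. -/
theorem exists_norm_pderiv_cutoff_le : ∃ C, 0 ≤ C ∧ ∀ N : ℝ, 1 ≤ N → ∀ (i : Fin 2) (x : Plane),
    ‖pderiv i (cutoff N) x‖
      ≤ C * (N * (Metric.ball (0 : Plane) (2 / N)).indicator 1 x) + C / N := by
  obtain ⟨M, hM0, hM, hz⟩ := exists_bound_deriv_smoothTransition
  refine ⟨4 * M, by positivity, fun N hN i x => ?_⟩
  have hN0 : 0 < N := by linarith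
  set σ := Real.smoothTransition with hσ
  have hσd : ∀ s, HasDerivAt σ (deriv σ s) s := fun s =>
    ((Real.smoothTransition.contDiff (n := 1)).differentiable one_ne_zero s).hasDerivAt
  set s := ‖x‖ ^ 2 with hs
  have hd : HasDerivAt (fun s => (cutoffProfile N s : ℂ))
      ((N ^ 2 * deriv σ (N ^ 2 * s - 1) * σ (2 - s / N ^ 2)
        - σ (N ^ 2 * s - 1) * (deriv σ (2 - s / N ^ 2) / N ^ 2) : ℝ) : ℂ) s := by
    refine HasDerivAt.ofReal_comp ?_
    have d1 : HasDerivAt (fun s => N ^ 2 * s - 1) (N ^ 2) s := by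
      simpa using ((hasDerivAt_id s).const_mul (N ^ 2)).sub_const 1
    have d2 : HasDerivAt (fun s => 2 - s / N ^ 2) (-(1 / N ^ 2)) s :=
      ((hasDerivAt_id s).div_const (N ^ 2)).const_sub 2
    refine (((hσd _).comp s d1).mul ((hσd _).comp s d2)).congr_deriv ?_
    simp only [Function.comp]
    ring
  -- With exponent n = 0 the polynomial factor is 1, so the value of ε is immaterial and the formula
  -- differentiates a function of |x|².
  have hp := pderiv_zetaL_pow_mul 0 0 (x := x) hd.differentiableAt i
  rw [hd.deriv] at hp
  have hp' : pderiv i (cutoff N) x = _ := (congrFun (congrArg (pderiv i) (funext fun x => by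
    rw [cutoff, pow_zero, one_mul])) x).trans hp
  rw [hp']
  simp only [CharP.cast_eq_zero, zero_mul, zero_add, pow_zero, one_mul]
  rw [norm_mul, norm_mul, Complex.norm_two, Complex.norm_real, Complex.norm_real]
  have hxi : ‖x i‖ ≤ ‖x‖ := PiLp.norm_apply_le x i
  have b1 : ‖x‖ * |N ^ 2 * deriv σ (N ^ 2 * s - 1) * σ (2 - s / N ^ 2)|
      ≤ 2 * M * (N * (Metric.ball (0 : Plane) (2 / N)).indicator 1 x) := by
    by_cases h : 1 < N ^ 2 * s - 1
    · rw [hz _ (Or.inr h)]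
      simp only [mul_zero, zero_mul, abs_zero]
      have : (0 : ℝ) ≤ (Metric.ball (0 : Plane) (2 / N)).indicator 1 x :=
        indicator_nonneg (fun _ _ => zero_le_one) _
      positivity
    · have h1 : (N * ‖x‖) ^ 2 < 2 ^ 2 := by rw [mul_pow, ← hs]; linarith
      have h2 : N * ‖x‖ < 2 := lt_of_pow_lt_pow_left₀ 2 (by norm_num) h1
      have h3 : x ∈ Metric.ball (0 : Plane) (2 / N) := by
        rw [Metric.mem_ball, dist_zero_right, lt_div_iff₀ hN0]; linarith
      rw [indicator_of_mem h3, Pi.one_apply, mul_one, abs_mul, abs_mul, abs_of_nonneg (sq_nonneg N),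
        abs_of_nonneg (Real.smoothTransition.nonneg _)]
      calc ‖x‖ * (N ^ 2 * |deriv σ (N ^ 2 * s - 1)| * σ (2 - s / N ^ 2))
          ≤ ‖x‖ * (N ^ 2 * M * 1) := by
            gcongr
            · exact Real.smoothTransition.nonneg _
            · exact hM _
            · exact Real.smoothTransition.le_one _
        _ = (N * ‖x‖) * (M * N) := by ring
        _ ≤ 2 * (M * N) := by gcongr
        _ = 2 * M * N := by ring
  have b2 : ‖x‖ * |σ (N ^ 2 * s - 1) * (deriv σ (2 - s / N ^ 2) / N ^ 2)| ≤ 2 * M / N := by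
    by_cases h : 2 - s / N ^ 2 < 0
    · rw [hz _ (Or.inl h)]
      simp only [mul_zero, zero_div, abs_zero]
      positivity
    · have h1 : ‖x‖ ^ 2 ≤ (2 * N) ^ 2 := by
        have : s / N ^ 2 ≤ 2 := by linarith
        rw [div_le_iff₀ (by positivity)] at this
        rw [← hs]; nlinarith
      have h2 : ‖x‖ ≤ 2 * N := le_of_sq_le_sq h1 (by positivity)
      rw [abs_mul, abs_div, abs_of_nonneg (sq_nonneg N),
        abs_of_nonneg (Real.smoothTransition.nonneg _)]
      calc ‖x‖ * (σ (N ^ 2 * s - 1) * (|deriv σ (2 - s / N ^ 2)| / N ^ 2))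
          ≤ (2 * N) * (1 * (M / N ^ 2)) := by
            gcongr
            · exact mul_nonneg (Real.smoothTransition.nonneg _) (by positivity)
            · exact Real.smoothTransition.le_one _
            · exact hM _
        _ = 2 * M / N := by field_simp
  rw [Real.norm_eq_abs (_ - _)]
  calc 2 * ‖x i‖ * |N ^ 2 * deriv σ (N ^ 2 * s - 1) * σ (2 - s / N ^ 2)
          - σ (N ^ 2 * s - 1) * (deriv σ (2 - s / N ^ 2) / N ^ 2)|
      ≤ 2 * ‖x‖ * (|N ^ 2 * deriv σ (N ^ 2 * s - 1) * σ (2 - s / N ^ 2)|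
          + |σ (N ^ 2 * s - 1) * (deriv σ (2 - s / N ^ 2) / N ^ 2)|) := by
        gcongr
        exact abs_sub _ _
    _ ≤ 2 * (2 * M * (N * (Metric.ball (0 : Plane) (2 / N)).indicator 1 x)) + 2 * (2 * M / N) := by
        linarith
    _ = _ := by ring

/-- `N ∫_{‖x‖ < 2/N} |X| → 0` for square integrable `X`. -/
theorem tendsto_mul_setIntegral_ball (X : L2) :
    Tendsto (fun n : ℕ => (n + 1 : ℝ) * ∫ x in Metric.ball (0 : Plane) (2 / (n + 1)), ‖X x‖)
      atTop (𝓝 0) := by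
  have hX := Lp.memLp X
  have hsq : Integrable (fun x => ‖X x‖ ^ 2) := hX.integrable_norm_pow (by norm_num)
  set B : ℕ → Set Plane := fun n => Metric.ball (0 : Plane) (2 / (n + 1)) with hB
  have h1 : Tendsto (fun n => ∫ x in B n, ‖X x‖ ^ 2) atTop (𝓝 0) := by
    have hanti : Antitone B := fun n n' h => Metric.ball_subset_ball (by gcongr)
    have h := tendsto_setIntegral_of_antitone (μ := volume) (fun n => Metric.isOpen_ball.measurableSet)
      hanti ⟨0, hsq.integrableOn⟩
    have hI : ⋂ n, B n = {0} := by
      ext x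
      simp only [mem_iInter, mem_singleton_iff, hB, Metric.mem_ball, dist_zero_right]
      constructor
      · intro hx
        by_contra hne
        have hx0 := norm_pos_iff.2 hne
        obtain ⟨n, hn⟩ := exists_nat_gt (2 / ‖x‖)
        have h2 := hx n
        rw [lt_div_iff₀ (by positivity)] at h2
        rw [div_lt_iff₀ hx0] at hn
        nlinarith
      · rintro rfl n
        rw [norm_zero]; positivity
    rw [hI] at h
    simpa using h
  -- Cauchy–Schwarz: the area 4π/(n+1)² of the disc absorbs the square of the prefactor.
  have h2 : ∀ n : ℕ, ((n + 1 : ℝ) * ∫ x in B n, ‖X x‖) ^ 2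
      ≤ 4 * Real.pi * ∫ x in B n, ‖X x‖ ^ 2 := by
    intro n
    have hv : (volume (B n)).toReal = Real.pi * (2 / (n + 1)) ^ 2 := by
      rw [hB, EuclideanSpace.volume_ball_fin_two, ENNReal.toReal_mul, ENNReal.toReal_pow,
        ENNReal.toReal_ofReal (by positivity), ENNReal.toReal_ofReal Real.pi_pos.le, mul_comm]
    have : IsFiniteMeasure (volume.restrict (B n)) :=
      ⟨by rw [Measure.restrict_apply_univ]; exact measure_ball_lt_top⟩
    have h := sq_integral_norm_le (ν := volume.restrict (B n)) (f := fun x => (‖X x‖ : ℂ))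
      ((hX.norm.ofReal).restrict _)
    simp only [Complex.norm_real, norm_norm] at h
    rw [Measure.real, Measure.restrict_apply_univ, hv] at h
    calc _ = (n + 1 : ℝ) ^ 2 * (∫ x in B n, ‖X x‖) ^ 2 := by ring
      _ ≤ (n + 1 : ℝ) ^ 2 * (Real.pi * (2 / (n + 1)) ^ 2 * ∫ x in B n, ‖X x‖ ^ 2) := by gcongr
      _ = _ := by
        have : (n + 1 : ℝ) ≠ 0 := by positivity
        field_simp
        ring
  have h3 : Tendsto (fun n : ℕ => ((n + 1 : ℝ) * ∫ x in B n, ‖X x‖) ^ 2) atTop (𝓝 0) := by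
    refine squeeze_zero (fun n => sq_nonneg _) h2 ?_
    simpa using h1.const_mul (4 * Real.pi)
  have h4 := h3.sqrt
  rw [Real.sqrt_zero] at h4
  refine h4.congr fun n => Real.sqrt_sq (mul_nonneg (by positivity) ?_)
  exact integral_nonneg fun _ => norm_nonneg _

/-! ### A divergence theorem on the punctured plane -/

theorem integrable_smul_of_memLp {f : Plane → ℂ} (hf : MemLp f 2 volume) (X : L2) :
    Integrable (fun x => f x • X x) :=
  memLp_one_iff_integrable.1 ((Lp.memLp X).smul hf)

theorem contDiff_cutoff_mul {f : Plane → ℂ} (hf : ContDiffOn ℝ 1 f {0}ᶜ) {N : ℝ} (hN : 1 ≤ N) :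
    ContDiff ℝ 1 fun x => cutoff N x * f x := by
  rw [contDiff_iff_contDiffAt]
  intro x
  by_cases hx : x = 0
  · subst hx
    have : (fun x => cutoff N x * f x) =ᶠ[𝓝 0] fun _ => 0 := by
      filter_upwards [Metric.ball_mem_nhds (0 : Plane) (by positivity : 0 < 1 / N)] with x hx
      rw [Metric.mem_ball, dist_zero_right, lt_div_iff₀ (by linarith)] at hx
      rw [cutoff_eq_zero_of_small, zero_mul]
      rw [← mul_pow]
      exact pow_le_one₀ (by positivity) (by linarith)
    exact contDiffAt_const.congr_of_eventuallyEq this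
  · exact (contDiff_cutoff N (n := 1)).contDiffAt.mul
      (hf.contDiffAt (isOpen_compl_singleton.mem_nhds hx))

theorem pderiv_mul {f g : Plane → ℂ} {x : Plane} (hf : DifferentiableAt ℝ f x)
    (hg : DifferentiableAt ℝ g x) (i : Fin 2) :
    pderiv i (fun x => f x * g x) x = f x * pderiv i g x + pderiv i f x * g x := by
  unfold pderiv
  rw [fderiv_fun_mul hf hg]
  simp [mul_comm]

theorem ae_ne_zero : ∀ᵐ x : Plane, x ≠ 0 := by
  simp [ae_iff]

/-- The divergence theorem for fields that are bounded near the origin, smooth away from it, and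
square integrable, against functions with weak derivatives. -/
theorem integral_divergence_smul {f : Fin 2 → Plane → ℂ} (hf : ∀ i, ContDiffOn ℝ 1 (f i) {0}ᶜ)
    (hL : ∀ i, MemLp (f i) 2 volume)
    (hB : ∃ B, ∀ i x, x ≠ 0 → ‖x‖ ≤ 1 → ‖f i x‖ ≤ B)
    {X : L2} {DX : Fin 2 → L2} (hd : Integrable fun x => (∑ i, pderiv i (f i) x) • X x)
    (hX : ∀ i, HasWeakPartial i X (DX i)) :
    ∫ x, (∑ i, pderiv i (f i) x) • X x = -∑ i, ∫ x, f i x • DX i x := by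
  obtain ⟨B, hB⟩ := hB
  obtain ⟨C, hC0, hC⟩ := exists_norm_pderiv_cutoff_le
  set ν : ℕ → ℝ := fun n => n + 1 with hν
  have hν1 : ∀ n, 1 ≤ ν n := fun n => by simp [hν]
  have hνt : Tendsto ν atTop atTop := tendsto_atTop_add_const_right _ _ tendsto_natCast_atTop_atTop
  have hcut : ∀ n i, ContDiff ℝ 1 fun x => cutoff (ν n) x * f i x := fun n i =>
    contDiff_cutoff_mul (hf i) (hν1 n)
  have hcutc : ∀ n i, HasCompactSupport fun x => cutoff (ν n) x * f i x := fun n i =>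
    (hasCompactSupport_cutoff (hν1 n)).mul_right
  have hcc : ∀ n, Continuous (cutoff (ν n)) := fun n => (contDiff_cutoff _ (n := 0)).continuous
  have dom : ∀ (g : Plane → ℂ) (Y : L2), Integrable (fun x => g x • Y x) →
      Tendsto (fun n => ∫ x, (cutoff (ν n) x * g x) • Y x) atTop (𝓝 (∫ x, g x • Y x)) := by
    intro g Y hI
    refine tendsto_integral_of_dominated_convergence (fun x => ‖g x • Y x‖) (fun n => ?_) hI.norm
      (fun n => ae_of_all _ fun x => ?_) ?_
    · simp_rw [mul_smul]
      exact (hcc n).aestronglyMeasurable.smul hI.1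
    · rw [mul_smul, norm_smul]
      exact mul_le_of_le_one_left (norm_nonneg _) (norm_cutoff_le _ _)
    · filter_upwards [ae_ne_zero] with x hx
      simpa using (((tendsto_cutoff hx).comp hνt).mul_const (g x)).smul_const (Y x)
  -- The error caused by the cutoff. Near the origin its slope N meets the bounded field, and N
  -- ∫_{|x|<2/N} |X| → 0; elsewhere it is at most C/N times |f X|, which is integrable.
  set E : ℕ → Plane → ℂ := fun n x => ∑ i, pderiv i (cutoff (ν n)) x * f i x with hE
  have hEL : ∀ n, MemLp (E n) 2 volume := by
    intro n
    refine memLp_finsetSum _ fun i _ => ?_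
    have hpc : Continuous (pderiv i (cutoff (ν n))) :=
      continuous_pderiv (contDiff_cutoff _ (n := 1))
    refine (hL i).of_le_mul (c := C * ν n + C / ν n) (hpc.aestronglyMeasurable.mul (hL i).1)
      (ae_of_all _ fun x => ?_)
    rw [norm_mul]
    gcongr
    refine (hC _ (hν1 n) i x).trans ?_
    have h0 := hν1 n
    gcongr
    refine mul_le_of_le_one_right (by linarith) ?_
    exact indicator_le_self' (f := (1 : Plane → ℝ)) (fun _ _ => zero_le_one) x
  have step : ∀ n, (∫ x, (cutoff (ν n) x * ∑ i, pderiv i (f i) x) • X x) + ∫ x, E n x • X x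
      = -∑ i, ∫ x, (cutoff (ν n) x * f i x) • DX i x := by
    intro n
    have hcd : Integrable fun x => (cutoff (ν n) x * ∑ i, pderiv i (f i) x) • X x := by
      simp_rw [mul_smul]
      exact hd.bdd_smul (C := 1) (hcc n).aestronglyMeasurable
        (ae_of_all _ fun x => norm_cutoff_le _ _)
    rw [← integral_add hcd (integrable_smul_of_memLp (hEL n) X),
      ← Finset.sum_neg_distrib]
    simp_rw [← fun i => (hX i).integral_pderiv_smul (hcut n i) (hcutc n i)]
    rw [← integral_finsetSum]
    · refine integral_congr_ae ?_
      filter_upwards [ae_ne_zero] with x hx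
      have hfx : ∀ i, DifferentiableAt ℝ (f i) x := fun i =>
        ((hf i).contDiffAt (isOpen_compl_singleton.mem_nhds hx)).differentiableAt one_ne_zero
      have hcx : DifferentiableAt ℝ (cutoff (ν n)) x :=
        (contDiff_cutoff _ (n := 1)).differentiable one_ne_zero x
      simp_rw [fun i => pderiv_mul hcx (hfx i) i]
      rw [← add_smul, ← Finset.sum_smul, Finset.mul_sum, ← Finset.sum_add_distrib]
    · exact fun i _ => integrable_smul_coe X (continuous_pderiv (hcut n i))
        (hasCompactSupport_pderiv (hcutc n i))
  have herr : Tendsto (fun n => ∫ x, E n x • X x) atTop (𝓝 0) := by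
    have hFX : ∀ i, Integrable fun x => ‖f i x • X x‖ := fun i =>
      (integrable_smul_of_memLp (hL i) X).norm
    have hXloc : ∀ r, IntegrableOn (fun x => ‖X x‖) (Metric.ball (0 : Plane) r) := fun r =>
      (((locallyIntegrable_coe X).integrableOn_isCompact (isCompact_closedBall 0 r)).mono_set
        Metric.ball_subset_closedBall).norm
    -- For n ≥ 1 the disc of radius 2/(n+1) lies in the unit disc, where the bound on the field is
    -- available.
    have hb : ∀ n, 1 ≤ n → ‖∫ x, E n x • X x‖
        ≤ 2 * C * |B| * (ν n * ∫ x in Metric.ball (0 : Plane) (2 / ν n), ‖X x‖)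
          + C / ν n * ∑ i, ∫ x, ‖f i x • X x‖ := by
      intro n hn
      have hn2 : (2 : ℝ) ≤ ν n := by
        have : (1 : ℝ) ≤ n := by exact_mod_cast hn
        simp only [hν]; linarith
      have hIb : Integrable fun x => 2 * C * |B| * (ν n *
          (Metric.ball (0 : Plane) (2 / ν n)).indicator (fun x => ‖X x‖) x) :=
        (((hXloc _).integrable_indicator Metric.isOpen_ball.measurableSet).const_mul _).const_mul _
      have hIf : Integrable fun x => C / ν n * ∑ i, ‖f i x • X x‖ :=
        (integrable_finsetSum _ fun i _ => hFX i).const_mul _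
      calc ‖∫ x, E n x • X x‖ ≤ ∫ x, (2 * C * |B| * (ν n *
            (Metric.ball (0 : Plane) (2 / ν n)).indicator (fun x => ‖X x‖) x)
            + C / ν n * ∑ i, ‖f i x • X x‖) := by
            refine norm_integral_le_of_norm_le (hIb.add hIf) ?_
            filter_upwards [ae_ne_zero] with x hx
            have key : ∀ i, ‖pderiv i (cutoff (ν n)) x * f i x‖ * ‖X x‖
                ≤ C * |B| * (ν n * (Metric.ball (0 : Plane) (2 / ν n)).indicator
                    (fun x => ‖X x‖) x) + C / ν n * ‖f i x • X x‖ := by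
              intro i
              rw [norm_mul, norm_smul]
              have h1 := hC _ (hν1 n) i x
              by_cases hxb : x ∈ Metric.ball (0 : Plane) (2 / ν n)
              · rw [indicator_of_mem hxb] at h1 ⊢
                have hx1 : ‖x‖ ≤ 1 := by
                  rw [Metric.mem_ball, dist_zero_right] at hxb
                  exact hxb.le.trans ((div_le_one (by linarith)).2 hn2)
                have h2 : ‖f i x‖ ≤ |B| := (hB i x hx hx1).trans (le_abs_self B)
                rw [Pi.one_apply, mul_one] at h1
                have h3 : 0 ≤ C * ν n := by positivity
                calc ‖pderiv i (cutoff (ν n)) x‖ * ‖f i x‖ * ‖X x‖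
                    ≤ (C * ν n + C / ν n) * ‖f i x‖ * ‖X x‖ := by gcongr
                  _ = C * ν n * ‖f i x‖ * ‖X x‖ + C / ν n * (‖f i x‖ * ‖X x‖) := by ring
                  _ ≤ C * ν n * |B| * ‖X x‖ + C / ν n * (‖f i x‖ * ‖X x‖) := by gcongr
                  _ = _ := by ring
              · rw [indicator_of_notMem hxb] at h1 ⊢
                rw [mul_zero, mul_zero, zero_add] at h1 ⊢
                rw [← mul_assoc]
                gcongr
            rw [norm_smul]
            calc ‖E n x‖ * ‖X x‖ ≤ (∑ i, ‖pderiv i (cutoff (ν n)) x * f i x‖) * ‖X x‖ := by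
                  gcongr; exact norm_sum_le _ _
              _ = ∑ i, ‖pderiv i (cutoff (ν n)) x * f i x‖ * ‖X x‖ := Finset.sum_mul ..
              _ ≤ ∑ i, _ := Finset.sum_le_sum fun i _ => key i
              _ = _ := by
                rw [Finset.sum_add_distrib, Finset.mul_sum, Finset.sum_const, Finset.card_univ,
                  Fintype.card_fin]
                simp only [nsmul_eq_mul]
                push_cast
                ring
        _ = _ := by
            rw [integral_add hIb hIf, integral_const_mul, integral_const_mul, integral_const_mul,
              integral_indicator Metric.isOpen_ball.measurableSet,
              integral_finsetSum _ fun i _ => hFX i]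
    have hlim : Tendsto (fun n => 2 * C * |B| * (ν n * ∫ x in Metric.ball (0 : Plane) (2 / ν n),
        ‖X x‖) + C / ν n * ∑ i, ∫ x, ‖f i x • X x‖) atTop (𝓝 0) := by
      have l1 := (tendsto_mul_setIntegral_ball X).const_mul (2 * C * |B|)
      have l2 := (hνt.const_div_atTop C).mul_const (∑ i, ∫ x, ‖f i x • X x‖)
      simpa using l1.add l2
    refine squeeze_zero_norm' ?_ hlim
    filter_upwards [eventually_ge_atTop 1] with n hn using hb n hn
  have t1 := (dom _ X hd).add herr
  have t2 := (tendsto_finsetSum Finset.univ fun i _ => dom (f i) (DX i) (integrable_smul_of_memLp (hL i) _)).neg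
  rw [add_zero] at t1
  exact tendsto_nhds_unique t1 (t2.congr fun n => (step n).symm)

section

/-! ### Mode fields -/

/-- The function `q` with `y r = r ^ κ * q (r ^ 2)`. -/
def radialQuotient (κ : ℕ) (y : ℝ → ℂ) (s : ℝ) : ℂ := y (√s) / ((√s : ℝ) : ℂ) ^ κ

theorem eq_pow_mul_radialQuotient (κ : ℕ) (y : ℝ → ℂ) {r : ℝ} (hr : 0 < r) :
    y r = (r : ℂ) ^ κ * radialQuotient κ y (r ^ 2) := by
  have : (r : ℂ) ^ κ ≠ 0 := pow_ne_zero _ (by exact_mod_cast hr.ne')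
  rw [radialQuotient, Real.sqrt_sq hr.le, mul_div_cancel₀ _ this]

theorem contDiffOn_radialQuotient (κ : ℕ) {y : ℝ → ℂ} (hy : ContDiffOn ℝ 2 y (Ioi 0)) :
    ContDiffOn ℝ 2 (radialQuotient κ y) (Ioi 0) := by
  have hs : ContDiffOn ℝ 2 Real.sqrt (Ioi 0) := fun s hs =>
    (Real.contDiffAt_sqrt (ne_of_gt hs)).contDiffWithinAt
  refine (hy.comp hs fun s hs => Real.sqrt_pos.2 hs).mul
    (((Complex.ofRealCLM.contDiff.comp_contDiffOn hs).pow κ).inv fun s hs => ?_)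
  exact pow_ne_zero _ (Complex.ofReal_ne_zero.2 (Real.sqrt_pos.2 hs).ne')

theorem deriv_radialQuotient (κ : ℕ) {y : ℝ → ℂ} (hy : ContDiffOn ℝ 2 y (Ioi 0)) {r : ℝ}
    (hr : 0 < r) :
    deriv y r = κ / r * y r + 2 * (r : ℂ) ^ (κ + 1) * deriv (radialQuotient κ y) (r ^ 2) := by
  have hq := contDiffOn_radialQuotient κ hy
  have hr2 : 0 < r ^ 2 := by positivity
  have h2 : HasDerivAt (fun r : ℝ => r ^ 2) (2 * r) r := by simpa using hasDerivAt_pow 2 r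
  have h4 : HasDerivAt (fun r : ℝ => radialQuotient κ y (r ^ 2)) _ r :=
    HasDerivAt.scomp (h := fun r : ℝ => r ^ 2) r (hasDerivAt_of_contDiffOn hq hr2) h2
  have h1 := (hasDerivAt_ofReal_pow κ r).mul h4
  have h3 : y =ᶠ[𝓝 r] fun r : ℝ => (r : ℂ) ^ κ * radialQuotient κ y (r ^ 2) := by
    filter_upwards [Ioi_mem_nhds hr] with r hr using eq_pow_mul_radialQuotient κ y hr
  rw [(h1.congr_of_eventuallyEq h3).deriv, eq_pow_mul_radialQuotient κ y hr]
  have hr0 : (r : ℂ) ≠ 0 := by exact_mod_cast hr.ne'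
  simp only [Complex.real_smul]
  push_cast
  rcases κ with _ | κ
  · simp
  · simp only [Nat.add_sub_cancel]
    push_cast
    field_simp
    ring

/-- This matches the radial operator with the expression produced by `laplacian_zetaL_pow_mul`. -/
theorem laplacian_radialQuotient (κ : ℕ) {y : ℝ → ℂ} (hy : ContDiffOn ℝ 2 y (Ioi 0)) {r : ℝ}
    (hr : 0 < r) :
    (r : ℂ) ^ κ * (4 * r ^ 2 * deriv (deriv (radialQuotient κ y)) (r ^ 2)
        + 4 * (κ + 1) * deriv (radialQuotient κ y) (r ^ 2))
      = deriv (deriv y) r + (1 / (r : ℂ)) * deriv y r - κ ^ 2 / (r : ℂ) ^ 2 * y r := by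
  have hq := contDiffOn_radialQuotient κ hy
  have hr2 : 0 < r ^ 2 := by positivity
  have hr0 : (r : ℂ) ≠ 0 := by exact_mod_cast hr.ne'
  have h2 : HasDerivAt (fun r : ℝ => r ^ 2) (2 * r) r := by simpa using hasDerivAt_pow 2 r
  have hi : HasDerivAt (fun r : ℝ => (κ : ℂ) / (r : ℂ)) (-(κ : ℂ) / (r : ℂ) ^ 2) r := by
    have := ((hasDerivAt_id r).ofReal_comp.fun_inv hr0).const_mul (κ : ℂ)
    refine (this.congr_deriv ?_).congr_of_eventuallyEq (Eventually.of_forall fun s => ?_)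
    · simp; ring
    · simp [div_eq_mul_inv]
  have h4 : HasDerivAt (fun r : ℝ => deriv (radialQuotient κ y) (r ^ 2)) _ r :=
    HasDerivAt.scomp (h := fun r : ℝ => r ^ 2) r (hasDerivAt_deriv_of_contDiffOn hq hr2) h2
  have h1 := (hi.mul (hasDerivAt_of_contDiffOn hy hr)).add
    (((hasDerivAt_ofReal_pow (κ + 1) r).const_mul 2).mul h4)
  have h3 : deriv y =ᶠ[𝓝 r] fun r : ℝ => κ / (r : ℂ) * y r
      + 2 * (r : ℂ) ^ (κ + 1) * deriv (radialQuotient κ y) (r ^ 2) := by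
    filter_upwards [Ioi_mem_nhds hr] with r hr using deriv_radialQuotient κ hy hr
  rw [(h1.congr_of_eventuallyEq h3).deriv, deriv_radialQuotient κ hy hr]
  simp only [Complex.real_smul, Nat.add_sub_cancel]
  push_cast
  field_simp
  ring

/-- The field `e^{ikθ} y(r)`, written so that its smoothness away from the origin is apparent. -/
def modeField (k : ℤ) (y : ℝ → ℂ) (x : Plane) : ℂ :=
  zetaL (unitOf k) x ^ k.natAbs * radialQuotient k.natAbs y (‖x‖ ^ 2)

variable {k : ℤ} {y : ℝ → ℂ} {x : Plane}

theorem modeField_eq (hx : x ≠ 0) : modeField k y x = angularMode k x * y ‖x‖ := by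
  rw [eq_pow_mul_radialQuotient k.natAbs y (norm_pos_iff.2 hx), modeField, ← harm, harm_eq]
  ring

theorem contDiffOn_modeField (hy : ContDiffOn ℝ 2 y (Ioi 0)) :
    ContDiffOn ℝ 2 (modeField k y) {0}ᶜ := by
  refine ((zetaL (unitOf k)).contDiff.pow k.natAbs).contDiffOn.mul
    ((contDiffOn_radialQuotient k.natAbs hy).comp (contDiff_norm_sq ℝ).contDiffOn fun x hx => ?_)
  have : 0 < ‖x‖ := norm_pos_iff.2 hx
  exact mem_Ioi.2 (by positivity)

theorem contDiffOn_pderiv_modeField (hy : ContDiffOn ℝ 2 y (Ioi 0)) (i : Fin 2) :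
    ContDiffOn ℝ 1 (pderiv i (modeField k y)) {0}ᶜ := by
  have := (contDiffOn_modeField (k := k) hy).fderiv_of_isOpen isOpen_compl_singleton
    (m := 1) (by norm_num)
  exact this.clm_apply contDiffOn_const

theorem norm_zetaCoeff_unitOf (k : ℤ) (i : Fin 2) : ‖zetaCoeff (unitOf k) i‖ = 1 := by
  fin_cases i
  · simp [zetaCoeff_zero]
  · simp only [Fin.mk_one, zetaCoeff_one, unitOf]; split_ifs <;> simp

/-- Differentiating the harmonic polynomial gives a term of size κ|y|/r, and differentiating the
radial quotient one of size at most |y' - κ y / r|; the triangle inequality accounts for the factor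
2. -/
theorem norm_pderiv_modeField_le (hy : ContDiffOn ℝ 2 y (Ioi 0)) (hx : x ≠ 0) (i : Fin 2) :
    ‖pderiv i (modeField k y) x‖
      ≤ ‖deriv y ‖x‖‖ + 2 * ‖(k.natAbs : ℂ) / (‖x‖ : ℂ) * y ‖x‖‖ := by
  have hr : 0 < ‖x‖ := norm_pos_iff.2 hx
  have hr0 : (‖x‖ : ℂ) ≠ 0 := by exact_mod_cast hr.ne'
  have hq := contDiffOn_radialQuotient k.natAbs hy
  have hp := pderiv_zetaL_pow_mul (unitOf k) k.natAbs (x := x)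
    (hasDerivAt_of_contDiffOn hq (r := ‖x‖ ^ 2) (by positivity)).differentiableAt i
  have hz : ‖zetaL (unitOf k) x‖ = ‖x‖ := by
    have h := norm_harm (if 0 ≤ k then 1 else -1) x
    by_cases hk : 0 ≤ k <;> simpa [harm, unitOf, hk] using h
  set q := radialQuotient k.natAbs y with hqdef
  have e1 : ‖(k.natAbs : ℂ) * zetaCoeff (unitOf k) i
      * (zetaL (unitOf k) x ^ (k.natAbs - 1) * q (‖x‖ ^ 2))‖
      = ‖(k.natAbs : ℂ) / (‖x‖ : ℂ) * y ‖x‖‖ := by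
    rw [eq_pow_mul_radialQuotient k.natAbs y hr, ← hqdef]
    simp only [norm_mul, norm_div, norm_pow, norm_zetaCoeff_unitOf, hz, Complex.norm_real,
      norm_norm]
    rcases k.natAbs with _ | n
    · simp
    · simp only [Nat.add_sub_cancel]
      field_simp
      ring
  have e2 : ‖2 * (x i : ℂ) * (zetaL (unitOf k) x ^ k.natAbs * deriv q (‖x‖ ^ 2))‖
      ≤ ‖deriv y ‖x‖ - (k.natAbs : ℂ) / (‖x‖ : ℂ) * y ‖x‖‖ := by
    rw [deriv_radialQuotient k.natAbs hy hr, add_sub_cancel_left, ← hqdef]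
    simp only [norm_mul, norm_pow, hz, Complex.norm_real, norm_norm, Complex.norm_two]
    have hxi : ‖x i‖ ≤ ‖x‖ := PiLp.norm_apply_le x i
    calc 2 * ‖x i‖ * (‖x‖ ^ k.natAbs * ‖deriv q (‖x‖ ^ 2)‖)
        ≤ 2 * ‖x‖ * (‖x‖ ^ k.natAbs * ‖deriv q (‖x‖ ^ 2)‖) := by gcongr
      _ = _ := by ring
  rw [show pderiv i (modeField k y) x = _ from hp]
  refine (norm_add_le _ _).trans ?_
  rw [e1]
  linarith [e2.trans (norm_sub_le _ _)]

theorem laplacian_modeField (hy : ContDiffOn ℝ 2 y (Ioi 0)) (hx : x ≠ 0) :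
    ∑ i, pderiv i (pderiv i (modeField k y)) x
      = angularMode k x * (deriv (deriv y) ‖x‖ + (1 / (‖x‖ : ℂ)) * deriv y ‖x‖
        - (k.natAbs : ℂ) ^ 2 / (‖x‖ : ℂ) ^ 2 * y ‖x‖) := by
  have hr : 0 < ‖x‖ := norm_pos_iff.2 hx
  have h := laplacian_zetaL_pow_mul (unitOf_sq k) k.natAbs isOpen_Ioi
    (contDiffOn_radialQuotient k.natAbs hy) (x := x) (mem_Ioi.2 (by positivity))
  rw [← laplacian_radialQuotient k.natAbs hy hr]
  rw [show ∑ i, pderiv i (pderiv i (modeField k y)) x = _ from h, ← harm, harm_eq]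
  ring

end

section

/-! ### Mode fields in the domain of the harmonic operator -/

/-- The regularity and decay of `y` that put `e^{ikθ} y(r)`, `|k| = κ`, into the domain of `L_c`;
here `F` is the source of the radial equation. -/
structure ModeProfile (κ : ℕ) (y F : ℝ → ℂ) : Prop where
  contDiffOn : ContDiffOn ℝ 2 y (Ioi 0)
  ode : ∀ r : ℝ, 0 < r →
    deriv (deriv y) r + (1 / (r : ℂ)) * deriv y r = κ ^ 2 / (r : ℂ) ^ 2 * y r + F r
  bound : ∃ B, ∀ r : ℝ, 0 < r → r ≤ 1 →
    ‖y r‖ ≤ B ∧ ‖(κ : ℂ) / (r : ℂ) * y r‖ ≤ B ∧ ‖deriv y r‖ ≤ B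
  memLp : MemLp y 2 radialMeasure
  memLp_mul : MemLp (fun r : ℝ => (r : ℂ) * y r) 2 radialMeasure
  memLp_deriv : MemLp (deriv y) 2 radialMeasure
  memLp_div : MemLp (fun r : ℝ => (κ : ℂ) / (r : ℂ) * y r) 2 radialMeasure
  memLp_energy : MemLp (fun r : ℝ => -(1 / 2) * F r + (r : ℂ) ^ 2 / 2 * y r) 2 radialMeasure

theorem pderiv_conj_comp (i : Fin 2) (V : Plane → ℂ) (x : Plane) :
    pderiv i (fun x => conj (V x)) x = conj (pderiv i V x) := by
  have := Complex.conjCLE.comp_fderiv (f := V) (x := x)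
  exact congrArg (fun L => L (EuclideanSpace.single i 1)) this

theorem integral_inner_smul_vec {X : L2} {h : Plane → ℂ} (e : C2)
    (hI : Integrable fun x => conj (h x) • X x) :
    ∫ x, inner ℂ (X x) (h x • e) = conj (inner ℂ e (∫ x, conj (h x) • X x)) := by
  rw [← integral_inner hI, ← integral_conj]
  refine integral_congr_ae (ae_of_all _ fun x => ?_)
  simp only [inner_smul_right, map_mul, Complex.conj_conj, inner_conj_symm]

theorem integrable_inner_smul_vec {X : L2} {h : Plane → ℂ} (e : C2)
    (hI : Integrable fun x => conj (h x) • X x) :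
    Integrable fun x => inner ℂ (X x) (h x • e) := by
  have h1 : Integrable fun x => inner ℂ (conj (h x) • X x) e := hI.inner_const e
  simpa only [inner_smul_left, Complex.conj_conj, inner_smul_right] using h1

theorem MemLp.conj_comp {h : Plane → ℂ} (hh : MemLp h 2 volume) :
    MemLp (fun x => conj (h x)) 2 volume :=
  hh.of_le (Complex.continuous_conj.comp_aestronglyMeasurable hh.1)
    (ae_of_all _ fun x => by simp)

namespace ModeProfile

variable {k : ℤ} {y F : ℝ → ℂ}

theorem memLp_modeField (h : ModeProfile k.natAbs y F) : MemLp (modeField k y) 2 volume := by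
  refine (memLp_congr_ae ?_).2 (memLp_angularMode_mul k h.memLp)
  filter_upwards [ae_ne_zero] with x hx using modeField_eq hx

theorem memLp_norm_mul_modeField (h : ModeProfile k.natAbs y F) :
    MemLp (fun x => (‖x‖ : ℂ) * modeField k y x) 2 volume := by
  refine (memLp_congr_ae ?_).2 (memLp_angularMode_mul k h.memLp_mul)
  filter_upwards [ae_ne_zero] with x hx
  rw [modeField_eq hx]; ring

theorem memLp_pderiv_modeField (h : ModeProfile k.natAbs y F) (i : Fin 2) :
    MemLp (pderiv i (modeField k y)) 2 volume := by
  have hm : AEStronglyMeasurable (pderiv i (modeField k y)) volume := by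
    have h1 := (contDiffOn_pderiv_modeField (k := k) h.contDiffOn i).continuousOn
    have h2 := h1.aestronglyMeasurable (μ := volume) isOpen_compl_singleton.measurableSet
    rwa [Measure.restrict_eq_self_of_ae_mem (by simpa using ae_ne_zero)] at h2
  -- The mode of index 0 serves to view radial L² functions as functions on the plane.
  refine ((memLp_angularMode_mul 0 h.memLp_deriv).norm.add
    ((memLp_angularMode_mul 0 h.memLp_div).norm.const_mul 2)).of_le hm ?_
  filter_upwards [ae_ne_zero] with x hx
  refine (norm_pderiv_modeField_le h.contDiffOn hx i).trans ?_
  simp only [Pi.add_apply, norm_mul (angularMode 0 x), norm_angularMode, one_mul]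
  exact le_abs_self _

theorem exists_bound_modeField (h : ModeProfile k.natAbs y F) :
    ∃ B, 0 ≤ B ∧ ∀ x : Plane, x ≠ 0 → ‖x‖ ≤ 1 →
      ‖modeField k y x‖ ≤ B ∧ ∀ i, ‖pderiv i (modeField k y) x‖ ≤ B := by
  obtain ⟨B, hB⟩ := h.bound
  have hB0 : 0 ≤ B := (norm_nonneg _).trans (hB 1 one_pos le_rfl).1
  refine ⟨3 * B, by positivity, fun x hx hx1 => ?_⟩
  obtain ⟨h1, h2, h3⟩ := hB ‖x‖ (norm_pos_iff.2 hx) hx1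
  refine ⟨?_, fun i => ?_⟩
  · rw [modeField_eq hx, norm_mul, norm_angularMode, one_mul]; linarith
  · linarith [norm_pderiv_modeField_le (k := k) h.contDiffOn hx i]

theorem laplacian_modeField (h : ModeProfile k.natAbs y F) {x : Plane} (hx : x ≠ 0) :
    ∑ i, pderiv i (pderiv i (modeField k y)) x = angularMode k x * F ‖x‖ := by
  rw [GPVortex.laplacian_modeField h.contDiffOn hx, h.ode _ (norm_pos_iff.2 hx),
    add_sub_cancel_left]

theorem memLp_modeField_smul (h : ModeProfile k.natAbs y F) (e : C2) :
    MemLp (fun x => modeField k y x • e) 2 (volume : Measure Plane) := by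
  have := h.memLp_modeField
  exact (this.norm.mul_const ‖e‖).of_le (this.1.smul_const e) (ae_of_all _ fun x => by
    simp [norm_smul])

theorem memLp_pderiv_modeField_smul (h : ModeProfile k.natAbs y F) (e : C2) (i : Fin 2) :
    MemLp (fun x => pderiv i (modeField k y) x • e) 2 (volume : Measure Plane) := by
  have := h.memLp_pderiv_modeField i
  exact (this.norm.mul_const ‖e‖).of_le (this.1.smul_const e) (ae_of_all _ fun x => by
    simp [norm_smul])

theorem hasWeakPartial (h : ModeProfile k.natAbs y F) (e : C2) (i : Fin 2) :
    HasWeakPartial i ((h.memLp_modeField_smul e).toLp _)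
      ((h.memLp_pderiv_modeField_smul e i).toLp _) := by
  intro ψ hψ hψc
  set ψ' : Plane → ℂ := fun x => ψ x with hψ'
  have h1 : ContDiff ℝ 1 ψ' := Complex.ofRealCLM.contDiff.comp (hψ.of_le (by simp))
  have hc : HasCompactSupport ψ' := hψc.comp_left (g := Complex.ofReal) Complex.ofReal_zero
  have hpd : ∀ x, pderiv i ψ' x = (fderiv ℝ ψ x (EuclideanSpace.single i 1) : ℝ) := fun x => by
    have hd := (hψ.differentiable (by simp) x).hasFDerivAt
    have := (Complex.ofRealCLM.hasFDerivAt.comp x hd).fderiv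
    exact congrArg (fun L => L (EuclideanSpace.single i 1)) this
  -- The divergence theorem for a field with a single nonzero component is integration by parts in
  -- direction i. The smooth test function plays the role of `X`.
  set f : Fin 2 → Plane → ℂ := fun j => if j = i then modeField k y else 0 with hf
  have hsum : ∀ x, ∑ j, pderiv j (f j) x = pderiv i (modeField k y) x := by
    intro x
    rw [Finset.sum_eq_single i]
    · simp [hf]
    · intro j _ hj
      simp [hf, hj, pderiv]
    · simp
  have hfc : ∀ j, ContDiffOn ℝ 1 (f j) {0}ᶜ := by
    intro j
    by_cases hj : j = i
    · simp only [hf, hj, if_true]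
      exact (contDiffOn_modeField h.contDiffOn).of_le (by norm_num)
    · simp only [hf, hj, if_false]
      exact contDiffOn_const
  have hfL : ∀ j, MemLp (f j) 2 volume := by
    intro j
    by_cases hj : j = i
    · simpa only [hf, hj, if_true] using h.memLp_modeField
    · simp only [hf, hj, if_false]
      exact MemLp.zero
  have hfB : ∃ B, ∀ j x, x ≠ 0 → ‖x‖ ≤ 1 → ‖f j x‖ ≤ B := by
    obtain ⟨B, hB0, hB⟩ := h.exists_bound_modeField
    refine ⟨B, fun j x hx hx1 => ?_⟩
    by_cases hj : j = i
    · simpa only [hf, hj, if_true] using (hB x hx hx1).1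
    · simpa [hf, hj] using hB0
  have hdiv := integral_divergence_smul hfc hfL hfB
    (X := (memLp_smul_vec h1.continuous hc e).toLp _)
    (by simp_rw [hsum]; exact integrable_smul_of_memLp (h.memLp_pderiv_modeField i) _)
    (hasWeakPartial_smul_vec h1 hc e)
  rw [Finset.sum_eq_single i (fun j _ hj => by simp [hf, hj]) (by simp)] at hdiv
  simp_rw [hsum] at hdiv
  simp only [hf, if_true] at hdiv
  have eL : ∫ x, (fderiv ℝ ψ x (EuclideanSpace.single i 1)) •
        ((h.memLp_modeField_smul e).toLp _ : L2) x
      = ∫ x, modeField k y x • ((memLp_smul_vec (continuous_pderiv (i := i) h1)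
          (hasCompactSupport_pderiv hc) e).toLp _ : L2) x := by
    refine integral_congr_ae ?_
    filter_upwards [(h.memLp_modeField_smul e).coeFn_toLp, (memLp_smul_vec
      (continuous_pderiv (i := i) h1) (hasCompactSupport_pderiv hc) e).coeFn_toLp] with x e1 e2
    rw [e1, e2, hpd, Complex.coe_smul, smul_comm]
  have eR : ∫ x, ψ x • ((h.memLp_pderiv_modeField_smul e i).toLp _ : L2) x
      = ∫ x, pderiv i (modeField k y) x •
        ((memLp_smul_vec h1.continuous hc e).toLp _ : L2) x := by
    refine integral_congr_ae ?_
    filter_upwards [(h.memLp_pderiv_modeField_smul e i).coeFn_toLp,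
      (memLp_smul_vec h1.continuous hc e).coeFn_toLp] with x e1 e2
    rw [e1, e2, hψ', Complex.coe_smul, smul_comm]
  rw [eL, eR, hdiv, neg_neg]

theorem inFormDomain (h : ModeProfile k.natAbs y F) (e : C2) :
    InFormDomain ((h.memLp_modeField_smul e).toLp _)
      (fun i => (h.memLp_pderiv_modeField_smul e i).toLp _) := by
  refine ⟨h.hasWeakPartial e, ?_⟩
  have h1 := h.memLp_norm_mul_modeField
  have h2 : MemLp (fun x => ((‖x‖ : ℂ) * modeField k y x) • e) 2 (volume : Measure Plane) :=
    (h1.norm.mul_const ‖e‖).of_le (h1.1.smul_const e) (ae_of_all _ fun x => by simp [norm_smul])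
  refine h2.ae_eq ?_
  filter_upwards [(h.memLp_modeField_smul e).coeFn_toLp] with x hx
  rw [hx, mul_smul, Complex.coe_smul]

/-- `L_c (e^{ikθ} y e) = e^{ikθ} (-F/2 + r² y/2) e`. -/
theorem lcEq (h : ModeProfile k.natAbs y F) {e : C2} {Ψ Γ : L2}
    (hΨ : ∀ᵐ x, Ψ x = modeField k y x • e)
    (hΓ : ∀ᵐ x, Γ x = (angularMode k x
      * (-(1 / 2) * F ‖x‖ + (‖x‖ : ℂ) ^ 2 / 2 * y ‖x‖)) • e) : LcEq Ψ Γ := by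
  obtain rfl : Ψ = (h.memLp_modeField_smul e).toLp _ := by
    refine Lp.ext ?_
    filter_upwards [hΨ, (h.memLp_modeField_smul e).coeFn_toLp] with x h1 h2
    rw [h1, h2]
  refine ⟨_, h.inFormDomain e, fun X DX ⟨hX, hXw⟩ => ?_⟩
  set φ := modeField k y with hφ
  set γ : Plane → ℂ := fun x => angularMode k x
    * (-(1 / 2) * F ‖x‖ + (‖x‖ : ℂ) ^ 2 / 2 * y ‖x‖) with hγ
  have hγL : MemLp γ 2 volume := memLp_angularMode_mul k h.memLp_energy
  have hlap : ∀ᵐ x, ∑ i, pderiv i (pderiv i φ) x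
      = -2 * γ x + (‖x‖ : ℂ) * ((‖x‖ : ℂ) * φ x) := by
    filter_upwards [ae_ne_zero] with x hx
    rw [h.laplacian_modeField hx, hφ, modeField_eq hx, hγ]
    ring
  -- The term r² φ is not known to be square integrable, so its pairing with X is written as that of
  -- rφ with rX, both in L².
  set Xw : L2 := hXw.toLp _ with hXw'
  have hXwe : ∀ᵐ x, Xw x = ‖x‖ • X x := hXw.coeFn_toLp
  have I1 : Integrable fun x => conj (γ x) • X x :=
    integrable_smul_of_memLp (MemLp.conj_comp hγL) X
  have I2 : Integrable fun x => conj ((‖x‖ : ℂ) * ((‖x‖ : ℂ) * φ x)) • X x := by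
    refine (integrable_smul_of_memLp (MemLp.conj_comp h.memLp_norm_mul_modeField) Xw).congr ?_
    filter_upwards [hXwe] with x hx
    rw [hx, map_mul (starRingEnd ℂ) (‖x‖ : ℂ) (_ * _), Complex.conj_ofReal, mul_smul,
      Complex.coe_smul, smul_comm]
  have I3 : Integrable fun x => conj (∑ i, pderiv i (pderiv i φ) x) • X x := by
    refine ((I1.smul (-2 : ℂ)).add I2).congr ?_
    filter_upwards [hlap] with x hx
    rw [hx, map_add, add_smul]
    simp only [Pi.add_apply, Pi.smul_apply, map_mul, map_neg, Complex.conj_ofNat, smul_smul]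
  have I4 : ∀ i, Integrable fun x => conj (pderiv i φ x) • DX i x := fun i =>
    integrable_smul_of_memLp (MemLp.conj_comp (h.memLp_pderiv_modeField i)) _
  -- Green's identity for the conjugated gradient of the mode field against an arbitrary X of the
  -- form domain. The bound on the gradient near 0 prevents a contribution from the origin.
  have hdiv := integral_divergence_smul (f := fun i x => conj (pderiv i φ x)) (X := X) (DX := DX)
    (fun i => Complex.conjCLE.contDiff.comp_contDiffOn (contDiffOn_pderiv_modeField h.contDiffOn i))
    (fun i => MemLp.conj_comp (h.memLp_pderiv_modeField i))
    (by
      obtain ⟨B, -, hB⟩ := h.exists_bound_modeField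
      exact ⟨B, fun i x hx hx1 => by simpa using (hB x hx hx1).2 i⟩)
    (by simp_rw [pderiv_conj_comp, ← map_sum]; exact I3) hX
  simp_rw [pderiv_conj_comp, ← map_sum] at hdiv
  have key : ∑ i, ∫ x, inner ℂ (DX i x) (pderiv i φ x • e)
      = -∫ x, inner ℂ (X x) ((∑ i, pderiv i (pderiv i φ) x) • e) := by
    rw [integral_inner_smul_vec e I3, hdiv, inner_neg_right, map_neg, neg_neg, inner_sum, map_sum]
    exact Finset.sum_congr rfl fun i _ => integral_inner_smul_vec e (I4 i)
  have J2 := integrable_inner_smul_vec e I2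
  have J3 := integrable_inner_smul_vec e I3
  have J4 := fun i => integrable_inner_smul_vec e (I4 i)
  rw [L2.inner_def, harmonicForm]
  calc _ = ∫ x, ((1 / 2 : ℂ) * ∑ i, inner ℂ (DX i x) (pderiv i φ x • e)
        + (1 / 2 : ℂ) * inner ℂ (X x) (((‖x‖ : ℂ) * ((‖x‖ : ℂ) * φ x)) • e)) := by
        refine integral_congr_ae ?_
        have hD : ∀ᵐ x, ∀ i, ((h.memLp_pderiv_modeField_smul e i).toLp _ : L2) x
            = pderiv i φ x • e := ae_all_iff.2 fun i =>
          (h.memLp_pderiv_modeField_smul e i).coeFn_toLp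
        filter_upwards [(h.memLp_modeField_smul e).coeFn_toLp, hD] with x h1 h2
        rw [h1]
        simp only [h2]
        congr 1
        simp only [inner_smul_right]
        push_cast
        ring
    _ = (1 / 2 : ℂ) * (∑ i, ∫ x, inner ℂ (DX i x) (pderiv i φ x • e))
        + (1 / 2 : ℂ) * ∫ x, inner ℂ (X x) (((‖x‖ : ℂ) * ((‖x‖ : ℂ) * φ x)) • e) := by
        rw [← integral_finsetSum _ fun i _ => J4 i]
        exact integral_eq_combination (integrable_finsetSum _ fun i _ => J4 i) J2 _ _
          fun x => rfl
    _ = (-(1 / 2) : ℂ) * (∫ x, inner ℂ (X x) ((∑ i, pderiv i (pderiv i φ) x) • e))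
        + (1 / 2 : ℂ) * ∫ x, inner ℂ (X x) (((‖x‖ : ℂ) * ((‖x‖ : ℂ) * φ x)) • e) := by
        rw [key]; ring
    _ = ∫ x, ((-(1 / 2) : ℂ) * inner ℂ (X x) ((∑ i, pderiv i (pderiv i φ) x) • e)
        + (1 / 2 : ℂ) * inner ℂ (X x) (((‖x‖ : ℂ) * ((‖x‖ : ℂ) * φ x)) • e)) :=
        (integral_eq_combination J3 J2 _ _ fun x => rfl).symm
    _ = _ := by
        refine integral_congr_ae ?_
        filter_upwards [hΓ, hlap] with x h1 h2
        rw [h1, h2]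
        simp only [inner_smul_right]
        ring

end ModeProfile

end

section

/-! ### Modes are eigenfunctions -/

theorem memLp_radialMeasure {f : ℝ → ℂ} (hc : ContinuousOn f (Ioi 0)) (hb : LocBdd f) {R : ℝ}
    (hR : 0 < R) {g : ℝ → ℝ} (hg : IntegrableOn g (Ioi R))
    (hfg : ∀ r, R < r → r * ‖f r‖ ^ 2 ≤ g r) : MemLp f 2 radialMeasure := by
  rw [memLp_two_iff_integrable_sq_norm
    (ContinuousOn.aestronglyMeasurable_radialMeasure hc), integrable_radialMeasure_iff]
  have hcc : ContinuousOn (fun r => r • ‖f r‖ ^ 2) (Ioi 0) := continuousOn_id.smul (hc.norm.pow 2)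
  obtain ⟨B, hB0, hB⟩ := hb (R + 1)
  have h1 : IntegrableOn (fun r => r • ‖f r‖ ^ 2) (Ioo 0 (R + 1)) := by
    refine Integrable.mono' (integrableOn_const (C := (R + 1) * B ^ 2) (by simp))
      ((hcc.mono Ioo_subset_Ioi_self).aestronglyMeasurable measurableSet_Ioo) ?_
    filter_upwards [ae_restrict_mem measurableSet_Ioo] with r hr
    have hr0 : 0 < r := hr.1
    rw [smul_eq_mul, Real.norm_of_nonneg (by positivity)]
    exact mul_le_mul hr.2.le (pow_le_pow_left₀ (norm_nonneg _) (hB r hr.1 hr.2) 2) (by positivity)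
      (by linarith)
  have h2 : IntegrableOn (fun r => r • ‖f r‖ ^ 2) (Ioi R) := by
    refine Integrable.mono' hg ((hcc.mono (Ioi_subset_Ioi hR.le)).aestronglyMeasurable
      measurableSet_Ioi) ?_
    filter_upwards [ae_restrict_mem measurableSet_Ioi] with r hr
    have : 0 < r := hR.trans hr
    rw [smul_eq_mul, Real.norm_of_nonneg (by positivity)]
    exact hfg r hr
  refine (h1.union h2).mono_set fun r hr => ?_
  rcases lt_or_ge r (R + 1) with h | h
  · exact Or.inl ⟨hr, h⟩
  · exact Or.inr (mem_Ioi.2 (by linarith))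

theorem memLp_bdd_mul {f a : ℝ → ℂ} (hf : MemLp f 2 radialMeasure) (ha : ContinuousOn a (Ioi 0))
    {A : ℝ} (hA : ∀ r, 0 < r → ‖a r‖ ≤ A) : MemLp (fun r => a r * f r) 2 radialMeasure := by
  refine hf.of_le_mul (c := A)
    ((ContinuousOn.aestronglyMeasurable_radialMeasure ha).mul hf.1) ?_
  filter_upwards [ae_radialMeasure_pos] with r hr
  rw [norm_mul]
  exact mul_le_mul_of_nonneg_right (hA r hr) (norm_nonneg _)

variable {m : ℤ} {μ : ℝ} {w : ℝ → ℝ} {lam : ℂ} {j : ℤ} {yp ym : ℝ → ℂ}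

/-- The growing term r² cancels, so the image under L_c is a combination of y and y' with
coefficients bounded by the profile; it is also the radial form of the eigenvalue relation. -/
theorem energy_source_eq (lam : ℂ) (y y' : ℝ → ℂ) (r : ℝ) :
    -(1 / 2) * source μ w lam y y' r + (r : ℂ) ^ 2 / 2 * y r
      = (Complex.I * lam - ((2 * |w r| ^ 2 - μ : ℝ) : ℂ)) * y r
        + (-((|w r| ^ 2 : ℝ) : ℂ)) * y' r := by
  simp only [source]
  push_cast
  ring

theorem IsVortexProfile.memLp_energy (hw : IsVortexProfile m μ w) (lam : ℂ) {y y' : ℝ → ℂ}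
    (hy : MemLp y 2 radialMeasure) (hy' : MemLp y' 2 radialMeasure) :
    MemLp (fun r : ℝ => -(1 / 2) * source μ w lam y y' r + (r : ℂ) ^ 2 / 2 * y r) 2
      radialMeasure := by
  simp_rw [energy_source_eq]
  obtain ⟨W, hW0, hW⟩ := hw.exists_bound
  have hW2 : ∀ r, 0 < r → |w r| ^ 2 ≤ W ^ 2 := fun r hr =>
    pow_le_pow_left₀ (abs_nonneg _) (hW r hr) 2
  have hc := hw.continuousOn_sq
  refine (memLp_bdd_mul hy (a := fun r => Complex.I * lam - ((2 * |w r| ^ 2 - μ : ℝ) : ℂ))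
    (A := ‖lam‖ + (2 * W ^ 2 + |μ|)) ?_ fun r hr => ?_).add
    (memLp_bdd_mul hy' (a := fun r => -((|w r| ^ 2 : ℝ) : ℂ)) (A := W ^ 2) ?_ fun r hr => ?_)
  · exact continuousOn_const.sub (Complex.continuous_ofReal.comp_continuousOn (by fun_prop))
  · refine (norm_sub_le _ _).trans ?_
    rw [norm_mul, Complex.norm_I, one_mul, Complex.norm_real]
    gcongr
    refine (norm_sub_le _ _).trans ?_
    rw [Real.norm_of_nonneg (by positivity), Real.norm_eq_abs μ]
    linarith [hW2 r hr]
  · exact (Complex.continuous_ofReal.comp_continuousOn hc).neg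
  · rw [norm_neg, Complex.norm_real, Real.norm_of_nonneg (by positivity)]
    exact hW2 r hr

theorem memLp_of_integrableOn_cube {y : ℝ → ℂ} (hy : ContinuousOn y (Ioi 0)) (hyb : LocBdd y)
    {R : ℝ} (hR : 1 ≤ R) (h : IntegrableOn (fun r => r ^ 3 * ‖y r‖ ^ 2) (Ioi R)) :
    MemLp y 2 radialMeasure := by
  refine memLp_radialMeasure hy hyb (by linarith) h fun r hr => ?_
  have h1 : 1 ≤ r := hR.trans hr.le
  have : r ≤ r ^ 3 := le_self_pow₀ h1 (by norm_num)
  gcongr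

/-- The absence of a singular part controls y, y' and κ y / r near 0, and the weighted integrals
control them at infinity. -/
theorem modeProfile_of_ode {κ : ℕ} {y F : ℝ → ℂ} (hy : ContDiffOn ℝ 2 y (Ioi 0))
    (hF : LocBdd F) (hFc : ContinuousOn F (Ioi 0)) (hyb : LocBdd y)
    (hode : ∀ r : ℝ, 0 < r →
      deriv (deriv y) r + (1 / (r : ℂ)) * deriv y r = κ ^ 2 / (r : ℂ) ^ 2 * y r + F r)
    {R : ℝ} (hR : 1 ≤ R) (h1 : IntegrableOn (fun r => r * ‖deriv y r‖ ^ 2) (Ioi R))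
    (h3 : IntegrableOn (fun r => r ^ 3 * ‖y r‖ ^ 2) (Ioi R))
    (hE : MemLp (fun r : ℝ => -(1 / 2) * F r + (r : ℂ) ^ 2 / 2 * y r) 2 radialMeasure) :
    ModeProfile κ y F := by
  obtain ⟨c, hreg⟩ := exists_regularSol hy hF hFc hyb hode
  obtain ⟨B, hB⟩ := hreg.norm_le hF
  obtain ⟨B', hB0', hB'⟩ := hyb 2
  have hR0 : 0 < R := by linarith
  have hn : ∀ r : ℝ, 0 < r → ‖(κ : ℂ) / (r : ℂ) * y r‖ = κ * ‖y r‖ / r := fun r hr => by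
    rw [norm_mul, norm_div, Complex.norm_natCast, Complex.norm_real, Real.norm_of_nonneg hr.le]
    ring
  have hbound : ∀ r : ℝ, 0 < r → r ≤ 1 → ‖y r‖ ≤ max B B' ∧
      ‖(κ : ℂ) / (r : ℂ) * y r‖ ≤ max B B' ∧ ‖deriv y r‖ ≤ max B B' := fun r hr hr1 =>
    ⟨(hB' r hr (by linarith)).trans (le_max_right _ _),
      ((hn r hr).trans_le (hB r hr hr1).1).trans (le_max_left _ _),
      (hB r hr hr1).2.trans (le_max_left _ _)⟩
  have hev : ∀ᶠ r in 𝓝[>] (0 : ℝ), 0 < r ∧ r ≤ 1 := by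
    filter_upwards [Ioc_mem_nhdsGT (zero_lt_one (α := ℝ))] with r hr using hr
  have hdc := continuousOn_deriv_of_contDiffOn hy
  have hyc := hy.continuousOn
  have hinv : ContinuousOn (fun r : ℝ => (κ : ℂ) / (r : ℂ) * y r) (Ioi 0) :=
    (continuousOn_const.div Complex.continuous_ofReal.continuousOn fun r hr =>
      Complex.ofReal_ne_zero.2 (ne_of_gt hr)).mul hyc
  refine ⟨hy, hode, ⟨_, hbound⟩, memLp_of_integrableOn_cube hyc hyb hR h3, ?_, ?_, ?_, hE⟩
  · refine memLp_radialMeasure (Complex.continuous_ofReal.continuousOn.mul hyc)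
      (LocBdd.mul (F := fun r : ℝ => (r : ℂ)) (fun R => ⟨|R|, abs_nonneg R, fun r hr hrR => ?_⟩)
        hyb) hR0 h3 fun r hr => ?_
    · rw [Complex.norm_real, Real.norm_of_nonneg hr.le]
      exact hrR.le.trans (le_abs_self R)
    · rw [norm_mul, Complex.norm_real, mul_pow, Real.norm_eq_abs, sq_abs]
      exact le_of_eq (by ring)
  · refine memLp_radialMeasure hdc (.of_continuousOn hdc ⟨max B B', ?_⟩) hR0 h1 fun r hr => le_rfl
    · filter_upwards [hev] with r hr using (hbound r hr.1 hr.2).2.2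
  · refine memLp_radialMeasure hinv (.of_continuousOn hinv ⟨max B B', ?_⟩) hR0
      (h3.const_mul ((κ : ℝ) ^ 2)) fun r hr => ?_
    · filter_upwards [hev] with r hr using (hbound r hr.1 hr.2).2.1
    · have h1 : 1 ≤ r := hR.trans hr.le
      rw [hn r (by linarith), div_pow, mul_pow]
      have h2 : r * (((κ : ℝ) ^ 2 * ‖y r‖ ^ 2) / r ^ 2) ≤ r * ((κ : ℝ) ^ 2 * ‖y r‖ ^ 2) := by
        gcongr
        exact div_le_self (by positivity) (one_le_pow₀ h1)
      have h3 : r ≤ r ^ 3 := le_self_pow₀ h1 (by norm_num)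
      calc _ ≤ _ := h2
        _ ≤ r ^ 3 * ((κ : ℝ) ^ 2 * ‖y r‖ ^ 2) := by gcongr
        _ = _ := by ring

theorem IsPairMode.modeProfile (hw : IsVortexProfile m μ w) (h : IsPairMode m μ w j lam yp ym) :
    ModeProfile (j + m).natAbs yp (source μ w lam yp ym) ∧
      ModeProfile (j - m).natAbs ym (source μ w (-lam) ym yp) := by
  obtain ⟨hp, hm, op, om⟩ := isPairSolution_iff.1 h.solution
  obtain ⟨bp, bm⟩ := h.locBdd
  obtain ⟨R, hR, ⟨ip1, ip3⟩, im1, im3⟩ := h.exists_integrableOn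
  have cp := hp.continuousOn
  have cm := hm.continuousOn
  have lp := memLp_of_integrableOn_cube cp bp hR ip3
  have lm := memLp_of_integrableOn_cube cm bm hR im3
  exact ⟨modeProfile_of_ode hp (hw.locBdd_source lam bp bm) (hw.continuousOn_source lam cp cm) bp op
      hR ip1 ip3 (hw.memLp_energy lam lp lm),
    modeProfile_of_ode hm (hw.locBdd_source (-lam) bm bp) (hw.continuousOn_source (-lam) cm cp) bm
      om hR im1 im3 (hw.memLp_energy (-lam) lm lp)⟩

theorem HasWeakPartial.add {i : Fin 2} {Ψ₁ Ψ₂ D₁ D₂ : L2} (h₁ : HasWeakPartial i Ψ₁ D₁)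
    (h₂ : HasWeakPartial i Ψ₂ D₂) : HasWeakPartial i (Ψ₁ + Ψ₂) (D₁ + D₂) := by
  intro φ hφ hc
  have hφ1 : ContDiff ℝ 1 φ := hφ.of_le (by simp)
  have key : ∀ (f : Plane → ℝ) (A B : L2), Continuous f → HasCompactSupport f →
      ∫ x, f x • (A + B : L2) x = (∫ x, f x • A x) + ∫ x, f x • B x := by
    intro f A B hf hfc
    rw [← integral_add ((locallyIntegrable_coe A).integrable_smul_left_of_hasCompactSupport hf hfc)
      ((locallyIntegrable_coe B).integrable_smul_left_of_hasCompactSupport hf hfc)]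
    refine integral_congr_ae ?_
    filter_upwards [Lp.coeFn_add A B] with x hx
    rw [hx, Pi.add_apply, smul_add]
  have e1 := key (pderiv i φ) Ψ₁ Ψ₂ (continuous_pderiv hφ1) (hasCompactSupport_pderiv hc)
  have e2 := key φ D₁ D₂ hφ.continuous hc
  rw [e2, neg_add, ← h₁ φ hφ hc, ← h₂ φ hφ hc]
  exact e1

theorem LcEq.add {Ψ₁ Ψ₂ G₁ G₂ : L2} (h₁ : LcEq Ψ₁ G₁) (h₂ : LcEq Ψ₂ G₂) :
    LcEq (Ψ₁ + Ψ₂) (G₁ + G₂) := by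
  obtain ⟨D₁, ⟨hD₁, hw₁⟩, hq₁⟩ := h₁
  obtain ⟨D₂, ⟨hD₂, hw₂⟩, hq₂⟩ := h₂
  refine ⟨fun i => D₁ i + D₂ i, ⟨fun i => (hD₁ i).add (hD₂ i), ?_⟩, fun X DX hX => ?_⟩
  · refine (hw₁.add hw₂).ae_eq ?_
    filter_upwards [Lp.coeFn_add Ψ₁ Ψ₂] with x hx
    rw [hx, Pi.add_apply, Pi.add_apply, smul_add]
  · rw [inner_add_right, ← hq₁ X DX hX, ← hq₂ X DX hX]
    have hint : ∀ (Ψ : L2) (D : Fin 2 → L2), MemLp (fun x : Plane => ‖x‖ • Ψ x) 2 volume →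
        Integrable fun x : Plane => ((1 / 2 : ℂ) * ∑ i, inner ℂ (DX i x) (D i x)
          + ((‖x‖ ^ 2 / 2 : ℝ) : ℂ) * inner ℂ (X x) (Ψ x)) := by
      intro Ψ D hΨ
      refine ((integrable_finsetSum _ fun i _ => L2.integrable_inner (DX i) (D i)).const_mul _).add
        ?_
      refine ((L2.integrable_inner (hX.weighted.toLp _) (hΨ.toLp _)).const_mul (1 / 2 : ℂ)).congr ?_
      filter_upwards [hX.weighted.coeFn_toLp, hΨ.coeFn_toLp] with x e1 e2
      rw [e1, e2, ← Complex.coe_smul, ← Complex.coe_smul, inner_smul_left, inner_smul_right,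
        Complex.conj_ofReal]
      push_cast
      ring
    rw [harmonicForm, harmonicForm, harmonicForm,
      ← integral_add (hint Ψ₁ D₁ hw₁) (hint Ψ₂ D₂ hw₂)]
    refine integral_congr_ae ?_
    have hD : ∀ᵐ x, ∀ i, (D₁ i + D₂ i : L2) x = D₁ i x + D₂ i x :=
      ae_all_iff.2 fun i => Lp.coeFn_add _ _
    filter_upwards [Lp.coeFn_add Ψ₁ Ψ₂, hD] with x e1 e2
    rw [e1]
    simp only [e2, Pi.add_apply, inner_add_right, Finset.sum_add_distrib]
    ring

end

/-! ### The eigenfunction of a mode, and the symmetries of the pair system -/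

section

variable {m : ℤ} {μ : ℝ} {w : ℝ → ℝ} {lam : ℂ} {j : ℤ} {yp ym : ℝ → ℂ}

theorem angularMode_add (k l : ℤ) (x : Plane) :
    angularMode (k + l) x = angularMode k x * angularMode l x := by
  rw [angularMode, angularMode, angularMode, ← Complex.exp_add]
  push_cast
  ring_nf

theorem eq_zero_of_ae_eq_zero {y : ℝ → ℂ} (hy : ContinuousOn y (Ioi 0))
    (h : ∀ᵐ x : Plane, y ‖x‖ = 0) {r : ℝ} (hr : 0 < r) : y r = 0 := by
  have hc : ContinuousOn (fun x : Plane => y ‖x‖) {0}ᶜ :=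
    hy.comp continuous_norm.continuousOn fun x hx => norm_pos_iff.2 hx
  have h1 := Measure.eqOn_open_of_ae_eq (μ := volume) (g := fun _ => (0 : ℂ))
    (ae_restrict_of_ae h) isOpen_compl_singleton hc continuousOn_const
  set x : Plane := EuclideanSpace.single 0 r with hx
  have hn : ‖x‖ = r := by rw [hx, PiLp.norm_single, Real.norm_of_nonneg hr.le]
  have h2 := h1 (x := x) (mem_compl_singleton_iff.2 (norm_pos_iff.1 (hn ▸ hr)))
  simpa only [hn] using h2

/-- L_c sends each of the two mode fields to a field with the same angular factor, so the eigenvalue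
relation can be checked pointwise in the basis diagonalizing J. Nontriviality survives because the
profiles are continuous. -/
theorem IsPairMode.exists_eigenfunction (hw : IsVortexProfile m μ w)
    (h : IsPairMode m μ w j lam yp ym) {C : ℂ} (hC : C ≠ 0) :
    ∃ Φ : L2, IsEigenfunction m μ w lam Φ ∧ ∀ᵐ x : Plane, Φ x = C • modeVector m j yp ym x := by
  obtain ⟨hp, hm⟩ := h.modeProfile hw
  set ep : C2 := C • !₂[1 / 2, -Complex.I / 2] with hep
  set em : C2 := C • !₂[1 / 2, Complex.I / 2] with hem
  set gp : ℝ → ℂ := fun r => -(1 / 2) * source μ w lam yp ym r + (r : ℂ) ^ 2 / 2 * yp r with hgp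
  set gm : ℝ → ℂ := fun r => -(1 / 2) * source μ w (-lam) ym yp r + (r : ℂ) ^ 2 / 2 * ym r with hgm
  have memΓ : ∀ (k : ℤ) (g : ℝ → ℂ) (e : C2), MemLp g 2 radialMeasure →
      MemLp (fun x => (angularMode k x * g ‖x‖) • e) 2 (volume : Measure Plane) := by
    intro k g e hg
    have := memLp_angularMode_mul k hg
    exact (this.norm.mul_const ‖e‖).of_le (this.1.smul_const e) (ae_of_all _ fun x => by
      simp [norm_smul])
  set Ψp : L2 := (hp.memLp_modeField_smul ep).toLp _
  set Ψm : L2 := (hm.memLp_modeField_smul em).toLp _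
  set Γp : L2 := (memΓ (j + m) gp ep hp.memLp_energy).toLp _
  set Γm : L2 := (memΓ (j - m) gm em hm.memLp_energy).toLp _
  have hΨp : ∀ᵐ x, Ψp x = modeField (j + m) yp x • ep := (hp.memLp_modeField_smul ep).coeFn_toLp
  have hΨm : ∀ᵐ x, Ψm x = modeField (j - m) ym x • em := (hm.memLp_modeField_smul em).coeFn_toLp
  have hΓp : ∀ᵐ x, Γp x = (angularMode (j + m) x * gp ‖x‖) • ep := MemLp.coeFn_toLp _
  have hΓm : ∀ᵐ x, Γm x = (angularMode (j - m) x * gm ‖x‖) • em := MemLp.coeFn_toLp _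
  have hL : LcEq (Ψp + Ψm) (Γp + Γm) := (hp.lcEq hΨp hΓp).add (hm.lcEq hΨm hΓm)
  have hΦ : ∀ᵐ x, (Ψp + Ψm : L2) x = C • modeVector m j yp ym x := by
    filter_upwards [Lp.coeFn_add Ψp Ψm, hΨp, hΨm, ae_ne_zero] with x h1 h2 h3 hx
    rw [h1, Pi.add_apply, h2, h3, modeField_eq hx, modeField_eq hx, modeVector, smul_add,
      smul_comm C, smul_comm C]
  have hG : ∀ᵐ x, (Γp + Γm : L2) x = C • modeVector m j gp gm x := by
    filter_upwards [Lp.coeFn_add Γp Γm, hΓp, hΓm] with x h1 h2 h3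
    rw [h1, Pi.add_apply, h2, h3, modeVector, smul_add, smul_comm C, smul_comm C]
  refine ⟨Ψp + Ψm, ⟨fun h0 => ?_, Γp + Γm, hL, ?_⟩, hΦ⟩
  · have hz : ∀ᵐ x : Plane, yp ‖x‖ = 0 ∧ ym ‖x‖ = 0 := by
      rw [h0] at hΦ
      filter_upwards [hΦ, Lp.coeFn_zero C2 2 (volume : Measure Plane)] with x h1 h2
      have h3 : modeVector m j yp ym x = 0 :=
        (smul_eq_zero.1 (h1.symm.trans h2)).resolve_left hC
      have hne : ∀ k, angularMode k x ≠ 0 := fun k => by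
        rw [← norm_ne_zero_iff, norm_angularMode]; exact one_ne_zero
      have h4 := inner_ePlus_modeVector m j yp ym x
      have h5 := inner_eMinus_modeVector m j yp ym x
      rw [h3, inner_zero_right] at h4 h5
      exact ⟨(mul_eq_zero.1 h4.symm).resolve_left (hne _),
        (mul_eq_zero.1 h5.symm).resolve_left (hne _)⟩
    obtain ⟨r, hr, hr'⟩ := h.nontrivial
    rcases hr' with hr' | hr'
    · exact hr' (eq_zero_of_ae_eq_zero hp.contDiffOn.continuousOn (hz.mono fun _ h => h.1) hr)
    · exact hr' (eq_zero_of_ae_eq_zero hm.contDiffOn.continuousOn (hz.mono fun _ h => h.2) hr)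
  · filter_upwards [Lp.coeFn_smul lam (Ψp + Ψm), hΦ, hG] with x h1 h2 h3
    rw [h1, Pi.smul_apply]
    refine (eigen_pointwise_iff m μ w lam x _ _).2 ?_
    rw [h2, h3]
    simp only [inner_smul_right, inner_ePlus_modeVector, inner_eMinus_modeVector, hgp, hgm,
      energy_source_eq]
    -- The factors e^{±2imθ} of the potential carry the index j - m to j + m and back, which closes
    -- the system.
    have a1 := angularMode_add (2 * m) (j - m) x
    have a2 := angularMode_add (-(2 * m)) (j + m) x
    rw [show 2 * m + (j - m) = j + m by ring] at a1
    rw [show -(2 * m) + (j + m) = j - m by ring] at a2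
    constructor
    · linear_combination (-((|w ‖x‖| ^ 2 : ℝ) : ℂ)) * C * ym ‖x‖ * a1
    · linear_combination (-((|w ‖x‖| ^ 2 : ℝ) : ℂ)) * C * yp ‖x‖ * a2

theorem radialOp_neg (k : ℤ) (μ : ℝ) (y : ℝ → ℂ) (r : ℝ) :
    radialOp (-k) μ y r = radialOp k μ y r := by
  simp [radialOp]

theorem deriv_conj_comp (y : ℝ → ℂ) :
    deriv (fun r => conj (y r)) = fun r => conj (deriv y r) :=
  funext fun _ => deriv.star

theorem radialOp_conj (k : ℤ) (μ : ℝ) (y : ℝ → ℂ) (r : ℝ) :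
    radialOp k μ (fun r => conj (y r)) r = conj (radialOp k μ y r) := by
  simp only [radialOp, deriv_conj_comp]
  simp [Complex.conj_ofNat]

/-- The coupling matrix is invariant under exchange of components while R changes sign; -j ± m = -(j
∓ m), and indices enter squared. -/
theorem IsPairSolution.swap (h : IsPairSolution m μ w j lam yp ym) :
    IsPairSolution m μ w (-j) (-lam) ym yp := by
  refine ⟨h.contDiffOn_minus, h.contDiffOn_plus, fun r hr => ?_, fun r hr => ?_⟩
  · rw [show -j + m = -(j - m) by ring, radialOp_neg]
    linear_combination h.equation_minus r hr
  · rw [show -j - m = -(j + m) by ring, radialOp_neg]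
    linear_combination h.equation_plus r hr

/-- Conjugation sends iλ to -i times the conjugate of λ, and the exchange of components reverses
this sign once more. -/
theorem IsPairSolution.conj_swap (h : IsPairSolution m μ w j lam yp ym) :
    IsPairSolution m μ w (-j) (conj lam) (fun r => conj (ym r)) (fun r => conj (yp r)) := by
  refine ⟨Complex.conjCLE.contDiff.comp_contDiffOn h.contDiffOn_minus,
    Complex.conjCLE.contDiff.comp_contDiffOn h.contDiffOn_plus, fun r hr => ?_, fun r hr => ?_⟩
  · have e := congrArg conj (h.equation_minus r hr)
    simp only [map_add, map_mul, map_neg, Complex.conj_ofReal, Complex.conj_I,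
      Complex.conj_ofNat] at e
    rw [show -j + m = -(j - m) by ring, radialOp_neg, radialOp_conj]
    linear_combination e
  · have e := congrArg conj (h.equation_plus r hr)
    simp only [map_add, map_mul, Complex.conj_ofReal, Complex.conj_I,
      Complex.conj_ofNat] at e
    rw [show -j - m = -(j + m) by ring, radialOp_neg, radialOp_conj]
    linear_combination e

theorem BoundaryCondition.conj {y : ℝ → ℂ} (h : BoundaryCondition y) :
    BoundaryCondition fun r => conj (y r) := by
  obtain ⟨⟨l, hl⟩, h0⟩ := h
  refine ⟨⟨_, (Complex.continuous_conj.tendsto l).comp hl⟩, ?_⟩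
  have h1 := (Complex.continuous_conj.tendsto 0).comp h0
  rwa [map_zero] at h1

theorem IsPairMode.swap (h : IsPairMode m μ w j lam yp ym) :
    IsPairMode m μ w (-j) (-lam) ym yp :=
  ⟨h.solution.swap, h.boundary_minus, h.boundary_plus,
    let ⟨r, hr, h'⟩ := h.nontrivial; ⟨r, hr, h'.symm⟩⟩

theorem IsPairMode.conj_swap (h : IsPairMode m μ w j lam yp ym) :
    IsPairMode m μ w (-j) (conj lam) (fun r => conj (ym r)) (fun r => conj (yp r)) :=
  ⟨h.solution.conj_swap, h.boundary_minus.conj, h.boundary_plus.conj, by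
    obtain ⟨r, hr, h'⟩ := h.nontrivial
    exact ⟨r, hr, h'.symm.imp (by simp) (by simp)⟩⟩

end

end GPVortex

end


theorem proposition4p2 (m : ℤ) (hm : 1 ≤ m) (μ : ℝ) (w : ℝ → ℝ)
    (hw : IsVortexProfile m μ w) :
    -- eigenvalues are exactly the numbers for which some radial pair system has a mode
    (∀ lam : ℂ, IsEigenvalue m μ w lam ↔
      ∃ (j : ℤ) (yp ym : ℝ → ℂ), IsPairMode m μ w j lam yp ym) ∧
    -- every mode gives an eigenfunction of the stated form
    (∀ (lam : ℂ) (j : ℤ) (yp ym : ℝ → ℂ) (C : ℂ),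
      IsPairMode m μ w j lam yp ym → C ≠ 0 →
      ∃ Φ : L2, IsEigenfunction m μ w lam Φ ∧
        (∀ᵐ x : Plane, Φ x = C • modeVector m j yp ym x) ∧
        ∀ t : ℝ, ∀ᵐ x : Plane,
          perturbation lam Φ t x = modePerturbation m j lam C yp ym t x) ∧
    -- every eigenfunction has the stated form, with one term for each index that occurs
    (∀ (lam : ℂ) (Φ : L2), IsEigenfunction m μ w lam Φ →
      ∃ (S : Finset ℤ) (C : ℤ → ℂ) (yp ym : ℤ → ℝ → ℂ), S.Nonempty ∧
        (∀ j ∈ S, C j ≠ 0 ∧ IsPairMode m μ w j lam (yp j) (ym j)) ∧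
        (∀ᵐ x : Plane, Φ x = ∑ j ∈ S, C j • modeVector m j (yp j) (ym j) x) ∧
        ∀ t : ℝ, ∀ᵐ x : Plane, perturbation lam Φ t x =
          ∑ j ∈ S, modePerturbation m j lam (C j) (yp j) (ym j) t x) ∧
    -- symmetries of the pair systems
    (∀ (lam : ℂ) (j : ℤ) (yp ym : ℝ → ℂ), IsPairSolution m μ w j lam yp ym →
      IsPairSolution m μ w (-j) (-lam) ym yp ∧
      IsPairSolution m μ w (-j) (conj lam) (fun r => conj (ym r)) (fun r => conj (yp r))) ∧
    -- the symmetries respect non-triviality and the boundary conditions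
    (∀ (lam : ℂ) (j : ℤ) (yp ym : ℝ → ℂ), IsPairMode m μ w j lam yp ym →
      IsPairMode m μ w (-j) (-lam) ym yp ∧
      IsPairMode m μ w (-j) (conj lam) (fun r => conj (ym r)) (fun r => conj (yp r))) := by
  refine ⟨fun lam => ⟨fun ⟨Φ, hΦ⟩ => ?_, fun ⟨j, yp, ym, h⟩ => ?_⟩,
    fun lam j yp ym C h hC => ?_, fun lam Φ h => ?_, fun lam j yp ym h => ⟨h.swap, h.conj_swap⟩,
    fun lam j yp ym h => ⟨h.swap, h.conj_swap⟩⟩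
  · obtain ⟨S, C, yp, ym, ⟨j, hj⟩, hS, -⟩ := hΦ.exists_modes hw
    exact ⟨j, yp j, ym j, (hS j hj).2⟩
  · obtain ⟨Φ, hΦ, -⟩ := h.exists_eigenfunction hw one_ne_zero
    exact ⟨Φ, hΦ⟩
  · obtain ⟨Φ, hΦ, he⟩ := h.exists_eigenfunction hw hC
    refine ⟨Φ, hΦ, he, fun t => ?_⟩
    filter_upwards [he] with x hx
    -- A single mode is read as a sum over {j} with constant families, so that `perturbation_eq_sum`
    -- applies.
    have hx' : Φ x = ∑ i ∈ {j}, (fun _ => C) i • modeVector m i ((fun _ => yp) i)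
        ((fun _ => ym) i) x := by rw [hx, Finset.sum_singleton]
    rw [perturbation_eq_sum hx' t, Finset.sum_singleton]
  · obtain ⟨S, C, yp, ym, hne, hS, he⟩ := h.exists_modes hw
    refine ⟨S, C, yp, ym, hne, hS, he, fun t => ?_⟩
    filter_upwards [he] with x hx using perturbation_eq_sum hx t
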